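/- **Theorem.** There is a deterministic algorithm whose input consists of an integer $k\ge 1$ and a weighted undirected graph $G=(V,E,w)$ with $n=|V|\ge 1$ vertices, $m=|E|$ edges and non-negative real edge weights, and whose output is an $n\times n$ matrix $\hat\delta$ with entries in $[0,\infty]$, such that the following holds. 1. (Stretch.) For all $u,v\in V$, $$d_G(u,v)\;\le\;\hat\delta(u,v)\;\le\; d_G(u,v)+2(k-1)\cdot W(u,v).$$ Here $d_G(u,v)$ is the weighted distance ($\infty$ if $u$ and $v$ are not connected), and $W(u,v)$ is the weight of the heaviest edge on a shortest $u$–$v$ path (the bound holds for every choice of the shortest path, and $W(u,u)=0$). If $u$ and $v$ are not connected, the claim is $\hat\delta(u,v)=\infty$. 2. (Running time.) If $k=O(\log n)$ and $m\ge n$, the algorithm runs in time $\tilde O\big(n^{2-1/k}\,m^{1/k}\big)$; without the assumption $m\ge n$ this holds with $m$ replaced by $\max(n,m)$. Precisely: for every real $a$ there are constants $C,d$ such that for all inputs with $k\le a\,(1+\ln n)$ the algorithm stops after at most $$C\cdot n^{2-1/k}\cdot\max(n,m)^{1/k}\cdot(1+\ln n)^{d}$$ steps. The model of computation is a random access machine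 with words of $c\log_2(n+k+2)$ bits, for a constant $c$ that depends only on the algorithm. Word operations (addition, truncated subtraction, multiplication, integer division, comparison, indirect addressing) and copying, adding and comparing weights in $[0,\infty]$ each cost one step. The graph is given as a list of its edges with their weights, in arbitrary order; the vertices are $0,\dots,n-1$. -/

import Mathlib

open scoped NNReal ENNReal

namespace APASP

/-! ### Weighted graphs

A weighted undirected graph is a simple graph `G` together with non-negative real weights on
unordered pairs of vertices. Only the weights of the edges of `G` are ever used. -/

section Graph

variable {V : Type*}

/-- `w(p)`, the total weight of the edges of the walk `p`. -/
noncomputable def walkWeight (w : Sym2 V → ℝ≥0) {G : SimpleGraph V} {u v : V}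
    (p : G.Walk u v) : ℝ≥0 :=
  (p.edges.map w).sum

/-- `W(p)`, the weight of the heaviest edge of the walk `p` (`0` if `p` has no edge). -/
noncomputable def heaviest (w : Sym2 V → ℝ≥0) {G : SimpleGraph V} {u v : V}
    (p : G.Walk u v) : ℝ≥0 :=
  (p.edges.map w).foldr max 0

/-- The weighted distance `d_G(u, v)`; it is `∞` if `u` and `v` are not connected. -/
noncomputable def wdist (G : SimpleGraph V) (w : Sym2 V → ℝ≥0) (u v : V) : ℝ≥0∞ :=
  ⨅ p : G.Walk u v, (walkWeight w p : ℝ≥0∞)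

/-- `p` is a shortest path from `u` to `v`. -/
def IsShortestPath (G : SimpleGraph V) (w : Sym2 V → ℝ≥0) {u v : V} (p : G.Walk u v) : Prop :=
  p.IsPath ∧ (walkWeight w p : ℝ≥0∞) = wdist G w u v

/-- The list `e` enumerates the edges of `G`, each exactly once, in an arbitrary order and with
arbitrary orientations. In particular `m` is the number of edges of `G`. -/
def IsEdgeList {m : ℕ} (G : SimpleGraph V) (e : Fin m → V × V) : Prop :=
  Function.Injective (fun i => s((e i).1, (e i).2)) ∧
    Set.range (fun i => s((e i).1, (e i).2)) = G.edgeSet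

end Graph

/-! ### The machine model

A random access machine with two kinds of cells:
* cells for natural numbers (machine words), with addition, truncated subtraction,
  multiplication, division with rounding down (`x / 0 = 0`), comparison and indirect addressing;
* cells for weights in `[0, ∞]`, which can only be copied, added and compared
  (the comparison-addition model); the only weight constants are `0` and `∞`.

There are registers and arrays of both kinds. A program is a finite piece of syntax, so it names
only finitely many registers and arrays; the index into an array is computed at run time. -/

/-- The contents of the memory. -/
structure State where
  /-- word registers -/
  reg : ℕ → ℕ
  /-- word arrays: `arr a i` is the `i`-th cell of the array `a` -/
  arr : ℕ → ℕ → ℕ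
  /-- weight registers -/
  wreg : ℕ → ℝ≥0∞
  /-- weight arrays -/
  warr : ℕ → ℕ → ℝ≥0∞

/-- Word expressions. -/
inductive NExp where
  | const (c : ℕ)
  | reg (x : ℕ)
  | get (a : ℕ) (i : NExp)
  | add (e f : NExp)
  | sub (e f : NExp)
  | mul (e f : NExp)
  | div (e f : NExp)

/-- The value of a word expression. -/
def NExp.eval (σ : State) : NExp → ℕ
  | .const c => c
  | .reg x => σ.reg x
  | .get a i => σ.arr a (i.eval σ)
  | .add e f => e.eval σ + f.eval σ
  | .sub e f => e.eval σ - f.eval σ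
  | .mul e f => e.eval σ * f.eval σ
  | .div e f => e.eval σ / f.eval σ

/-- The number of elementary operations in a word expression. -/
def NExp.size : NExp → ℕ
  | .const _ => 1
  | .reg _ => 1
  | .get _ i => i.size + 1
  | .add e f => e.size + f.size + 1
  | .sub e f => e.size + f.size + 1
  | .mul e f => e.size + f.size + 1
  | .div e f => e.size + f.size + 1

/-- Weight expressions. -/
inductive WExp where
  | zero
  | infty
  | reg (x : ℕ)
  | get (a : ℕ) (i : NExp)
  | add (e f : WExp)

/-- The value of a weight expression. -/
noncomputable def WExp.eval (σ : State) : WExp → ℝ≥0∞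
  | .zero => 0
  | .infty => ⊤
  | .reg x => σ.wreg x
  | .get a i => σ.warr a (i.eval σ)
  | .add e f => e.eval σ + f.eval σ

/-- The number of elementary operations in a weight expression. -/
def WExp.size : WExp → ℕ
  | .zero => 1
  | .infty => 1
  | .reg _ => 1
  | .get _ i => i.size + 1
  | .add e f => e.size + f.size + 1

/-- Tests. -/
inductive Test where
  | lt (e f : NExp)
  | eq (e f : NExp)
  | wlt (e f : WExp)
  | not (b : Test)
  | and (b b' : Test)

/-- The truth value of a test. -/
def Test.Holds (σ : State) : Test → Prop
  | .lt e f => e.eval σ < f.eval σ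
  | .eq e f => e.eval σ = f.eval σ
  | .wlt e f => e.eval σ < f.eval σ
  | .not b => ¬ b.Holds σ
  | .and b b' => b.Holds σ ∧ b'.Holds σ

/-- The number of elementary operations in a test. -/
def Test.size : Test → ℕ
  | .lt e f => e.size + f.size + 1
  | .eq e f => e.size + f.size + 1
  | .wlt e f => e.size + f.size + 1
  | .not b => b.size + 1
  | .and b b' => b.size + b'.size + 1

/-- Programs. -/
inductive Prog where
  | skip
  | setReg (x : ℕ) (e : NExp)
  | setArr (a : ℕ) (i e : NExp)
  | setWReg (x : ℕ) (e : WExp)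
  | setWArr (a : ℕ) (i : NExp) (e : WExp)
  | seq (p q : Prog)
  | ite (b : Test) (p q : Prog)
  | loop (b : Test) (p : Prog)

/-- `Exec B p σ t τ`: the program `p`, started in the state `σ` on a machine whose words hold the
numbers below `B`, stops in the state `τ` after exactly `t` elementary operations.

Every number stored in a word cell, and every address written to, has to be below `B`; an
execution that violates this is stuck and does not stop in any state. (Within one expression,
whose size is fixed by the program, intermediate values take a constant number of words.) -/
inductive Exec (B : ℕ) : Prog → State → ℕ → State → Prop
  | skip (σ : State) : Exec B .skip σ 1 σ
  | setReg (σ : State) (x : ℕ) (e : NExp) (he : e.eval σ < B) :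
      Exec B (.setReg x e) σ (e.size + 1)
        { σ with reg := Function.update σ.reg x (e.eval σ) }
  | setArr (σ : State) (a : ℕ) (i e : NExp) (hi : i.eval σ < B) (he : e.eval σ < B) :
      Exec B (.setArr a i e) σ (i.size + e.size + 1)
        { σ with
          arr := Function.update σ.arr a (Function.update (σ.arr a) (i.eval σ) (e.eval σ)) }
  | setWReg (σ : State) (x : ℕ) (e : WExp) :
      Exec B (.setWReg x e) σ (e.size + 1)
        { σ with wreg := Function.update σ.wreg x (e.eval σ) }
  | setWArr (σ : State) (a : ℕ) (i : NExp) (e : WExp) (hi : i.eval σ < B) :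
      Exec B (.setWArr a i e) σ (i.size + e.size + 1)
        { σ with
          warr := Function.update σ.warr a (Function.update (σ.warr a) (i.eval σ) (e.eval σ)) }
  | seq {p q : Prog} {σ τ ρ : State} {s t : ℕ} (hp : Exec B p σ s τ) (hq : Exec B q τ t ρ) :
      Exec B (.seq p q) σ (s + t) ρ
  | iteTrue {b : Test} {p q : Prog} {σ τ : State} {t : ℕ} (hb : b.Holds σ)
      (hp : Exec B p σ t τ) : Exec B (.ite b p q) σ (b.size + 1 + t) τ
  | iteFalse {b : Test} {p q : Prog} {σ τ : State} {t : ℕ} (hb : ¬ b.Holds σ)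
      (hq : Exec B q σ t τ) : Exec B (.ite b p q) σ (b.size + 1 + t) τ
  | loopStop {b : Test} {p : Prog} {σ : State} (hb : ¬ b.Holds σ) :
      Exec B (.loop b p) σ (b.size + 1) σ
  | loopStep {b : Test} {p : Prog} {σ τ ρ : State} {s t : ℕ} (hb : b.Holds σ)
      (hp : Exec B p σ s τ) (hl : Exec B (.loop b p) τ t ρ) :
      Exec B (.loop b p) σ (b.size + 1 + s + t) ρ

/-- The machine is deterministic: the final state and the number of operations are determined by
the program and the initial state. -/
theorem Exec.deterministic {B : ℕ} {p : Prog} {σ τ τ' : State} {t t' : ℕ}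
    (h : Exec B p σ t τ) (h' : Exec B p σ t' τ') : t = t' ∧ τ = τ' := by
  induction h generalizing t' τ' with
  | skip => cases h'; exact ⟨rfl, rfl⟩
  | setReg => cases h'; exact ⟨rfl, rfl⟩
  | setArr => cases h'; exact ⟨rfl, rfl⟩
  | setWReg => cases h'; exact ⟨rfl, rfl⟩
  | setWArr => cases h'; exact ⟨rfl, rfl⟩
  | seq _ _ ih1 ih2 =>
    cases h' with
    | seq h1 h2 =>
      obtain ⟨rfl, rfl⟩ := ih1 h1
      obtain ⟨rfl, rfl⟩ := ih2 h2
      exact ⟨rfl, rfl⟩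
  | iteTrue hb _ ih =>
    cases h' with
    | iteTrue _ h1 => obtain ⟨rfl, rfl⟩ := ih h1; exact ⟨rfl, rfl⟩
    | iteFalse hb' _ => exact absurd hb hb'
  | iteFalse hb _ ih =>
    cases h' with
    | iteTrue hb' _ => exact absurd hb' hb
    | iteFalse _ h1 => obtain ⟨rfl, rfl⟩ := ih h1; exact ⟨rfl, rfl⟩
  | loopStop hb =>
    cases h' with
    | loopStop _ => exact ⟨rfl, rfl⟩
    | loopStep hb' _ _ => exact absurd hb' hb
  | loopStep hb _ _ ih1 ih2 =>
    cases h' with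
    | loopStop hb' => exact absurd hb hb'
    | loopStep _ h1 h2 =>
      obtain ⟨rfl, rfl⟩ := ih1 h1
      obtain ⟨rfl, rfl⟩ := ih2 h2
      exact ⟨rfl, rfl⟩

/-! ### Input and output conventions -/

/-- The initial state for the parameter `k` and the weighted graph on the vertices `0, …, n - 1`
whose edges are listed by `e`: the word registers `0`, `1`, `2` hold `n`, `m`, `k`; the cells
`i < m` of the word arrays `0` and `1` and of the weight array `0` hold the two end points and
the weight of the `i`-th edge; everything else is `0`. -/
noncomputable def inputState {n m : ℕ} (k : ℕ) (e : Fin m → Fin n × Fin n)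
    (w : Sym2 (Fin n) → ℝ≥0) : State where
  reg x := if x = 0 then n else if x = 1 then m else if x = 2 then k else 0
  arr a i :=
    if h : i < m then
      if a = 0 then (e ⟨i, h⟩).1 else if a = 1 then (e ⟨i, h⟩).2 else 0
    else 0
  wreg _ := 0
  warr a i :=
    if h : i < m then
      if a = 0 then (w s((e ⟨i, h⟩).1, (e ⟨i, h⟩).2) : ℝ≥0∞) else 0
    else 0

/-- The `n × n` output matrix, which is stored row by row in the weight array `1`. -/
def outputMatrix (n : ℕ) (τ : State) (u v : Fin n) : ℝ≥0∞ :=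
  τ.warr 1 (u * n + v)

end APASP

/-! Every vertex `y` lists itself and then its neighbours by increasing edge weight. The thresholds
are `s_j = min (r ^ j) n` for `j < k`, and `s_k = n + 1`, which exceeds the length of every list.
Level `j = k, …, 1` chooses centres that meet the first `s_{j-1}` entries of every list with at
least that many entries. From each centre `u` it runs Dijkstra's algorithm on the arcs `x → y` with
`x` among the first `s_j` entries of `y`, starting from all estimates between `u` and other vertices
known so far.

Stretch (`rowGood_of_stable`). Centres of level `j` have error at most `2(k-j)W` along every walk.
Let a walk to `u` begin with the edge `y x'`. If `x'` is among the first `s_j` entries of `y`, the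
arc `x' → y` is relaxed and the error for the rest of the walk carries over unchanged. Otherwise the
list of `y` is long, so its first `s_j` entries contain a centre `z` of level `j + 1`, and `w(y,z) ≤
w(y,x')`. The older estimate between `z` and `u`, applied to the detour `z, y, x', …`, has error
`2(k-j-1)W`, and walking from `y` to `z` and back costs at most `2W` more. The fallback settles the
whole remaining walk at once, so the `2W` is paid once per level and not once per edge. Level `k`
needs no fallback because `s_k` exceeds all lengths; since `s_0 = 1` and each list starts with its
owner, level `1` makes every vertex a centre. The lower bound holds because estimates only come from
relaxations, which respect the triangle inequality (`Frontier`, `dijkstra_spec`).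

Time. A greedy choice needs about `n log n / s_{j-1}` centres (`greedyBound`), and one run handles
`O(n s_j)` arcs with `s_j ≤ r s_{j-1}`; a level costs `O(n² r log² n)` (`level_cost_le`). At level
`k` there are `n + 2m` arcs, which `m / n + 1 ≤ r ^ k` keeps within the same bound. Minimality of
`r` gives `r ≤ 2 (max(n,m)/n)^{1/k}` (`sq_mul_le_rpow`), and the `k` levels contribute one more
logarithm.

Programs are verified by `Wp`, which combines termination, result and step count; loops pay for
their rounds from a potential (`wp_loop`). -/

namespace APASP

/-! ### State updates -/

namespace State

/-- Write a word register. -/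
def setR (σ : State) (x v : ℕ) : State := { σ with reg := Function.update σ.reg x v }

/-- Write a cell of a word array. -/
def setA (σ : State) (a i v : ℕ) : State :=
  { σ with arr := Function.update σ.arr a (Function.update (σ.arr a) i v) }

/-- Write a weight register. -/
def setW (σ : State) (x : ℕ) (v : ℝ≥0∞) : State :=
  { σ with wreg := Function.update σ.wreg x v }

/-- Write a cell of a weight array. -/
def setWA (σ : State) (a i : ℕ) (v : ℝ≥0∞) : State :=
  { σ with warr := Function.update σ.warr a (Function.update (σ.warr a) i v) }

variable (σ : State) (x y a b i v : ℕ) (c : ℝ≥0∞)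

@[simp] theorem setR_reg : (σ.setR x v).reg y = if y = x then v else σ.reg y := by
  simp [setR, Function.update_apply]
@[simp] theorem setR_arr : (σ.setR x v).arr = σ.arr := rfl
@[simp] theorem setR_wreg : (σ.setR x v).wreg = σ.wreg := rfl
@[simp] theorem setR_warr : (σ.setR x v).warr = σ.warr := rfl
@[simp] theorem setA_reg : (σ.setA a i v).reg = σ.reg := rfl
@[simp] theorem setA_arr : (σ.setA a i v).arr b =
    if b = a then Function.update (σ.arr a) i v else σ.arr b := by
  simp [setA, Function.update_apply]
@[simp] theorem setA_warr : (σ.setA a i v).warr = σ.warr := rfl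
@[simp] theorem setW_reg : (σ.setW x c).reg = σ.reg := rfl
@[simp] theorem setW_arr : (σ.setW x c).arr = σ.arr := rfl
@[simp] theorem setW_wreg : (σ.setW x c).wreg y = if y = x then c else σ.wreg y := by
  simp [setW, Function.update_apply]
@[simp] theorem setW_warr : (σ.setW x c).warr = σ.warr := rfl
@[simp] theorem setWA_reg : (σ.setWA a i c).reg = σ.reg := rfl
@[simp] theorem setWA_arr : (σ.setWA a i c).arr = σ.arr := rfl
@[simp] theorem setWA_wreg : (σ.setWA a i c).wreg = σ.wreg := rfl
@[simp] theorem setWA_warr : (σ.setWA a i c).warr b =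
    if b = a then Function.update (σ.warr a) i c else σ.warr b := by
  simp [setWA, Function.update_apply]

end State

/-! ### Frames -/

namespace Prog

/-- Does the program contain an assignment to the word register `x`? -/
def writesReg (x : ℕ) : Prog → Bool
  | .setReg y _ => y == x
  | .seq p q => p.writesReg x || q.writesReg x
  | .ite _ p q => p.writesReg x || q.writesReg x
  | .loop _ p => p.writesReg x
  | _ => false

/-- Does the program contain an assignment to the word array `a`? -/
def writesArr (a : ℕ) : Prog → Bool
  | .setArr b _ _ => b == a
  | .seq p q => p.writesArr a || q.writesArr a
  | .ite _ p q => p.writesArr a || q.writesArr a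
  | .loop _ p => p.writesArr a
  | _ => false

/-- Does the program contain an assignment to the weight register `x`? -/
def writesWReg (x : ℕ) : Prog → Bool
  | .setWReg y _ => y == x
  | .seq p q => p.writesWReg x || q.writesWReg x
  | .ite _ p q => p.writesWReg x || q.writesWReg x
  | .loop _ p => p.writesWReg x
  | _ => false

/-- Does the program contain an assignment to the weight array `a`? -/
def writesWArr (a : ℕ) : Prog → Bool
  | .setWArr b _ _ => b == a
  | .seq p q => p.writesWArr a || q.writesWArr a
  | .ite _ p q => p.writesWArr a || q.writesWArr a
  | .loop _ p => p.writesWArr a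
  | _ => false

end Prog

/-- The states `σ` and `τ` agree on everything that the program `p` does not assign to. -/
structure Frame (p : Prog) (σ τ : State) : Prop where
  reg : ∀ x, p.writesReg x = false → τ.reg x = σ.reg x
  arr : ∀ a, p.writesArr a = false → τ.arr a = σ.arr a
  wreg : ∀ x, p.writesWReg x = false → τ.wreg x = σ.wreg x
  warr : ∀ a, p.writesWArr a = false → τ.warr a = σ.warr a

namespace Frame

variable {p q : Prog} {b : Test} {σ τ ρ : State}

theorem refl (p : Prog) (σ : State) : Frame p σ σ :=
  ⟨fun _ _ => rfl, fun _ _ => rfl, fun _ _ => rfl, fun _ _ => rfl⟩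

theorem trans (h : Frame p σ τ) (h' : Frame p τ ρ) : Frame p σ ρ :=
  ⟨fun x hx => (h'.reg x hx).trans (h.reg x hx), fun x hx => (h'.arr x hx).trans (h.arr x hx),
    fun x hx => (h'.wreg x hx).trans (h.wreg x hx), fun x hx => (h'.warr x hx).trans (h.warr x hx)⟩

theorem seq_left (h : Frame p σ τ) : Frame (.seq p q) σ τ := by
  constructor
  · intro x hx; simp only [Prog.writesReg, Bool.or_eq_false_iff] at hx; exact h.reg x hx.1
  · intro x hx; simp only [Prog.writesArr, Bool.or_eq_false_iff] at hx; exact h.arr x hx.1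
  · intro x hx; simp only [Prog.writesWReg, Bool.or_eq_false_iff] at hx; exact h.wreg x hx.1
  · intro x hx; simp only [Prog.writesWArr, Bool.or_eq_false_iff] at hx; exact h.warr x hx.1

theorem seq_right (h : Frame q σ τ) : Frame (.seq p q) σ τ := by
  constructor
  · intro x hx; simp only [Prog.writesReg, Bool.or_eq_false_iff] at hx; exact h.reg x hx.2
  · intro x hx; simp only [Prog.writesArr, Bool.or_eq_false_iff] at hx; exact h.arr x hx.2
  · intro x hx; simp only [Prog.writesWReg, Bool.or_eq_false_iff] at hx; exact h.wreg x hx.2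
  · intro x hx; simp only [Prog.writesWArr, Bool.or_eq_false_iff] at hx; exact h.warr x hx.2

theorem ite_left (h : Frame p σ τ) : Frame (.ite b p q) σ τ :=
  ⟨(h.seq_left (q := q)).1, (h.seq_left (q := q)).2, (h.seq_left (q := q)).3,
    (h.seq_left (q := q)).4⟩

theorem ite_right (h : Frame q σ τ) : Frame (.ite b p q) σ τ :=
  ⟨(h.seq_right (p := p)).1, (h.seq_right (p := p)).2, (h.seq_right (p := p)).3,
    (h.seq_right (p := p)).4⟩

theorem loop (h : Frame p σ τ) : Frame (.loop b p) σ τ := ⟨h.1, h.2, h.3, h.4⟩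

end Frame

/-- Untouched memory is recognized syntactically: for a concrete program the side condition is
decided by `rfl`, so no specification has to list what it preserves. -/
theorem Exec.frame {B : ℕ} {p : Prog} {σ τ : State} {t : ℕ} (h : Exec B p σ t τ) :
    Frame p σ τ := by
  induction h with
  | skip σ => exact .refl _ _
  | setReg σ x e he =>
    refine ⟨fun y hy => ?_, fun _ _ => rfl, fun _ _ => rfl, fun _ _ => rfl⟩
    have : y ≠ x := by rintro rfl; simp [Prog.writesReg] at hy
    simp [this]
  | setArr σ x i e hi he =>
    refine ⟨fun _ _ => rfl, fun y hy => ?_, fun _ _ => rfl, fun _ _ => rfl⟩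
    have : y ≠ x := by rintro rfl; simp [Prog.writesArr] at hy
    simp [this]
  | setWReg σ x e =>
    refine ⟨fun _ _ => rfl, fun _ _ => rfl, fun y hy => ?_, fun _ _ => rfl⟩
    have : y ≠ x := by rintro rfl; simp [Prog.writesWReg] at hy
    simp [this]
  | setWArr σ x i e hi =>
    refine ⟨fun _ _ => rfl, fun _ _ => rfl, fun _ _ => rfl, fun y hy => ?_⟩
    have : y ≠ x := by rintro rfl; simp [Prog.writesWArr] at hy
    simp [this]
  | seq _ _ ih1 ih2 => exact ih1.seq_left.trans ih2.seq_right
  | iteTrue _ _ ih => exact ih.ite_left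
  | iteFalse _ _ ih => exact ih.ite_right
  | loopStop _ => exact .refl _ _
  | loopStep _ _ _ ih1 ih2 => exact ih1.loop.trans ih2

/-! ### Weakest preconditions with time -/

/-- The program `p`, started in `σ`, stops after some number `t` of steps in some state `τ` such
that `Q t τ`. -/
def Wp (B : ℕ) (p : Prog) (σ : State) (Q : ℕ → State → Prop) : Prop :=
  ∃ t τ, Exec B p σ t τ ∧ Q t τ

section Wp

variable {B : ℕ} {p q : Prog} {b : Test} {σ : State} {Q Q' : ℕ → State → Prop}

theorem Wp.mono (h : Wp B p σ Q) (hQ : ∀ t τ, Frame p σ τ → Q t τ → Q' t τ) : Wp B p σ Q' := by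
  obtain ⟨t, τ, he, hq⟩ := h
  exact ⟨t, τ, he, hQ t τ he.frame hq⟩

theorem wp_skip : Wp B .skip σ Q ↔ Q 1 σ := by
  constructor
  · rintro ⟨t, τ, he, hq⟩; cases he; exact hq
  · exact fun h => ⟨_, _, .skip σ, h⟩

theorem wp_setReg {x : ℕ} {e : NExp} : Wp B (.setReg x e) σ Q ↔
    e.eval σ < B ∧ Q (e.size + 1) (σ.setR x (e.eval σ)) := by
  constructor
  · rintro ⟨t, τ, he, hq⟩; cases he with | setReg _ _ _ h => exact ⟨h, hq⟩
  · exact fun h => ⟨_, _, .setReg σ x e h.1, h.2⟩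

theorem wp_setArr {a : ℕ} {i e : NExp} : Wp B (.setArr a i e) σ Q ↔
    i.eval σ < B ∧ e.eval σ < B ∧
      Q (i.size + e.size + 1) (σ.setA a (i.eval σ) (e.eval σ)) := by
  constructor
  · rintro ⟨t, τ, he, hq⟩; cases he with | setArr _ _ _ _ h h' => exact ⟨h, h', hq⟩
  · exact fun h => ⟨_, _, .setArr σ a i e h.1 h.2.1, h.2.2⟩

theorem wp_setWReg {x : ℕ} {e : WExp} : Wp B (.setWReg x e) σ Q ↔
    Q (e.size + 1) (σ.setW x (e.eval σ)) := by
  constructor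
  · rintro ⟨t, τ, he, hq⟩; cases he; exact hq
  · exact fun h => ⟨_, _, .setWReg σ x e, h⟩

theorem wp_setWArr {a : ℕ} {i : NExp} {e : WExp} : Wp B (.setWArr a i e) σ Q ↔
    i.eval σ < B ∧ Q (i.size + e.size + 1) (σ.setWA a (i.eval σ) (e.eval σ)) := by
  constructor
  · rintro ⟨t, τ, he, hq⟩; cases he with | setWArr _ _ _ _ h => exact ⟨h, hq⟩
  · exact fun h => ⟨_, _, .setWArr σ a i e h.1, h.2⟩

theorem wp_seq : Wp B (.seq p q) σ Q ↔
    Wp B p σ fun s τ => Wp B q τ fun t ρ => Q (s + t) ρ := by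
  constructor
  · rintro ⟨t, τ, he, hq⟩
    cases he with | seq h h' => exact ⟨_, _, h, _, _, h', hq⟩
  · rintro ⟨s, τ, h, t, ρ, h', hq⟩
    exact ⟨_, _, .seq h h', hq⟩

theorem wp_ite : Wp B (.ite b p q) σ Q ↔
    (b.Holds σ → Wp B p σ fun t τ => Q (b.size + 1 + t) τ) ∧
      (¬ b.Holds σ → Wp B q σ fun t τ => Q (b.size + 1 + t) τ) := by
  constructor
  · rintro ⟨t, τ, he, hq⟩
    cases he with
    | iteTrue hb h => exact ⟨fun _ => ⟨_, _, h, hq⟩, fun hb' => absurd hb hb'⟩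
    | iteFalse hb h => exact ⟨fun hb' => absurd hb' hb, fun _ => ⟨_, _, h, hq⟩⟩
  · rintro ⟨h1, h2⟩
    by_cases hb : b.Holds σ
    · obtain ⟨t, τ, h, hq⟩ := h1 hb; exact ⟨_, _, .iteTrue hb h, hq⟩
    · obtain ⟨t, τ, h, hq⟩ := h2 hb; exact ⟨_, _, .iteFalse hb h, hq⟩

/-- A loop with an invariant `I φ` that carries a potential `φ`: every round is paid for by a
decrease of the potential. -/
theorem wp_loop {I : ℕ → State → Prop} {φ : ℕ} (h0 : I φ σ)
    (hb : ∀ φ τ, Frame (.loop b p) σ τ → I φ τ → b.Holds τ →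
      Wp B p τ fun t ρ => ∃ ψ, I ψ ρ ∧ b.size + 1 + t + ψ ≤ φ) :
    Wp B (.loop b p) σ fun t τ => t ≤ φ + b.size + 1 ∧ (∃ ψ, I ψ τ) ∧ ¬ b.Holds τ := by
  induction φ using Nat.strong_induction_on generalizing σ with
  | _ φ ih =>
    by_cases h : b.Holds σ
    · obtain ⟨t, ρ, he, ψ, hI, hle⟩ := hb φ σ (.refl _ _) h0 h
      -- The test alone costs a step, so `ψ < φ`; one strong induction yields termination and the
      -- time bound together.
      obtain ⟨s, τ, he', hs, hI', hn⟩ := ih ψ (by omega) hI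
        (fun φ' τ' hf => hb φ' τ' (he.frame.loop.trans hf))
      exact ⟨_, _, .loopStep h he he', by omega, hI', hn⟩
    · exact ⟨_, _, .loopStop h, by omega, ⟨_, h0⟩, h⟩

/-- `for i := 0 to e - 1 do p`. -/
def Prog.forLt (i : ℕ) (e : NExp) (p : Prog) : Prog :=
  .seq (.setReg i (.const 0))
    (.loop (.lt (.reg i) e) (.seq p (.setReg i (.add (.reg i) (.const 1)))))

/-- The invariant refers to states whose counter already holds its next value. A round costs `c` for
the body, `e.size + 3` for the test and `4` for the increment; the initial assignment and the
failing test cost `e.size + 5`. -/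
theorem wp_forLt {i : ℕ} {e : NExp} {I : ℕ → State → Prop} {N c : ℕ} (hN : N < B)
    (hi : p.writesReg i = false) (h0 : I 0 (σ.setR i 0))
    (he : ∀ τ, Frame (Prog.forLt i e p) σ τ → e.eval τ = N)
    (hb : ∀ j τ, j < N → Frame (Prog.forLt i e p) σ τ → τ.reg i = j → I j τ →
      Wp B p τ fun t ρ => t ≤ c ∧ I (j + 1) (ρ.setR i (j + 1))) :
    Wp B (Prog.forLt i e p) σ fun t τ =>
      t ≤ N * (c + e.size + 7) + e.size + 5 ∧ I N τ ∧ τ.reg i = N := by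
  have hset : Frame (Prog.forLt i e p) σ (σ.setR i 0) :=
    (Exec.setReg (B := N + 1) σ i (.const 0) (by simp [NExp.eval])).frame.seq_left
  refine wp_seq.2 (wp_setReg.2 ⟨by simp only [NExp.eval]; omega, ?_⟩)
  simp only [NExp.eval]
  refine (wp_loop (I := fun φ τ => ∃ j, j ≤ N ∧ τ.reg i = j ∧ I j τ ∧
    φ = (N - j) * (c + e.size + 7)) ⟨0, Nat.zero_le _, by simp, h0, rfl⟩ ?_).mono ?_
  · rintro φ τ hf ⟨j, hj, hij, hI, rfl⟩ hlt
    have hf' : Frame (Prog.forLt i e p) σ τ := hset.trans hf.seq_right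
    simp only [Test.Holds, NExp.eval, he τ hf', hij] at hlt
    refine wp_seq.2 ((hb j τ hlt hf' hij hI).mono fun t ρ hfr ⟨ht, hI'⟩ => wp_setReg.2 ?_)
    have hri : ρ.reg i = j := (hfr.reg i hi).trans hij
    simp only [NExp.eval, hri, NExp.size, Test.size]
    refine ⟨by omega, _, ⟨j + 1, hlt, by simp, hI', rfl⟩, ?_⟩
    obtain ⟨d, rfl⟩ := Nat.exists_eq_add_of_lt hlt
    rw [show j + d + 1 - (j + 1) = d by omega, show j + d + 1 - j = d + 1 by omega, Nat.add_mul]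
    omega
  · rintro t τ hf ⟨ht, ⟨ψ, j, hj, hij, hI, -⟩, hn⟩
    have hf' : Frame (Prog.forLt i e p) σ τ := hset.trans hf.seq_right
    simp only [Test.Holds, NExp.eval, he τ hf', hij, not_lt] at hn
    obtain rfl : j = N := le_antisymm hj hn
    refine ⟨?_, hI, hij⟩
    simp only [Test.size, NExp.size, Nat.sub_zero] at ht ⊢
    omega

end Wp

attribute [simp] wp_skip wp_setReg wp_setArr wp_setWReg wp_setWArr wp_seq wp_ite
  NExp.eval NExp.size WExp.eval WExp.size Test.Holds Test.size

/-! ### A priority queue: the tournament tree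

The keys of the items `0, …, n - 1` are stored in the leaves `n, …, 2 n - 1` of a binary tree with
the inner nodes `1, …, n - 1`; the children of `i` are `2 i` and `2 i + 1`. Every inner node stores
the smaller value of its children. An item with the key `∞` counts as absent. -/

/-- The array `T` is a tournament tree for the keys `H`. -/
structure IsHeap (n : ℕ) (T H : ℕ → ℝ≥0∞) : Prop where
  node : ∀ i, 1 ≤ i → i < n → T i = min (T (2 * i)) (T (2 * i + 1))
  leaf : ∀ x, x < n → T (n + x) = H x

/-- Induction towards the root through the parent `i / 2`, whose value is the minimum over its
children. Nothing requires `n` to be a power of two. -/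
theorem IsHeap.root_le_node {n : ℕ} {T H : ℕ → ℝ≥0∞} (h : IsHeap n T H) (i : ℕ) (hi : 1 ≤ i)
    (hin : i < 2 * n) : T 1 ≤ T i := by
  induction i using Nat.strong_induction_on with
  | _ i ih =>
    rcases Nat.lt_or_ge i 2 with h2 | h2
    · rw [show i = 1 by omega]
    · refine (ih (i / 2) (by omega) (by omega) (by omega)).trans ?_
      rw [h.node (i / 2) (by omega) (by omega)]
      rcases Nat.mod_two_eq_zero_or_one i with h0 | h0
      · exact (min_le_left _ _).trans (by rw [show 2 * (i / 2) = i by omega])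
      · exact (min_le_right _ _).trans (by rw [show 2 * (i / 2) + 1 = i by omega])

theorem IsHeap.root_le {n : ℕ} {T H : ℕ → ℝ≥0∞} (h : IsHeap n T H) {x : ℕ} (hx : x < n) :
    T 1 ≤ H x := by
  rw [← h.leaf x hx]
  exact h.root_le_node _ (by omega) (by omega)

/-- Sets the key of the item in register `4` to the value of the weight register `0`. -/
def heapUpdate : Prog :=
  .seq (.setReg 3 (.add (.reg 0) (.reg 4))) <|
  .seq (.setWArr 3 (.reg 3) (.reg 0)) <|
  .loop (.lt (.const 1) (.reg 3)) <|
  .seq (.setReg 3 (.div (.reg 3) (.const 2))) <|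
  .ite (.wlt (.get 3 (.add (.mul (.const 2) (.reg 3)) (.const 1)))
      (.get 3 (.mul (.const 2) (.reg 3))))
    (.setWArr 3 (.reg 3) (.get 3 (.add (.mul (.const 2) (.reg 3)) (.const 1))))
    (.setWArr 3 (.reg 3) (.get 3 (.mul (.const 2) (.reg 3))))

/-- While the program climbs, the node equation may fail only at the parent `i / 2` of the current
node `i`. Recomputing the parent moves this defect one level up; at `i = 1` it would sit at `0`,
which is no node. -/
theorem heapUpdate_spec {B n v : ℕ} {σ : State} {H : ℕ → ℝ≥0∞} (hB : 2 * n < B)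
    (hn : σ.reg 0 = n) (hv : σ.reg 4 = v) (hvn : v < n) (hH : IsHeap n (σ.warr 3) H) :
    Wp B heapUpdate σ fun t τ =>
      t ≤ 50 * (Nat.log 2 n + 2) ∧
        IsHeap n (τ.warr 3) (Function.update H v (σ.wreg 0)) := by
  have hlog : Nat.log 2 (n + v) ≤ Nat.log 2 n + 1 := by
    have h1 : Nat.log 2 (n + v) ≤ Nat.log 2 (n * 2) := Nat.log_mono_right (by omega)
    rwa [Nat.log_mul_base (by omega) (by omega)] at h1
  simp only [heapUpdate, wp_seq, wp_setReg, wp_setWArr, NExp.eval, NExp.size, WExp.eval, WExp.size,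
    hn, hv, State.setR_reg, State.setR_wreg, if_true]
  refine ⟨by omega, by omega, ?_⟩
  refine (wp_loop (I := fun φ τ => ∃ i, τ.reg 3 = i ∧ 1 ≤ i ∧ i < 2 * n ∧
      φ = 40 * Nat.log 2 i ∧
      (∀ j, 1 ≤ j → j < n → j ≠ i / 2 →
        τ.warr 3 j = min (τ.warr 3 (2 * j)) (τ.warr 3 (2 * j + 1))) ∧
      ∀ x, x < n → τ.warr 3 (n + x) = Function.update H v (σ.wreg 0) x)
    ⟨n + v, by simp, by omega, by omega, rfl, ?_, ?_⟩ ?_).mono ?_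
  · intro j h1 hj hne
    have e1 : j ≠ n + v := by omega
    have e2 : 2 * j ≠ n + v := by omega
    have e3 : 2 * j + 1 ≠ n + v := by omega
    simpa [e1, e2, e3] using hH.node j h1 hj
  · intro x hx
    by_cases hxv : x = v
    · subst hxv; simp
    · simp [hxv, hH.leaf x hx]
  · rintro φ τ hf ⟨i, hi, h1, hin, rfl, hnode, hleaf⟩ hlt
    simp only [Test.Holds, NExp.eval, hi] at hlt
    have hlog2 : Nat.log 2 i = Nat.log 2 (i / 2) + 1 := by
      rw [Nat.log_of_one_lt_of_le (by omega) (by omega)]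
    have key : ∀ c : ℝ≥0∞, c = min (τ.warr 3 (2 * (i / 2))) (τ.warr 3 (2 * (i / 2) + 1)) →
        (∀ j, 1 ≤ j → j < n → j ≠ i / 2 / 2 → Function.update (τ.warr 3) (i / 2) c j =
          min (Function.update (τ.warr 3) (i / 2) c (2 * j))
            (Function.update (τ.warr 3) (i / 2) c (2 * j + 1))) ∧
        ∀ x, x < n → Function.update (τ.warr 3) (i / 2) c (n + x) =
          Function.update H v (σ.wreg 0) x := by
      refine fun c hc => ⟨fun j h1 hj hne => ?_, fun x hx => ?_⟩
      · have e2 : 2 * j ≠ i / 2 := by omega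
        have e3 : 2 * j + 1 ≠ i / 2 := by omega
        by_cases hji : j = i / 2
        · subst hji; simp [e2, e3, hc]
        · simpa [e2, e3, hji] using hnode j h1 hj hji
      · have : n + x ≠ i / 2 := by omega
        simpa [this] using hleaf x hx
    simp only [wp_seq, wp_setReg, wp_ite, wp_setWArr, Test.Holds, Test.size, NExp.eval, NExp.size,
      WExp.eval, WExp.size, State.setR_reg, State.setR_warr, if_true, hi, State.setWA_reg,
      State.setWA_warr]
    refine ⟨by omega, fun hw => ⟨by omega, _, ⟨i / 2, rfl, by omega, by omega, rfl,
      key _ (min_eq_right hw.le).symm⟩, by omega⟩,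
      fun hw => ⟨by omega, _, ⟨i / 2, rfl, by omega, by omega, rfl,
      key _ (min_eq_left (not_lt.1 hw)).symm⟩, by omega⟩⟩
  · rintro t τ - ⟨ht, ⟨φ, i, hi, h1, hin, rfl, hnode, hleaf⟩, hnot⟩
    simp only [Test.Holds, NExp.eval, hi, Test.size, NExp.size] at hnot ht
    refine ⟨by omega, fun j h1 hj => hnode j h1 hj (by omega), hleaf⟩

/-- Finds an item with the smallest key, stores it in register `4`, and removes it. -/
def heapExtract : Prog :=
  .seq (.setReg 3 (.const 1)) <|
  .seq (.loop (.lt (.reg 3) (.reg 0)) <|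
    .ite (.wlt (.get 3 (.add (.mul (.const 2) (.reg 3)) (.const 1)))
        (.get 3 (.mul (.const 2) (.reg 3))))
      (.setReg 3 (.add (.mul (.const 2) (.reg 3)) (.const 1)))
      (.setReg 3 (.mul (.const 2) (.reg 3)))) <|
  .seq (.setReg 4 (.sub (.reg 3) (.reg 0))) <|
  .seq (.setWReg 0 .infty) heapUpdate

/-- The descent always moves to a child that carries the value of the root, so it ends in a leaf
whose key is minimal. Setting this key to `∞` removes the item. -/
theorem heapExtract_spec {B n : ℕ} {σ : State} {H : ℕ → ℝ≥0∞} (hB : 2 * n < B) (hn0 : 0 < n)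
    (hn : σ.reg 0 = n) (hH : IsHeap n (σ.warr 3) H) :
    Wp B heapExtract σ fun t τ =>
      t ≤ 100 * (Nat.log 2 n + 2) ∧ ∃ x, x < n ∧ τ.reg 4 = x ∧ H x = σ.warr 3 1 ∧
        IsHeap n (τ.warr 3) (Function.update H x ⊤) := by
  simp only [heapExtract, wp_seq, wp_setReg, NExp.eval, NExp.size]
  refine ⟨by omega, ?_⟩
  refine (wp_loop (I := fun φ τ => ∃ i, τ.reg 3 = i ∧ 1 ≤ i ∧ i < 2 * n ∧
      -- A round costs at most `24` and increases `Nat.log 2 i` by one; the depth never exceeds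
      -- `Nat.log 2 n + 1`.
      φ + 24 * Nat.log 2 i = 24 * (Nat.log 2 n + 1) ∧ σ.warr 3 i = σ.warr 3 1)
    (φ := 24 * (Nat.log 2 n + 1)) ⟨1, by simp, by omega, by omega, by simp, rfl⟩ ?_).mono ?_
  · rintro φ τ hf ⟨i, hi, h1, hin, hφ, hroot⟩ hlt
    have hw : τ.warr 3 = σ.warr 3 := hf.warr 3 rfl
    have hr : τ.reg 0 = n := by
      rw [hf.reg 0 rfl]; simpa using hn
    simp only [Test.Holds, NExp.eval, hi, hr] at hlt
    have hl0 : Nat.log 2 (2 * i) = Nat.log 2 i + 1 := by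
      rw [mul_comm, Nat.log_mul_base (by omega) (by omega)]
    have hl1 : Nat.log 2 (2 * i + 1) = Nat.log 2 i + 1 := by
      rw [Nat.log_of_one_lt_of_le (by omega) (by omega)]
      congr 2; omega
    have hl2 : Nat.log 2 i + 1 ≤ Nat.log 2 n + 1 := by
      have := Nat.log_mono_right (b := 2) hlt.le; omega
    have hnode := hH.node i h1 hlt
    simp only [wp_setReg, wp_ite, Test.Holds, Test.size, NExp.eval, NExp.size,
      WExp.eval, WExp.size, State.setR_reg, if_true, hi, hw]
    refine ⟨fun hw => ⟨by omega, 24 * (Nat.log 2 n + 1) - 24 * (Nat.log 2 i + 1),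
        ⟨_, rfl, by omega, by omega, by omega, ?_⟩, by omega⟩,
      fun hw => ⟨by omega, 24 * (Nat.log 2 n + 1) - 24 * (Nat.log 2 i + 1),
        ⟨_, rfl, by omega, by omega, by omega, ?_⟩, by omega⟩⟩
    · rw [min_eq_right hw.le] at hnode; rw [← hnode, hroot]
    · rw [min_eq_left (not_lt.1 hw)] at hnode; rw [← hnode, hroot]
  · rintro t τ hf ⟨ht, ⟨φ, i, hi, h1, hin, hφ, hroot⟩, hnot⟩
    have hw : τ.warr 3 = σ.warr 3 := hf.warr 3 rfl
    have hr : τ.reg 0 = n := by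
      rw [hf.reg 0 rfl]; simpa using hn
    simp only [Test.Holds, NExp.eval, hi, Test.size, NExp.size, hr] at hnot ht
    simp only [wp_setWReg, WExp.eval, WExp.size, hi, hr]
    refine ⟨by omega, (heapUpdate_spec (n := n) (v := i - n) (H := H) hB (by simpa using hr)
      (by simp) (by omega) (by simpa [hw] using hH)).mono ?_⟩
    rintro s ρ hf' ⟨hs, hheap⟩
    refine ⟨by omega, i - n, by omega, ?_, ?_, by simpa using hheap⟩
    · rw [hf'.reg 4 rfl]; simp
    · rw [← hroot, ← hH.leaf _ (by omega)]; congr 1; omega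

/-! ### Walks, distances and the weight matrix -/

section Graph

variable {n : ℕ} {G : SimpleGraph (Fin n)} {w : Sym2 (Fin n) → ℝ≥0}

theorem walkWeight_cons {u v x : Fin n} (h : G.Adj u v) (p : G.Walk v x) :
    walkWeight w (.cons h p) = w s(u, v) + walkWeight w p := by
  simp [walkWeight]

theorem heaviest_cons {u v x : Fin n} (h : G.Adj u v) (p : G.Walk v x) :
    heaviest w (.cons h p) = max (w s(u, v)) (heaviest w p) := by
  simp [heaviest]

theorem walkWeight_reverse {u v : Fin n} (p : G.Walk u v) :
    walkWeight w p.reverse = walkWeight w p := by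
  simp [walkWeight, SimpleGraph.Walk.edges_reverse, List.map_reverse, List.sum_reverse]

theorem heaviest_reverse {u v : Fin n} (p : G.Walk u v) :
    heaviest w p.reverse = heaviest w p := by
  have : LeftCommutative (max : ℝ≥0 → ℝ≥0 → ℝ≥0) := ⟨max_left_comm⟩
  simp only [heaviest, SimpleGraph.Walk.edges_reverse, List.map_reverse]
  exact (List.reverse_perm _).foldr_eq 0

theorem wdist_comm (u v : Fin n) : wdist G w u v = wdist G w v u := by
  refine le_antisymm (le_iInf fun p => ?_) (le_iInf fun p => ?_) <;>
  · rw [← walkWeight_reverse]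
    exact iInf_le (fun p => (walkWeight w p : ℝ≥0∞)) p.reverse

theorem wdist_self (u : Fin n) : wdist G w u u = 0 := by
  refine le_antisymm (iInf_le_of_le .nil ?_) zero_le
  simp [walkWeight]

theorem wdist_le_add_of_adj (u : Fin n) {x y : Fin n} (h : G.Adj x y) :
    wdist G w u y ≤ wdist G w u x + w s(x, y) := by
  rw [wdist_comm u y, wdist_comm u x]
  simp only [wdist]
  rw [ENNReal.iInf_add]
  refine le_iInf fun p => (iInf_le _ (.cons h.symm p)).trans ?_
  rw [walkWeight_cons, Sym2.eq_swap, add_comm]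
  push_cast
  exact le_rfl

open Classical in
/-- The matrix of the edge weights, with `∞` off the edges (also on the diagonal). -/
noncomputable def edgeMatrix (G : SimpleGraph (Fin n)) (w : Sym2 (Fin n) → ℝ≥0) (x y : ℕ) :
    ℝ≥0∞ :=
  if h : ∃ (hx : x < n) (hy : y < n), G.Adj ⟨x, hx⟩ ⟨y, hy⟩ then
    (w s(⟨x, h.1⟩, ⟨y, h.2.1⟩) : ℝ≥0∞) else ⊤

/-- The matrix of the edge weights, with `0` on the diagonal and `∞` for the other non-edges. -/
noncomputable def weightMatrix (G : SimpleGraph (Fin n)) (w : Sym2 (Fin n) → ℝ≥0) (x y : ℕ) :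
    ℝ≥0∞ :=
  if x = y then 0 else edgeMatrix G w x y

/-- The distance with vertices read as numbers. -/
noncomputable def natDist (G : SimpleGraph (Fin n)) (w : Sym2 (Fin n) → ℝ≥0) (x y : ℕ) : ℝ≥0∞ :=
  if h : x < n ∧ y < n then wdist G w ⟨x, h.1⟩ ⟨y, h.2⟩ else 0

theorem edgeMatrix_of_adj {x y : Fin n} (h : G.Adj x y) : edgeMatrix G w x y = w s(x, y) := by
  have : ∃ (hx : x.val < n) (hy : y.val < n), G.Adj ⟨x.val, hx⟩ ⟨y.val, hy⟩ := ⟨x.2, y.2, h⟩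
  rw [edgeMatrix, dif_pos this]

theorem exists_adj_of_edgeMatrix_lt_top {x y : ℕ} (h : edgeMatrix G w x y < ⊤) :
    ∃ x' y' : Fin n, G.Adj x' y' ∧ x' = x ∧ y' = (y : ℕ) := by
  unfold edgeMatrix at h
  split_ifs at h with h'
  · exact ⟨⟨x, h'.1⟩, ⟨y, h'.2.1⟩, h'.2.2, rfl, rfl⟩
  · simp at h

theorem edgeMatrix_self (x : ℕ) : edgeMatrix G w x x = ⊤ := by
  by_contra h
  obtain ⟨x', y', ha, rfl, he⟩ := exists_adj_of_edgeMatrix_lt_top (lt_top_iff_ne_top.2 h)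
  exact ha.ne (Fin.ext he).symm

theorem edgeMatrix_comm (x y : ℕ) : edgeMatrix G w x y = edgeMatrix G w y x := by
  have key : ∀ x y, edgeMatrix G w x y < ⊤ → edgeMatrix G w x y = edgeMatrix G w y x := by
    intro x y h
    obtain ⟨x', y', ha, rfl, rfl⟩ := exists_adj_of_edgeMatrix_lt_top h
    rw [edgeMatrix_of_adj ha, edgeMatrix_of_adj ha.symm, Sym2.eq_swap]
  rcases lt_or_ge (edgeMatrix G w x y) ⊤ with h | h
  · exact key x y h
  · rcases lt_or_ge (edgeMatrix G w y x) ⊤ with h' | h'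
    · exact (key y x h').symm
    · rw [top_le_iff.1 h, top_le_iff.1 h']

theorem weightMatrix_comm (x y : ℕ) : weightMatrix G w x y = weightMatrix G w y x := by
  simp only [weightMatrix, edgeMatrix_comm x y, eq_comm (a := x)]

@[simp] theorem weightMatrix_self (x : ℕ) : weightMatrix G w x x = 0 := by simp [weightMatrix]

theorem weightMatrix_of_adj {x y : Fin n} (h : G.Adj x y) : weightMatrix G w x y = w s(x, y) := by
  have : (x : ℕ) ≠ y := fun e => h.ne (Fin.ext e)
  simp [weightMatrix, this, edgeMatrix_of_adj h]

theorem natDist_coe (x y : Fin n) : natDist G w x y = wdist G w x y := by simp [natDist]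

theorem natDist_self (x : ℕ) : natDist G w x x = 0 := by
  unfold natDist
  split_ifs
  · exact wdist_self _
  · rfl

theorem natDist_comm (x y : ℕ) : natDist G w x y = natDist G w y x := by
  unfold natDist
  by_cases h : x < n ∧ y < n
  · rw [dif_pos h, dif_pos h.symm, wdist_comm]
  · rw [dif_neg h, dif_neg fun h' => h h'.symm]

/-- This is what keeps the true distance a lower bound of the estimates under relaxation. Out of
range no case distinction is needed, since missing edges weigh `∞`. -/
theorem natDist_le_add (u x y : ℕ) (hu : u < n) :
    natDist G w u y ≤ natDist G w u x + weightMatrix G w x y := by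
  by_cases hxy : x = y
  · simp [hxy]
  · rcases lt_or_ge (edgeMatrix G w x y) ⊤ with h | h
    · obtain ⟨x', y', ha, rfl, rfl⟩ := exists_adj_of_edgeMatrix_lt_top h
      have := wdist_le_add_of_adj (w := w) ⟨u, hu⟩ ha
      rw [weightMatrix_of_adj ha]
      simpa only [← natDist_coe] using this
    · simp [weightMatrix, hxy, top_le_iff.1 h]

/-- The edges are counted twice by the finite entries of the matrix. -/
theorem sum_card_edgeMatrix_lt_top {m : ℕ} {e : Fin m → Fin n × Fin n} (he : IsEdgeList G e) :
    ∑ y ∈ Finset.range n, ((Finset.range n).filter fun x => edgeMatrix G w y x < ⊤).card =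
      2 * m := by
  classical
  have hm : G.edgeFinset.card = m := by
    have h1 : G.edgeFinset = Finset.univ.image fun i => s((e i).1, (e i).2) := by
      ext z
      rw [SimpleGraph.mem_edgeFinset, ← he.2]
      simp
    rw [h1, Finset.card_image_of_injective _ he.1, Finset.card_univ, Fintype.card_fin]
  rw [← hm, ← SimpleGraph.sum_degrees_eq_twice_card_edges, Finset.sum_range]
  refine Finset.sum_congr rfl fun y _ => ?_
  rw [← SimpleGraph.card_neighborFinset_eq_degree, ← Finset.card_map Fin.valEmbedding]
  congr 1
  ext x
  simp only [Finset.mem_filter, Finset.mem_range, Finset.mem_map, SimpleGraph.mem_neighborFinset,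
    Fin.valEmbedding_apply]
  constructor
  · rintro ⟨hx, h⟩
    obtain ⟨y', x', ha, hy, rfl⟩ := exists_adj_of_edgeMatrix_lt_top h
    obtain rfl := Fin.ext hy
    exact ⟨x', ha, rfl⟩
  · rintro ⟨x', ha, rfl⟩
    exact ⟨x'.2, by rw [edgeMatrix_of_adj ha]; exact ENNReal.coe_lt_top⟩

/-- All degrees are at most `n - 1`. The consequence `m / n + 1 ≤ n` lets powers of `r` be capped at
`n`. -/
theorem card_edges_le {m : ℕ} {e : Fin m → Fin n × Fin n} (he : IsEdgeList G e) :
    2 * m ≤ n * (n - 1) := by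
  rw [← sum_card_edgeMatrix_lt_top (w := fun _ => 0) he, ← smul_eq_mul]
  have : ∀ y ∈ Finset.range n,
      ((Finset.range n).filter fun x => edgeMatrix G (fun _ => 0) y x < ⊤).card ≤ n - 1 := by
    intro y hy
    have h := Finset.card_erase_of_mem hy
    rw [Finset.card_range] at h
    rw [← h]
    refine Finset.card_le_card fun x hx => ?_
    simp only [Finset.mem_filter] at hx
    refine Finset.mem_erase.2 ⟨?_, hx.1⟩
    rintro rfl
    simp [edgeMatrix_self] at hx
  simpa using Finset.sum_le_card_nsmul _ _ _ this

end Graph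

/-! ### Sorted neighbourhoods and the stretch -/

/-- The first `l` entries of `N` enumerate the items with a finite key `A x`, in the order of their
keys and starting with `y`. -/
structure SortedRow (n : ℕ) (A : ℕ → ℝ≥0∞) (y : ℕ) (N : ℕ → ℕ) (l : ℕ) : Prop where
  pos : 0 < l
  zero : N 0 = y
  lt : ∀ j, j < l → N j < n
  inj : ∀ i j, i < l → j < l → N i = N j → i = j
  surj : ∀ x, x < n → A x < ⊤ → ∃ j, j < l ∧ N j = x
  mono : ∀ i j, i ≤ j → j < l → A (N i) ≤ A (N j)

theorem SortedRow.le {n : ℕ} {A : ℕ → ℝ≥0∞} {y : ℕ} {N : ℕ → ℕ} {l : ℕ}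
    (h : SortedRow n A y N l) : l ≤ n := by
  have := Finset.card_le_card_of_injOn (s := Finset.range l) (t := Finset.range n) N
    (fun j hj => Finset.mem_coe.2 (Finset.mem_range.2 (h.lt j (Finset.mem_range.1 hj))))
    (fun i hi j hj => h.inj i j (Finset.mem_range.1 hi) (Finset.mem_range.1 hj))
  simpa using this

section Stretch

variable {n : ℕ} (G : SimpleGraph (Fin n)) (w : Sym2 (Fin n) → ℝ≥0)

/-- The estimates `D v` of the distances from `u` have stretch `(1, c W)`. -/
def RowGood (D : ℕ → ℝ≥0∞) (c : ℕ) (u : ℕ) : Prop :=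
  ∀ (x v : Fin n) (p : G.Walk x v), x = u →
    D v ≤ walkWeight w p + c * (heaviest w p : ℝ≥0∞)

variable {G w}

/-- One level of the algorithm: let `D` be stable under relaxing the arcs that lead to `y` from its
`s` nearest neighbours. If each `y` with more neighbours has a vertex `z` among them from which the
distances are known up to `(2 i - 2) W`, and `D` makes use of them, then `D` is correct up to
`2 i W`. -/
theorem rowGood_of_stable {N : ℕ → ℕ → ℕ} {len : ℕ → ℕ} {M : ℕ → ℕ → ℝ≥0∞} {D : ℕ → ℝ≥0∞}
    {s i u : ℕ} (hrows : ∀ y, y < n → SortedRow n (weightMatrix G w y) y (N y) (len y))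
    (hu : D u = 0) (hM : ∀ v, v < n → D v ≤ M v u)
    (harc : ∀ y j, y < n → j < s → j < len y →
      D y ≤ D (N y j) + weightMatrix G w (N y j) y)
    (hprev : ∀ y, y < n → s ≤ len y →
      1 ≤ i ∧ ∃ j, j < s ∧ RowGood G w (M (N y j)) (2 * (i - 1)) (N y j)) :
    RowGood G w D (2 * i) u := by
  -- The induction peels off the edge at `v`, the end far from the source `u`, so the walk is taken
  -- towards `u` and reversed at the end.
  have key : ∀ (x v : Fin n) (p : G.Walk v x), x = u →
      D v ≤ walkWeight w p + (2 * i : ℕ) * (heaviest w p : ℝ≥0∞) := by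
    intro x v p hx
    induction p with
    | nil => simp [hx, hu]
    | @cons y x' x h p ih =>
      rw [walkWeight_cons, heaviest_cons]
      have hw : weightMatrix G w y x' = w s(y, x') := weightMatrix_of_adj h
      obtain ⟨j, hj, hNj⟩ := (hrows y y.2).surj x' x'.2 (by rw [hw]; exact ENNReal.coe_lt_top)
      rcases lt_or_ge j s with hjs | hjs
      -- Near neighbour: the arc is relaxed, and the induction hypothesis passes on the error
      -- without increasing it.
      · have h1 := harc y j y.2 hjs hj
        rw [hNj, weightMatrix_comm, hw] at h1
        refine h1.trans ((add_le_add_left (ih hx) _).trans ?_)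
        have : (heaviest w p : ℝ≥0∞) ≤ (max (w s(y, x')) (heaviest w p) : ℝ≥0) :=
          ENNReal.coe_le_coe.2 (le_max_right _ _)
        calc _ = (w s(y, x') + walkWeight w p : ℝ≥0∞) + (2 * i : ℕ) * (heaviest w p : ℝ≥0∞) := by
              ring
          _ ≤ _ := by push_cast; gcongr; exact_mod_cast le_max_right _ _
      -- Far neighbour: the row of `y` has more than `s` entries, and its good vertex `z = N y l`
      -- precedes `x'`, so `w(y,z) ≤ w(y,x')`. The induction hypothesis is not used; the estimate
      -- from `z` handles the walk `z, y, x', …` as a whole.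
      · obtain ⟨h1i, l, hl, hgood⟩ := hprev y y.2 (by omega)
        have hz : N y l < n := (hrows y y.2).lt l (by omega)
        have hzw : weightMatrix G w y (N y l) ≤ w s(y, x') := by
          rw [← hw, ← hNj]; exact (hrows y y.2).mono l j (by omega) hj
        have hDy := harc y l y.2 hl (by omega)
        have hDz := hM (N y l) hz
        have hbound : M (N y l) x ≤ (w s(y, x') : ℝ≥0∞) + ((w s(y, x') + walkWeight w p : ℝ≥0) +
            (2 * (i - 1) : ℕ) * (max (w s(y, x')) (heaviest w p) : ℝ≥0) : ℝ≥0∞) := by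
          -- A row starts with its owner, so `z` may be `y` itself; then there is no edge to
          -- prepend.
          by_cases hzy : N y l = y
          · have := hgood y x (.cons h p) hzy.symm
            rw [walkWeight_cons, heaviest_cons] at this
            exact this.trans le_add_self
          · have hlt : weightMatrix G w y (N y l) < ⊤ := hzw.trans_lt ENNReal.coe_lt_top
            have hE : weightMatrix G w y (N y l) = edgeMatrix G w y (N y l) := by
              rw [weightMatrix, if_neg fun e => hzy e.symm]
            rw [hE] at hlt hzw
            obtain ⟨y', z, ha, hy', hz'⟩ := exists_adj_of_edgeMatrix_lt_top hlt
            obtain rfl := Fin.ext hy'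
            rw [← hz', edgeMatrix_of_adj ha] at hzw
            have := hgood z x (.cons ha.symm (.cons h p)) hz'
            rw [walkWeight_cons, heaviest_cons, walkWeight_cons, heaviest_cons,
              Sym2.eq_swap (a := z), max_eq_right
                ((ENNReal.coe_le_coe.1 hzw).trans (le_max_left _ _))] at this
            refine this.trans ?_
            rw [ENNReal.coe_add, add_assoc]
            gcongr
        rw [weightMatrix_comm] at hDy
        rw [← hx] at hDz
        refine hDy.trans ((add_le_add (hDz.trans hbound) hzw).trans ?_)
        have hmax : (w s(y, x') : ℝ≥0∞) ≤ (max (w s(y, x')) (heaviest w p) : ℝ≥0) :=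
          ENNReal.coe_le_coe.2 (le_max_left _ _)
        -- With `X` the heaviest weight, the steps from `y` to `z` and back add at most `2 X` to the
        -- error `2 (i - 1) X`.
        generalize ((max (w s(y, x')) (heaviest w p) : ℝ≥0) : ℝ≥0∞) = X at hmax ⊢
        obtain ⟨i, rfl⟩ : ∃ i', i = i' + 1 := ⟨i - 1, by omega⟩
        push_cast
        calc _ ≤ X + ((w s(y, x') : ℝ≥0∞) + walkWeight w p + 2 * ((i + 1 - 1 : ℕ) : ℝ≥0∞) * X)
              + X := by push_cast; gcongr
          _ = _ := by rw [Nat.add_sub_cancel]; ring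
  intro x v p hx
  have := key x v p.reverse hx
  rwa [walkWeight_reverse, heaviest_reverse] at this

theorem RowGood.mono {D D' : ℕ → ℝ≥0∞} {c u : ℕ} (h : RowGood G w D c u)
    (hle : ∀ v, v < n → D' v ≤ D v) : RowGood G w D' c u :=
  fun x v p hx => (hle v v.2).trans (h x v p hx)

end Stretch

/-! ### Indices into matrices that are stored row by row -/

theorem index_lt {n x y : ℕ} (hx : x < n) (hy : y < n) : x * n + y < n * n := by nlinarith

theorem index_inj {n x y x' y' : ℕ} (hy : y < n) (hy' : y' < n)
    (h : x * n + y = x' * n + y') : x = x' ∧ y = y' := by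
  have h1 : (x * n + y) / n = x := by
    rw [mul_comm, Nat.mul_add_div (by omega), Nat.div_eq_of_lt hy, add_zero]
  have h2 : (x' * n + y') / n = x' := by
    rw [mul_comm, Nat.mul_add_div (by omega), Nat.div_eq_of_lt hy', add_zero]
  have : x = x' := by rw [← h1, h, h2]
  subst this
  exact ⟨rfl, by omega⟩

theorem index_eq_iff {n x y x' y' : ℕ} (hy : y < n) (hy' : y' < n) :
    x * n + y = x' * n + y' ↔ x = x' ∧ y = y' :=
  ⟨index_inj hy hy', fun h => by rw [h.1, h.2]⟩

/-! ### Reading the input -/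

/-- Fills the distance matrix (array `1`), the weight matrix (array `2`) and the queue (array `3`)
with `∞`. -/
def fillTop : Prog :=
  .forLt 5 (.add (.mul (.reg 0) (.reg 0)) (.mul (.const 2) (.reg 0))) <|
    .seq (.setWArr 1 (.reg 5) .infty) <|
    .seq (.setWArr 2 (.reg 5) .infty) (.setWArr 3 (.reg 5) .infty)

theorem fillTop_spec {B n : ℕ} {σ : State} (hn : σ.reg 0 = n) (hB : n * n + 2 * n < B) :
    Wp B fillTop σ fun t τ => t ≤ 30 * (n * n + 2 * n + 1) ∧
      ∀ i, i < n * n + 2 * n → τ.warr 1 i = ⊤ ∧ τ.warr 2 i = ⊤ ∧ τ.warr 3 i = ⊤ := by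
  refine (wp_forLt (N := n * n + 2 * n) (c := 9)
    (I := fun j τ => ∀ i, i < j → τ.warr 1 i = ⊤ ∧ τ.warr 2 i = ⊤ ∧ τ.warr 3 i = ⊤)
    hB rfl (by simp) ?_ ?_).mono ?_
  · intro τ hf
    simp [hf.reg 0 rfl, hn]
  · intro j τ hj hf hrj hI
    simp only [wp_seq, wp_setWArr, NExp.eval, NExp.size, WExp.eval, WExp.size, hrj,
      State.setWA_reg]
    refine ⟨by omega, by omega, by omega, by omega, fun i hi => ?_⟩
    simp only [State.setR_warr, State.setWA_warr]
    by_cases hij : i = j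
    · simp [hij]
    · simpa [hij] using hI i (by omega)
  · rintro t τ - ⟨ht, hI, -⟩
    simp only [NExp.size] at ht
    exact ⟨by omega, hI⟩

/-- Stores the edge weights in the weight matrix. -/
def loadEdges : Prog :=
  .forLt 5 (.reg 1) <|
    .seq (.setReg 6 (.get 0 (.reg 5))) <|
    .seq (.setReg 7 (.get 1 (.reg 5))) <|
    .seq (.setWArr 2 (.add (.mul (.reg 6) (.reg 0)) (.reg 7)) (.get 0 (.reg 5)))
      (.setWArr 2 (.add (.mul (.reg 7) (.reg 0)) (.reg 6)) (.get 0 (.reg 5)))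

theorem loadEdges_spec {B n m k : ℕ} {G : SimpleGraph (Fin n)} {w : Sym2 (Fin n) → ℝ≥0}
    {e : Fin m → Fin n × Fin n} (he : IsEdgeList G e) {σ : State} (hn : σ.reg 0 = n)
    (hm : σ.reg 1 = m) (harr : σ.arr = (inputState k e w).arr)
    (hw0 : σ.warr 0 = (inputState k e w).warr 0)
    (hA : ∀ i, i < n * n → σ.warr 2 i = ⊤) (hB : n * n < B) (hmB : m < B) :
    Wp B loadEdges σ fun t τ => t ≤ 60 * (m + 1) ∧
      ∀ x y, x < n → y < n → τ.warr 2 (x * n + y) = edgeMatrix G w x y := by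
  classical
  refine (wp_forLt (N := m) (c := 40)
    (I := fun j τ => ∀ x y : Fin n, τ.warr 2 (x * n + y) =
      if ∃ i : Fin m, i < j ∧ s((e i).1, (e i).2) = s(x, y) then (w s(x, y) : ℝ≥0∞) else ⊤)
    hmB rfl ?_ ?_ ?_).mono ?_
  · intro x y
    simpa using hA _ (index_lt x.2 y.2)
  · intro τ hf
    simp [hf.reg 1 rfl, hm]
  · intro j τ hj hf hrj hI
    have hx : τ.arr 0 j = (e ⟨j, hj⟩).1 := by rw [hf.arr 0 rfl, harr]; simp [inputState, hj]
    have hy : τ.arr 1 j = (e ⟨j, hj⟩).2 := by rw [hf.arr 1 rfl, harr]; simp [inputState, hj]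
    have hw : τ.warr 0 j = w s((e ⟨j, hj⟩).1, (e ⟨j, hj⟩).2) := by
      rw [hf.warr 0 rfl, hw0]; simp [inputState, hj]
    have hn' : τ.reg 0 = n := by rw [hf.reg 0 rfl, hn]
    generalize hab : e ⟨j, hj⟩ = p at hx hy hw
    obtain ⟨a, b⟩ := p
    have h1 := index_lt a.2 b.2
    have h2 := index_lt b.2 a.2
    simp only [wp_seq, wp_setReg, wp_setWArr, NExp.eval, NExp.size, WExp.eval, WExp.size,
      State.setR_reg, State.setR_arr, State.setR_warr, State.setWA_reg, State.setWA_warr,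
      reduceIte, Nat.reduceEqDiff, OfNat.zero_ne_ofNat, hrj, hx, hy, hw, hn']
    refine ⟨by omega, by omega, by omega, by omega, by omega, fun x y => ?_⟩
    simp only [Function.update_apply, index_eq_iff y.2 a.2, index_eq_iff y.2 b.2, Fin.val_inj]
    have hor : (∃ i : Fin m, (i : ℕ) < j + 1 ∧ s((e i).1, (e i).2) = s(x, y)) ↔
        s(a, b) = s(x, y) ∨ ∃ i : Fin m, i < j ∧ s((e i).1, (e i).2) = s(x, y) := by
      constructor
      · rintro ⟨i, hi, h⟩
        rcases Nat.lt_succ_iff_lt_or_eq.1 hi with h' | h'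
        · exact .inr ⟨i, h', h⟩
        · left
          obtain rfl : i = ⟨j, hj⟩ := Fin.ext h'
          rwa [hab] at h
      · rintro (h | ⟨i, hi, h⟩)
        · exact ⟨⟨j, hj⟩, by simp, by rwa [hab]⟩
        · exact ⟨i, by omega, h⟩
    have hsym : s(a, b) = s(x, y) ↔ (x = a ∧ y = b) ∨ (x = b ∧ y = a) := by
      rw [Sym2.eq_iff]; constructor <;> rintro (⟨rfl, rfl⟩ | ⟨rfl, rfl⟩) <;> simp
    by_cases hs : s(a, b) = s(x, y)
    · rw [if_pos (hor.2 (.inl hs)), ← hs]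
      rcases hsym.1 hs with h | h
      · simp [h]
      · simp [h]
    · have hn1 : ¬ (x = a ∧ y = b) := fun h => hs (hsym.2 (.inl h))
      have hn2 : ¬ (x = b ∧ y = a) := fun h => hs (hsym.2 (.inr h))
      rw [if_neg hn2, if_neg hn1, hI x y]
      simp only [hor, hs, false_or]
  · rintro t τ - ⟨ht, hI, -⟩
    simp only [NExp.size] at ht
    refine ⟨by omega, fun x y hx hy => ?_⟩
    have := hI ⟨x, hx⟩ ⟨y, hy⟩
    simp only at this
    rw [this]
    by_cases ha : G.Adj ⟨x, hx⟩ ⟨y, hy⟩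
    · have : s(⟨x, hx⟩, ⟨y, hy⟩) ∈ G.edgeSet := ha
      rw [← he.2] at this
      obtain ⟨i, hi⟩ := this
      rw [if_pos ⟨i, i.2, hi⟩, ← edgeMatrix_of_adj ha]
    · rw [if_neg]
      · by_contra hne
        obtain ⟨x', y', ha', rfl, rfl⟩ :=
          exists_adj_of_edgeMatrix_lt_top (lt_top_iff_ne_top.2 fun h => hne h.symm)
        exact ha ha'
      · rintro ⟨i, -, hi⟩
        have : s(⟨x, hx⟩, ⟨y, hy⟩) ∈ G.edgeSet := by rw [← he.2]; exact ⟨i, hi⟩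
        exact ha this

/-! ### Sorting the neighbourhoods -/

/-- The number of items with a finite key. -/
noncomputable def finiteKeys (n : ℕ) (H : ℕ → ℝ≥0∞) : ℕ :=
  ((Finset.range n).filter fun x => H x < ⊤).card

theorem finiteKeys_remove {n x : ℕ} {H : ℕ → ℝ≥0∞} (hx : x < n) (h : H x < ⊤) :
    finiteKeys n (Function.update H x ⊤) + 1 = finiteKeys n H := by
  have hmem : x ∈ (Finset.range n).filter fun x => H x < ⊤ := by simp [hx, h]
  rw [finiteKeys, finiteKeys, ← Finset.card_erase_add_one hmem]
  congr 2
  ext z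
  by_cases hz : z = x <;> simp [hz]

theorem SortedRow.congr {n y l : ℕ} {A : ℕ → ℝ≥0∞} {N N' : ℕ → ℕ} (h : SortedRow n A y N l)
    (hN : ∀ j, j < l → N' j = N j) : SortedRow n A y N' l where
  pos := h.pos
  zero := by rw [hN 0 h.pos, h.zero]
  lt j hj := by rw [hN j hj]; exact h.lt j hj
  inj i j hi hj := by rw [hN i hi, hN j hj]; exact h.inj i j hi hj
  surj x hx hA := by
    obtain ⟨j, hj, rfl⟩ := h.surj x hx hA
    exact ⟨j, hj, hN j hj⟩
  mono i j hij hj := by rw [hN i (by omega), hN j hj]; exact h.mono i j hij hj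

/-- Puts all vertices into the queue, with the entries of row `r5` of the weight matrix as keys. -/
def fillQueue : Prog :=
  .forLt 6 (.reg 0) <|
    .seq (.setReg 4 (.reg 6)) <|
    .seq (.setWReg 0 (.get 2 (.add (.mul (.reg 5) (.reg 0)) (.reg 6)))) heapUpdate

theorem fillQueue_spec {B n y : ℕ} {σ : State} (hB : 2 * n < B) (hn : σ.reg 0 = n)
    (hy : σ.reg 5 = y) (hT : IsHeap n (σ.warr 3) fun _ => ⊤) :
    Wp B fillQueue σ fun t τ => t ≤ n * (50 * (Nat.log 2 n + 2) + 20) + 10 ∧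
      IsHeap n (τ.warr 3) fun x => if x < n then σ.warr 2 (y * n + x) else ⊤ := by
  refine (wp_forLt (N := n) (c := 50 * (Nat.log 2 n + 2) + 10)
    (I := fun j τ => IsHeap n (τ.warr 3) fun x => if x < j then σ.warr 2 (y * n + x) else ⊤)
    (by omega) rfl (by simpa using hT) ?_ ?_).mono ?_
  · intro τ hf
    simp [hf.reg 0 rfl, hn]
  · intro j τ hj hf hrj hI
    have hn' : τ.reg 0 = n := by rw [hf.reg 0 rfl, hn]
    have hy' : τ.reg 5 = y := by rw [hf.reg 5 rfl, hy]
    have hA : τ.warr 2 = σ.warr 2 := hf.warr 2 rfl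
    simp [hrj, hn', hy', hA]
    refine ⟨by omega, (heapUpdate_spec (n := n) (v := j) hB (by simpa using hn') (by simp) hj
      (by simpa using hI)).mono ?_⟩
    rintro t ρ - ⟨ht, hh⟩
    refine ⟨by omega, ?_⟩
    convert hh using 1
    funext x
    by_cases hxj : x = j
    · simp [hxj]
    · simp [hxj, show x ≤ j ↔ x < j by omega]
  · rintro t τ - ⟨ht, hI, -⟩
    simp only [NExp.size] at ht
    exact ⟨by nlinarith, hI⟩

/-- Moves the items from the queue to row `r5` of array `2`, from position `r7` on. -/
def drainQueue : Prog :=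
  .loop (.wlt (.get 3 (.const 1)) .infty) <|
    .seq heapExtract <|
    .seq (.setArr 2 (.add (.mul (.reg 5) (.reg 0)) (.reg 7)) (.reg 4))
      (.setReg 7 (.add (.reg 7) (.const 1)))

/-- The invariant compares all listed keys with all remaining ones, so appending a minimum keeps the
list sorted. The owner `y` is not in the queue, as `E y = ⊤`; it already stands at position `0`, and
giving it the key `0` does not disturb the order. -/
theorem drainQueue_spec {B n y : ℕ} {σ : State} {E : ℕ → ℝ≥0∞} (hB : 2 * n < B)
    (hB' : n * n < B) (hn0 : 0 < n) (hn : σ.reg 0 = n) (hy : σ.reg 5 = y) (hyn : y < n)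
    (h7 : σ.reg 7 = 1) (hT : IsHeap n (σ.warr 3) E) (hEy : E y = ⊤) (hN0 : σ.arr 2 (y * n) = y) :
    Wp B drainQueue σ fun t τ => t ≤ n * (100 * (Nat.log 2 n + 2) + 30) + 10 ∧
      IsHeap n (τ.warr 3) (fun _ => ⊤) ∧
      (∀ i, i < y * n ∨ y * n + n ≤ i → τ.arr 2 i = σ.arr 2 i) ∧
      τ.reg 7 = 1 + finiteKeys n E ∧ 1 + finiteKeys n E ≤ n ∧
      SortedRow n (Function.update E y 0) y (fun j => τ.arr 2 (y * n + j)) (τ.reg 7) := by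
  have hcard : 1 + finiteKeys n E ≤ n := by
    have h := Finset.card_erase_add_one (Finset.mem_range.2 hyn)
    rw [Finset.card_range] at h
    suffices finiteKeys n E ≤ ((Finset.range n).erase y).card by omega
    refine Finset.card_le_card fun x hx => ?_
    simp only [Finset.mem_filter] at hx
    refine Finset.mem_erase.2 ⟨?_, hx.1⟩
    rintro rfl
    simp [hEy] at hx
  refine (wp_loop (φ := finiteKeys n E * (100 * (Nat.log 2 n + 2) + 30))
    (I := fun φ τ => ∃ (H : ℕ → ℝ≥0∞) (l : ℕ), τ.reg 7 = l ∧ 1 ≤ l ∧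
      l + finiteKeys n H = 1 + finiteKeys n E ∧ IsHeap n (τ.warr 3) H ∧
      τ.arr 2 (y * n) = y ∧
      (∀ j, 1 ≤ j → j < l → τ.arr 2 (y * n + j) < n ∧ E (τ.arr 2 (y * n + j)) < ⊤ ∧
        H (τ.arr 2 (y * n + j)) = ⊤) ∧
      (∀ i j, 1 ≤ i → i < j → j < l → τ.arr 2 (y * n + i) ≠ τ.arr 2 (y * n + j)) ∧
      (∀ x, x < n → H x = E x ∨ H x = ⊤ ∧ ∃ j, 1 ≤ j ∧ j < l ∧ τ.arr 2 (y * n + j) = x) ∧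
      (∀ j x, 1 ≤ j → j < l → x < n → E (τ.arr 2 (y * n + j)) ≤ H x) ∧
      (∀ i j, 1 ≤ i → i ≤ j → j < l →
        E (τ.arr 2 (y * n + i)) ≤ E (τ.arr 2 (y * n + j))) ∧
      (∀ i, i < y * n ∨ y * n + n ≤ i → τ.arr 2 i = σ.arr 2 i) ∧
      φ = finiteKeys n H * (100 * (Nat.log 2 n + 2) + 30))
    ⟨E, 1, h7, le_rfl, rfl, hT, hN0, by omega, by omega, fun x hx => .inl rfl, by omega, by omega,
      fun i _ => rfl, rfl⟩ ?_).mono ?_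
  · rintro φ τ hf ⟨H, l, hl, h1, hlc, hH, hz, hlt, hinj, hor, hle, hmono, hfr, rfl⟩ hb
    simp only [Test.Holds, WExp.eval, NExp.eval] at hb
    have hn' : τ.reg 0 = n := by rw [hf.reg 0 rfl, hn]
    refine wp_seq.2 ((heapExtract_spec hB hn0 hn' hH).mono ?_)
    rintro t ρ hf' ⟨ht, x, hx, h4, hxk, hheap⟩
    have hn'' : ρ.reg 0 = n := by rw [hf'.reg 0 rfl, hn']
    have hy'' : ρ.reg 5 = y := by rw [hf'.reg 5 rfl, hf.reg 5 rfl, hy]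
    have h7'' : ρ.reg 7 = l := by rw [hf'.reg 7 rfl, hl]
    have ha'' : ρ.arr 2 = τ.arr 2 := by rw [hf'.arr 2 rfl]
    rw [← hxk] at hb
    -- The extracted key is finite, so `x` has not been removed before and still carries its
    -- original key.
    have hEx : E x = H x := by
      rcases hor x hx with h | h
      · exact h.symm
      · rw [h.1] at hb; exact absurd hb (lt_irrefl _)
    have hrem := finiteKeys_remove hx hb
    have hln : l < n := by omega
    have hidx := index_lt hyn hln
    have hnew : ∀ j, j < l →
        Function.update (τ.arr 2) (y * n + l) x (y * n + j) = τ.arr 2 (y * n + j) := by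
      intro j hj
      rw [Function.update_of_ne (by omega)]
    simp only [wp_seq, wp_setReg, wp_setArr, NExp.eval, NExp.size, Test.size, WExp.size,
      State.setA_reg, State.setA_arr, State.setA_warr, State.setR_reg, State.setR_arr,
      State.setR_warr, reduceIte, hn'', hy'', h7'', ha'', h4]
    refine ⟨by omega, by omega, by omega,
      finiteKeys n (Function.update H x ⊤) * (100 * (Nat.log 2 n + 2) + 30),
      ⟨Function.update H x ⊤, l + 1, rfl, by omega, by omega, hheap, ?_, ?_, ?_, ?_, ?_, ?_, ?_,
        rfl⟩, ?_⟩
    · exact (hnew 0 (by omega)).trans hz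
    · intro j h1j hj
      rcases Nat.lt_succ_iff_lt_or_eq.1 hj with hj | rfl
      · rw [hnew j hj]
        refine ⟨(hlt j h1j hj).1, (hlt j h1j hj).2.1, ?_⟩
        by_cases he : τ.arr 2 (y * n + j) = x
        · simp [he]
        · rw [Function.update_of_ne he]; exact (hlt j h1j hj).2.2
      · simp [hx, hEx, hb]
    · intro i j h1i hij hj
      rcases Nat.lt_succ_iff_lt_or_eq.1 hj with hj | rfl
      · rw [hnew j hj, hnew i (by omega)]; exact hinj i j h1i hij hj
      · rw [hnew i hij, Function.update_self]
        intro he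
        have := (hlt i h1i hij).2.2
        rw [he] at this
        rw [this] at hb
        exact lt_irrefl _ hb
    · intro z hzn
      by_cases hzx : z = x
      · subst hzx
        exact .inr ⟨by simp, l, h1, by omega, by simp⟩
      · rw [Function.update_of_ne hzx]
        refine (hor z hzn).imp_right fun h => ⟨h.1, ?_⟩
        obtain ⟨j, h1j, hj, he⟩ := h.2
        exact ⟨j, h1j, by omega, by rw [hnew j hj, he]⟩
    · intro j z h1j hj hzn
      by_cases hzx : z = x
      · simp [hzx]
      · rw [Function.update_of_ne hzx]
        rcases Nat.lt_succ_iff_lt_or_eq.1 hj with hj | rfl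
        · rw [hnew j hj]; exact hle j z h1j hj hzn
        · rw [Function.update_self, hEx, hxk]; exact hH.root_le hzn
    · intro i j h1i hij hj
      rcases Nat.lt_succ_iff_lt_or_eq.1 hj with hj | rfl
      · rw [hnew j hj, hnew i (by omega)]; exact hmono i j h1i hij hj
      · rcases Nat.lt_or_eq_of_le hij with hij | rfl
        · rw [hnew i hij, Function.update_self, hEx]; exact hle i x h1i hij hx
        · exact le_rfl
    · intro i hi
      rw [Function.update_of_ne (by omega)]; exact hfr i hi
    · rw [← hrem, Nat.add_mul]; omega
  · rintro t τ - ⟨ht, ⟨φ, H, l, hl, h1, hlc, hH, hz, hlt, hinj, hor, hle, hmono, hfr, rfl⟩, hb⟩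
    simp only [Test.Holds, WExp.eval, NExp.eval, Test.size, WExp.size, NExp.size, not_lt,
      top_le_iff] at hb ht
    have htop : ∀ x, x < n → H x = ⊤ := fun x hx => by
      have := hH.root_le hx
      rwa [hb, top_le_iff] at this
    have hH0 : finiteKeys n H = 0 := by
      rw [finiteKeys, Finset.card_eq_zero, Finset.filter_eq_empty_iff]
      intro x hx
      simp [htop x (Finset.mem_range.1 hx)]
    have hney : ∀ j, 1 ≤ j → j < l → τ.arr 2 (y * n + j) ≠ y := by
      intro j h1j hj he
      have := (hlt j h1j hj).2.1
      rw [he, hEy] at this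
      exact lt_irrefl _ this
    refine ⟨?_, ⟨hH.node, fun x hx => by rw [hH.leaf x hx, htop x hx]⟩, hfr, by omega, hcard, ?_⟩
    · have : finiteKeys n E ≤ n := by omega
      have := Nat.mul_le_mul_right (100 * (Nat.log 2 n + 2) + 30) this
      omega
    · rw [hl]
      refine ⟨h1, hz, ?_, ?_, ?_, ?_⟩
      · intro j hj
        rcases Nat.eq_zero_or_pos j with rfl | hj0
        · simpa [hz] using hyn
        · exact (hlt j hj0 hj).1
      · intro i j hi hj he
        rcases Nat.eq_zero_or_pos i with rfl | hi0 <;> rcases Nat.eq_zero_or_pos j with rfl | hj0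
        · rfl
        · exact absurd (he.symm.trans hz) (hney j hj0 hj)
        · exact absurd (he.trans hz) (hney i hi0 hi)
        · rcases lt_trichotomy i j with h | h | h
          · exact absurd he (hinj i j hi0 h hj)
          · exact h
          · exact absurd he.symm (hinj j i hj0 h hi)
      · intro x hx hA
        by_cases hxy : x = y
        · exact ⟨0, h1, by rw [hxy]; exact hz⟩
        · rw [Function.update_of_ne hxy] at hA
          rcases hor x hx with h | ⟨-, j, -, hj, he⟩
          · rw [htop x hx] at h; rw [← h] at hA; exact absurd hA (lt_irrefl _)
          · exact ⟨j, hj, he⟩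
      · intro i j hij hj
        rcases Nat.eq_zero_or_pos i with rfl | hi0
        · simp [hz]
        · rw [Function.update_of_ne (hney i hi0 (by omega)),
            Function.update_of_ne (hney j (by omega) hj)]
          exact hmono i j hi0 hij hj

/-- Sorts the neighbours of the vertex `r5` into its row of array `2`, stores their number
(including the vertex itself) in array `3`, and sets the diagonal entry of the weight matrix. -/
def sortRow : Prog :=
  .seq fillQueue <|
  .seq (.setArr 2 (.mul (.reg 5) (.reg 0)) (.reg 5)) <|
  .seq (.setReg 7 (.const 1)) <|
  .seq drainQueue <|
  .seq (.setArr 3 (.reg 5) (.reg 7)) (.setWArr 2 (.add (.mul (.reg 5) (.reg 0)) (.reg 5)) .zero)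

/-- Sorts the neighbours of all vertices. -/
def sortRows : Prog := .forLt 5 (.reg 0) sortRow

/-- Row `y` is sorted while its diagonal entry is still `∞`, so the keys are those of `edgeMatrix`;
only then is the diagonal set to `0`, which gives `weightMatrix`. The exact row length, one more
than the degree, is needed to count the arcs of the first level. -/
theorem sortRows_spec {B n : ℕ} {G : SimpleGraph (Fin n)} {w : Sym2 (Fin n) → ℝ≥0} {σ : State}
    (hB : 2 * n < B) (hB' : n * n < B) (hn0 : 0 < n) (hn : σ.reg 0 = n)
    (hA : ∀ x y, x < n → y < n → σ.warr 2 (x * n + y) = edgeMatrix G w x y)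
    (hT : IsHeap n (σ.warr 3) fun _ => ⊤) :
    Wp B sortRows σ fun t τ => t ≤ 300 * (n * n * (Nat.log 2 n + 2)) ∧
      IsHeap n (τ.warr 3) (fun _ => ⊤) ∧
      (∀ x y, x < n → y < n → τ.warr 2 (x * n + y) = weightMatrix G w x y) ∧
      ∀ y, y < n → τ.arr 3 y = 1 + finiteKeys n (edgeMatrix G w y) ∧
        SortedRow n (weightMatrix G w y) y (fun j => τ.arr 2 (y * n + j)) (τ.arr 3 y) := by
  refine (wp_forLt (N := n) (c := n * (150 * (Nat.log 2 n + 2) + 50) + 50)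
    (I := fun j τ => IsHeap n (τ.warr 3) (fun _ => ⊤) ∧
      (∀ x y, x < n → y < n → τ.warr 2 (x * n + y) =
        if x = y ∧ x < j then 0 else edgeMatrix G w x y) ∧
      ∀ y, y < j → τ.arr 3 y = 1 + finiteKeys n (edgeMatrix G w y) ∧
        SortedRow n (weightMatrix G w y) y (fun j => τ.arr 2 (y * n + j)) (τ.arr 3 y))
    (by omega) rfl (by simpa using ⟨hT, hA⟩) ?_ ?_).mono ?_
  · intro τ hf
    simp [hf.reg 0 rfl, hn]
  · rintro y τ hyn hf hr5 ⟨hT, hA, hrows⟩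
    have hn1 : τ.reg 0 = n := by rw [hf.reg 0 rfl, hn]
    refine wp_seq.2 ((fillQueue_spec hB hn1 hr5 hT).mono ?_)
    rintro t ρ hf' ⟨ht, hE⟩
    have hEeq : (fun x => if x < n then τ.warr 2 (y * n + x) else ⊤) = edgeMatrix G w y := by
      funext x
      split_ifs with hx
      · rw [hA y x hyn hx, if_neg (by omega)]
      · by_contra hne
        obtain ⟨-, x', -, -, rfl⟩ :=
          exists_adj_of_edgeMatrix_lt_top (lt_top_iff_ne_top.2 fun h => hne h.symm)
        exact hx x'.2
    rw [hEeq] at hE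
    have hn2 : ρ.reg 0 = n := by rw [hf'.reg 0 rfl, hn1]
    have hy2 : ρ.reg 5 = y := by rw [hf'.reg 5 rfl, hr5]
    have ha2 : ρ.arr = τ.arr := funext fun a => hf'.arr a rfl
    have hA2 : ρ.warr 2 = τ.warr 2 := hf'.warr 2 rfl
    have hidx := index_lt hyn hyn
    simp only [wp_seq, wp_setReg, wp_setArr, NExp.eval, NExp.size, hn2, hy2]
    refine ⟨by omega, by omega, by omega, (drainQueue_spec (y := y) hB hB' hn0
      (by simpa using hn2) (by simpa using hy2) hyn (by simp) (by simpa using hE)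
      (edgeMatrix_self y) (by simp)).mono ?_⟩
    rintro t' ρ' hf'' ⟨ht', hT', hfr, h7, hcard, hrow⟩
    have hn3 : ρ'.reg 0 = n := by rw [hf''.reg 0 rfl]; simpa using hn2
    have hy3 : ρ'.reg 5 = y := by rw [hf''.reg 5 rfl]; simpa using hy2
    have ha3 : ρ'.arr 3 = τ.arr 3 := by rw [hf''.arr 3 rfl]; simp [ha2]
    have hA3 : ρ'.warr 2 = τ.warr 2 := by rw [hf''.warr 2 rfl]; simp [hA2]
    simp only [wp_setWArr, NExp.eval, NExp.size, WExp.eval, WExp.size,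
      State.setA_reg, State.setA_warr, State.setA_arr, State.setWA_arr, State.setWA_warr,
      State.setR_arr, State.setR_warr, reduceIte, Nat.reduceEqDiff, hn3, hy3, ha3, hA3]
    refine ⟨by omega, by omega, by omega, ?_, hT', ?_, ?_⟩
    · nlinarith
    · intro x z hx hz
      simp only [Function.update_apply, index_eq_iff hz hyn, hA x z hx hz]
      by_cases h : x = y ∧ z = y
      · simp [h]
      · rw [if_neg h]
        congr 1
        simp only [eq_iff_iff, and_congr_right_iff]
        omega
    · intro z hz
      rcases Nat.lt_succ_iff_lt_or_eq.1 hz with hz | rfl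
      · rw [Function.update_of_ne (by omega)]
        refine ⟨(hrows z hz).1, (hrows z hz).2.congr fun j hj => ?_⟩
        have hj' : j < n := by have := (hrows z hz).2.le; omega
        -- The earlier rows end before cell `y * n`, and the work on row `y` leaves those cells
        -- unchanged.
        have h1 : z * n + j < y * n := by nlinarith
        rw [hfr _ (.inl h1)]
        simp only [State.setR_arr, State.setA_arr, reduceIte, ha2]
        rw [Function.update_of_ne (by omega)]
      · rw [Function.update_self]
        refine ⟨h7, ?_⟩
        convert hrow using 1
        funext x
        simp only [weightMatrix, Function.update_apply, eq_comm]
  · rintro t τ - ⟨ht, ⟨hT, hA, hrows⟩, -⟩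
    simp only [NExp.size] at ht
    refine ⟨?_, hT, fun x y hx hy => ?_, hrows⟩
    · have : n ≤ n * n := Nat.le_mul_self n
      nlinarith
    · rw [hA x y hx hy, weightMatrix]
      simp [hx]

/-! ### The degree thresholds -/

/-- Capping before the multiplication loses nothing, so for `r ≤ n` the thresholds are computed
without leaving the range up to `n * n`. -/
theorem min_pow_succ {r n j : ℕ} (hr : 1 ≤ r) : min (min (r ^ j) n * r) n = min (r ^ (j + 1)) n := by
  rw [pow_succ]
  rcases le_total (r ^ j) n with h | h
  · rw [min_eq_left h]
  · rw [min_eq_right h, min_eq_right (Nat.le_mul_of_pos_right n hr),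
      min_eq_right (h.trans (Nat.le_mul_of_pos_right _ hr))]

/-- Stores `min (r6 ^ j) n` in the cells `j ≤ k` of array `4`. -/
def cappedPowers : Prog :=
  .seq (.setArr 4 (.const 0) (.const 1)) <|
  .forLt 7 (.reg 2) <|
    .seq (.setReg 8 (.mul (.get 4 (.reg 7)) (.reg 6))) <|
    .ite (.lt (.reg 8) (.reg 0))
      (.setArr 4 (.add (.reg 7) (.const 1)) (.reg 8))
      (.setArr 4 (.add (.reg 7) (.const 1)) (.reg 0))

theorem cappedPowers_spec {B n k r : ℕ} {σ : State} (hB : n * n < B) (hkB : k < B) (hn0 : 0 < n)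
    (hn : σ.reg 0 = n) (hk : σ.reg 2 = k) (hr : σ.reg 6 = r) (hr1 : 1 ≤ r) (hrn : r ≤ n) :
    Wp B cappedPowers σ fun t τ => t ≤ 40 * (k + 1) ∧
      ∀ j, j ≤ k → τ.arr 4 j = min (r ^ j) n := by
  have hnn : n ≤ n * n := Nat.le_mul_self n
  simp only [cappedPowers, wp_seq, wp_setArr, NExp.eval, NExp.size]
  refine ⟨by omega, by omega, (wp_forLt (N := k) (c := 25)
    (I := fun i τ => ∀ j, j ≤ i → τ.arr 4 j = min (r ^ j) n) hkB rfl ?_ ?_ ?_).mono ?_⟩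
  · intro j hj
    obtain rfl : j = 0 := by omega
    simp; omega
  · intro τ hf
    simp [hf.reg 2 rfl, hk]
  · intro i τ hi hf h7 hI
    have hn1 : τ.reg 0 = n := by rw [hf.reg 0 rfl]; simpa using hn
    have hr1' : τ.reg 6 = r := by rw [hf.reg 6 rfl]; simpa using hr
    have hle : min (r ^ i) n * r ≤ n * n := Nat.mul_le_mul (min_le_right _ _) hrn
    have key : ∀ c, c = min (min (r ^ i) n * r) n → ∀ j, j ≤ i + 1 →
        Function.update (τ.arr 4) (i + 1) c j = min (r ^ j) n := by
      intro c hc j hj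
      by_cases h : j = i + 1
      · subst h; rw [Function.update_self, hc, min_pow_succ hr1]
      · rw [Function.update_of_ne h]; exact hI j (by omega)
    simp only [wp_seq, wp_setReg, wp_setArr, wp_ite, NExp.eval, NExp.size, Test.Holds, Test.size,
      State.setR_reg, State.setR_arr, State.setA_arr, reduceIte, Nat.reduceEqDiff,
      OfNat.zero_ne_ofNat, h7, hn1, hr1', hI i le_rfl]
    refine ⟨by omega, fun h => ⟨by omega, by omega, by omega, key _ (min_eq_left h.le).symm⟩,
      fun h => ⟨by omega, by omega, by omega, key _ (min_eq_right (not_lt.1 h)).symm⟩⟩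
  · rintro t τ - ⟨ht, hI, -⟩
    simp only [NExp.size] at ht
    exact ⟨by omega, hI⟩

/-- Computes the least `r` with `m / n + 1 ≤ r ^ k`, and stores the thresholds in array `4`:
`min (r ^ j) n` for `j < k`, and `n + 1` for `j = k`. -/
def thresholds : Prog :=
  .seq (.setReg 5 (.add (.div (.reg 1) (.reg 0)) (.const 1))) <|
  .seq (.setReg 6 (.const 0)) <|
  .seq (.loop (.lt (.get 4 (.reg 2)) (.reg 5)) <|
    .seq (.setReg 6 (.add (.reg 6) (.const 1))) cappedPowers) <|
  .setArr 4 (.reg 2) (.add (.reg 0) (.const 1))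

/-- The values `r = 1, 2, …` are tried in turn. As `r ≤ r ^ k`, at most `m / n + 1 ≤ n` trials
occur, each with `O(k)` steps. -/
theorem thresholds_spec {B n m k : ℕ} {σ : State} (hB : n * n + 1 < B) (hkB : k < B) (hn0 : 0 < n)
    (hk1 : 1 ≤ k) (hn : σ.reg 0 = n) (hm : σ.reg 1 = m) (hk : σ.reg 2 = k)
    (hS : σ.arr 4 k = 0) (hq : m / n + 1 ≤ n) :
    Wp B thresholds σ fun t τ => t ≤ 100 * (n * (k + 1)) ∧
      ∃ r, 1 ≤ r ∧ (r - 1) ^ k ≤ m / n ∧ m / n + 1 ≤ r ^ k ∧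
        (∀ j, j < k → τ.arr 4 j = min (r ^ j) n) ∧ τ.arr 4 k = n + 1 := by
  have hnn : n ≤ n * n := Nat.le_mul_self n
  obtain ⟨q, hqdef⟩ : ∃ q, q = m / n + 1 := ⟨_, rfl⟩
  rw [← hqdef] at hq ⊢
  have hq1 : 1 ≤ q := by rw [hqdef]; exact Nat.le_add_left _ _
  rw [show m / n = q - 1 by rw [hqdef]; rfl]
  simp only [thresholds, wp_seq, wp_setReg, NExp.eval, NExp.size, hn, hm, ← hqdef]
  refine ⟨by omega, by omega, (wp_loop (φ := (q - 0) * (50 * (k + 1)))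
    (I := fun φ τ => ∃ r, τ.reg 6 = r ∧ τ.reg 5 = q ∧ r ≤ q ∧ (1 ≤ r → (r - 1) ^ k < q) ∧
      -- The cell is `0` initially, so the first test succeeds and the search really starts with `r
      -- = 1`.
      (r = 0 → τ.arr 4 k = 0) ∧ (1 ≤ r → ∀ j, j ≤ k → τ.arr 4 j = min (r ^ j) n) ∧
      φ = (q - r) * (50 * (k + 1)))
    ⟨0, by simp, by simp, by omega, by omega, by simpa using hS, by omega, rfl⟩ ?_).mono ?_⟩
  · rintro φ τ hf ⟨r, h6, h5, hrq, hpow, hz, hcap, rfl⟩ hb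
    have hn1 : τ.reg 0 = n := by rw [hf.reg 0 rfl]; simpa using hn
    have hk1' : τ.reg 2 = k := by rw [hf.reg 2 rfl]; simpa using hk
    simp only [Test.Holds, NExp.eval, hk1', h5] at hb
    have hrk : r ^ k < q := by
      rcases Nat.eq_zero_or_pos r with rfl | hr
      · rw [zero_pow (by omega)]; omega
      · rw [hcap hr k le_rfl] at hb
        -- Since `q ≤ n`, the cap cannot be what makes the test succeed.
        exact (min_lt_iff.1 hb).resolve_right (by omega)
    have hrlt : r < q := lt_of_le_of_lt (Nat.le_self_pow (by omega) r) hrk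
    simp only [wp_seq, wp_setReg, NExp.eval, NExp.size, h6]
    refine ⟨by omega, (cappedPowers_spec (n := n) (k := k) (r := r + 1) (by omega) hkB hn0
      (by simpa using hn1) (by simpa using hk1') (by simp) (by omega) (by omega)).mono ?_⟩
    rintro t ρ hf' ⟨ht, hS'⟩
    refine ⟨_, ⟨r + 1, by rw [hf'.reg 6 rfl]; simp, by rw [hf'.reg 5 rfl]; simpa using h5, hrlt,
      fun _ => by simpa using hrk, by omega, fun _ => hS', rfl⟩, ?_⟩
    simp only [Test.size, NExp.size]
    obtain ⟨d, hd⟩ := Nat.exists_eq_add_of_lt hrlt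
    rw [show q - (r + 1) = d by omega, show q - r = d + 1 by omega, Nat.add_mul]
    omega
  · rintro t τ hf ⟨ht, ⟨φ, r, h6, h5, hrq, hpow, hz, hcap, rfl⟩, hb⟩
    have hn1 : τ.reg 0 = n := by rw [hf.reg 0 rfl]; simpa using hn
    have hk1' : τ.reg 2 = k := by rw [hf.reg 2 rfl]; simpa using hk
    simp only [Test.Holds, NExp.eval, hk1', h5, not_lt] at hb
    have hr1 : 1 ≤ r := by
      by_contra h
      rw [hz (by omega)] at hb; omega
    have hle := (hb.trans_eq (hcap hr1 k le_rfl)).trans (min_le_left _ _)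
    have hpow := hpow hr1
    simp only [wp_setArr, NExp.eval, NExp.size, hn1, hk1', State.setA_arr, reduceIte]
    simp only [Test.size, NExp.size] at ht
    refine ⟨by omega, by omega, ?_, r, hr1, by omega, hle, fun j hj => ?_, by simp⟩
    · have h1 : (q - 0) * (50 * (k + 1)) ≤ n * (50 * (k + 1)) := Nat.mul_le_mul_right _ (by omega)
      have h2 : k + 1 ≤ n * (k + 1) := Nat.le_mul_of_pos_left _ hn0
      have h3 : n * (50 * (k + 1)) = 50 * (n * (k + 1)) := by ring
      omega
    · rw [Function.update_of_ne (by omega)]; exact hcap hr1 j hj.le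

/-! ### The arcs of a level -/

/-- The arcs from the first `s` entries of the rows to the owners of the rows: the heads of the
arcs with tail `x` are the first `cnt x` entries of row `x` of `out`. The rows `y < i` are
complete, and row `i` is complete up to its entry `i'`. -/
structure ArcLists (n s : ℕ) (nbr len cnt out : ℕ → ℕ) (i i' : ℕ) : Prop where
  lt : ∀ x q, x < n → q < cnt x → out (x * (n * n) + q) < n
  arc : ∀ y j, y < i → j < min (len y) s →
    ∃ q, q < cnt (nbr (y * n + j)) ∧ out (nbr (y * n + j) * (n * n) + q) = y
  arc' : ∀ j, j < i' → ∃ q, q < cnt (nbr (i * n + j)) ∧ out (nbr (i * n + j) * (n * n) + q) = i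
  sum : ∑ x ∈ Finset.range n, cnt x = ∑ y ∈ Finset.range i, min (len y) s + i'

theorem sum_update_succ {n a : ℕ} (c : ℕ → ℕ) (ha : a < n) :
    ∑ x ∈ Finset.range n, Function.update c a (c a + 1) x = ∑ x ∈ Finset.range n, c x + 1 := by
  have h := Finset.mem_range.2 ha
  rw [Finset.sum_update_of_mem h, ← Finset.sum_sdiff (Finset.singleton_subset_iff.2 h)]
  simp only [Finset.sum_singleton]
  ring

/-- The rows of `out` have stride `n * n`. Fewer than `n * n` arcs have been stored before row `i`
is finished, so every counter is smaller than the stride and the new entry falls on a fresh cell. -/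
theorem ArcLists.push {n s i i' : ℕ} {nbr len cnt out : ℕ → ℕ}
    (h : ArcLists n s nbr len cnt out i i') (hi : i < n) (hi' : i' < min (len i) s)
    (hlen : ∀ y, y < n → len y ≤ n) (hnbr : ∀ y j, y < n → j < len y → nbr (y * n + j) < n) :
    cnt (nbr (i * n + i')) < n * n ∧
    ArcLists n s nbr len
      (Function.update cnt (nbr (i * n + i')) (cnt (nbr (i * n + i')) + 1))
      (Function.update out (nbr (i * n + i') * (n * n) + cnt (nbr (i * n + i'))) i) i (i' + 1) := by
  have hx : nbr (i * n + i') < n := hnbr i i' hi (hi'.trans_le (min_le_left _ _))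
  have hi'n : i' < n := hi'.trans_le ((min_le_left _ _).trans (hlen i hi))
  generalize hxdef : nbr (i * n + i') = x at hx ⊢
  have hsum : ∑ y ∈ Finset.range i, min (len y) s ≤ i * n := by
    have := Finset.sum_le_card_nsmul (Finset.range i) (fun y => min (len y) s) n fun y hy =>
      (min_le_left _ _).trans (hlen y ((Finset.mem_range.1 hy).trans hi))
    simpa using this
  have htot : ∀ z, z < n → cnt z < n * n := fun z hz => by
    have h1 := Finset.single_le_sum (f := cnt) (fun _ _ => Nat.zero_le _) (Finset.mem_range.2 hz)
    have h2 := index_lt hi hi'n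
    rw [h.sum] at h1
    omega
  have hkeep : ∀ z q, z < n → q < cnt z →
      Function.update out (x * (n * n) + cnt x) i (z * (n * n) + q) = out (z * (n * n) + q) := by
    intro z q hz hq
    rw [Function.update_of_ne]
    intro he
    obtain ⟨rfl, rfl⟩ := index_inj (hq.trans (htot z hz)) (htot x hx) he
    exact lt_irrefl _ hq
  have hold : ∀ z y, z < n → (∃ q, q < cnt z ∧ out (z * (n * n) + q) = y) →
      ∃ q, q < Function.update cnt x (cnt x + 1) z ∧
        Function.update out (x * (n * n) + cnt x) i (z * (n * n) + q) = y := by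
    rintro z y hz ⟨q, hq, he⟩
    refine ⟨q, hq.trans_le ?_, by rw [hkeep z q hz hq, he]⟩
    rw [Function.update_apply]
    split_ifs with hzx
    · subst hzx; omega
    · exact le_rfl
  refine ⟨htot x hx, ?_, ?_, ?_, ?_⟩
  · intro z q hz hq
    by_cases hzx : z = x
    · subst hzx
      rw [Function.update_self] at hq
      rcases Nat.lt_succ_iff_lt_or_eq.1 hq with hq | rfl
      · rw [hkeep z q hz hq]; exact h.lt z q hz hq
      · rw [Function.update_self]; exact hi
    · rw [Function.update_of_ne hzx] at hq
      rw [hkeep z q hz hq]; exact h.lt z q hz hq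
  · intro y j hy hj
    exact hold _ _ (hnbr y j (by omega) (hj.trans_le (min_le_left _ _))) (h.arc y j hy hj)
  · intro j hj
    rcases Nat.lt_succ_iff_lt_or_eq.1 hj with hj | rfl
    · exact hold _ _ (hnbr i j hi (hj.trans (hi'.trans_le (min_le_left _ _)))) (h.arc' j hj)
    · rw [hxdef]
      exact ⟨cnt x, by simp, by simp⟩
  · rw [sum_update_succ _ hx, h.sum, add_assoc]

/-- Builds the arc lists for the threshold in cell `r15` of array `4`: their lengths are stored in
array `5`, and their entries in array `6`. -/
def buildArcs : Prog :=
  .seq (.forLt 5 (.reg 0) (.setArr 5 (.reg 5) (.const 0))) <|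
  .forLt 5 (.reg 0) <|
    .seq (.ite (.lt (.get 3 (.reg 5)) (.get 4 (.reg 15)))
      (.setReg 8 (.get 3 (.reg 5))) (.setReg 8 (.get 4 (.reg 15)))) <|
    .forLt 6 (.reg 8) <|
      .seq (.setReg 7 (.get 2 (.add (.mul (.reg 5) (.reg 0)) (.reg 6)))) <|
      .seq (.setArr 6 (.add (.mul (.reg 7) (.mul (.reg 0) (.reg 0))) (.get 5 (.reg 7))) (.reg 5))
        (.setArr 5 (.reg 7) (.add (.get 5 (.reg 7)) (.const 1)))

/-- Only the `n` counters are cleared. The lists are spread over about `n ^ 3` addresses, but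
entries beyond the counters never matter; the large address range costs word length, not time. -/
theorem buildArcs_spec {B n s : ℕ} {σ : State} (hB : n * (n * n) + 1 < B) (hn0 : 0 < n)
    (hn : σ.reg 0 = n) (hs : σ.arr 4 (σ.reg 15) = s) (hlen : ∀ y, y < n → σ.arr 3 y ≤ n)
    (hnbr : ∀ y j, y < n → j < σ.arr 3 y → σ.arr 2 (y * n + j) < n) :
    Wp B buildArcs σ fun t τ => t ≤ 150 * (n * n) ∧
      ArcLists n s (σ.arr 2) (σ.arr 3) (τ.arr 5) (τ.arr 6) n 0 := by
  have hnn : n ≤ n * n := Nat.le_mul_self n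
  have hnnn : n * n ≤ n * (n * n) := Nat.le_mul_of_pos_left _ hn0
  refine wp_seq.2 ((wp_forLt (N := n) (c := 3) (I := fun i τ => ∀ x, x < i → τ.arr 5 x = 0)
    (by omega) rfl (by simp) ?_ ?_).mono ?_)
  · intro τ hf
    simp [hf.reg 0 rfl, hn]
  · intro i τ hi hf h5 hI
    simp only [wp_setArr, NExp.eval, NExp.size, h5]
    refine ⟨by omega, by omega, le_rfl, fun x hx => ?_⟩
    simp only [State.setR_arr, State.setA_arr, reduceIte, Function.update_apply]
    split_ifs with h
    · rfl
    · exact hI x (by omega)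
  rintro t τ hf ⟨ht, hz, -⟩
  have hn1 : τ.reg 0 = n := by rw [hf.reg 0 rfl, hn]
  have hs1 : τ.arr 4 (τ.reg 15) = s := by rw [hf.reg 15 rfl, hf.arr 4 rfl, hs]
  have ha2 : τ.arr 2 = σ.arr 2 := hf.arr 2 rfl
  have ha3 : τ.arr 3 = σ.arr 3 := hf.arr 3 rfl
  refine (wp_forLt (N := n) (c := n * 40 + 30)
    (I := fun i τ => ArcLists n s (σ.arr 2) (σ.arr 3) (τ.arr 5) (τ.arr 6) i 0)
    (by omega) rfl ?_ ?_ ?_).mono ?_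
  · refine ⟨fun x q hx hq => ?_, by omega, by omega, ?_⟩
    · simp [hz x hx] at hq
    · simpa using hz
  · intro τ' hf
    simp [hf.reg 0 rfl, hn1]
  · intro i ρ hi hf h5 hI
    have hn2 : ρ.reg 0 = n := by rw [hf.reg 0 rfl, hn1]
    have hs2 : ρ.arr 4 (ρ.reg 15) = s := by rw [hf.reg 15 rfl, hf.arr 4 rfl, hs1]
    have hb2 : ρ.arr 2 = σ.arr 2 := by rw [hf.arr 2 rfl, ha2]
    have hb3 : ρ.arr 3 = σ.arr 3 := by rw [hf.arr 3 rfl, ha3]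
    have hmn : min (σ.arr 3 i) s ≤ n := (min_le_left _ _).trans (hlen i hi)
    refine wp_seq.2 (Wp.mono (Q := fun t π => t ≤ 10 ∧ π = ρ.setR 8 (min (σ.arr 3 i) s)) ?_ ?_)
    · simp only [wp_ite, wp_setReg, NExp.eval, NExp.size, Test.Holds, Test.size, h5, hb3, hs2]
      have := hlen i hi
      refine ⟨fun h => ⟨by omega, by omega, by rw [min_eq_left h.le]⟩,
        fun h => ⟨by omega, by omega, by rw [min_eq_right (not_lt.1 h)]⟩⟩
    · rintro t₁ π - ⟨ht₁, rfl⟩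
      refine (wp_forLt (N := min (σ.arr 3 i) s) (c := 30)
        (I := fun i' τ => ArcLists n s (σ.arr 2) (σ.arr 3) (τ.arr 5) (τ.arr 6) i i')
        (by omega) rfl (by simpa using hI) ?_ ?_).mono ?_
      · intro τ' hf
        simp [hf.reg 8 rfl]
      · intro i' π hi' hf' h6 hI'
        have hn3 : π.reg 0 = n := by rw [hf'.reg 0 rfl]; simpa using hn2
        have h53 : π.reg 5 = i := by rw [hf'.reg 5 rfl]; simpa using h5
        have hb23 : π.arr 2 = σ.arr 2 := by rw [hf'.arr 2 rfl]; simpa using hb2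
        have hx := hnbr i i' hi (hi'.trans_le (min_le_left _ _))
        obtain ⟨hc, hpush⟩ := hI'.push hi hi' hlen hnbr
        have hidx : σ.arr 2 (i * n + i') * (n * n) + π.arr 5 (σ.arr 2 (i * n + i')) <
            n * (n * n) := by nlinarith
        simp only [wp_seq, wp_setReg, wp_setArr, NExp.eval, NExp.size, State.setR_reg,
          State.setR_arr, State.setA_arr, State.setA_reg, reduceIte, Nat.reduceEqDiff,
          OfNat.zero_ne_ofNat, hn3, h53, h6, hb23]
        exact ⟨by omega, by omega, by omega, by omega, by omega, by omega, hpush⟩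
      · rintro t₂ π - ⟨ht₂, hI', -⟩
        simp only [NExp.size] at ht₂
        refine ⟨by omega, ?_⟩
        simp only [State.setR_arr]
        refine ⟨hI'.lt, fun y j hy hj => ?_, by omega, ?_⟩
        · rcases Nat.lt_succ_iff_lt_or_eq.1 hy with hy | rfl
          · exact hI'.arc y j hy hj
          · exact hI'.arc' j hj
        · rw [hI'.sum, Finset.sum_range_succ, add_zero]
  · rintro t₁ ρ - ⟨ht₁, hI, -⟩
    simp only [NExp.size] at ht ht₁
    refine ⟨?_, hI⟩
    have : n * (n * 40 + 30 + 1 + 7) = 40 * (n * n) + 38 * n := by ring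
    omega

/-! ### Dijkstra's algorithm -/

/-- The items in `S` are settled and have left the queue `H`; `c` separates the tentative
distances `D` of the settled items from the others; `d` bounds the tentative distances below. -/
structure Frontier (n : ℕ) (d : ℕ → ℝ≥0∞) (S : Finset ℕ) (c : ℝ≥0∞) (D H : ℕ → ℝ≥0∞) : Prop where
  key : ∀ x, x < n → H x = if x ∈ S then ⊤ else D x
  low : ∀ x, x ∈ S → D x ≤ c
  high : ∀ x, x < n → x ∉ S → c ≤ D x
  le : ∀ x, x < n → d x ≤ D x

namespace Frontier

variable {n : ℕ} {d : ℕ → ℝ≥0∞} {S : Finset ℕ} {c : ℝ≥0∞} {D H : ℕ → ℝ≥0∞}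

/-- A candidate `v ≥ c` cannot improve a settled item, whose value is at most `c`; hence `y` is
still in the queue. -/
theorem relax (h : Frontier n d S c D H) {y : ℕ} {v : ℝ≥0∞} (hc : c ≤ v) (hd : d y ≤ v)
    (hv : v < D y) :
    y ∉ S ∧ Frontier n d S c (Function.update D y v) (Function.update H y v) := by
  have hy : y ∉ S := fun hy => absurd (h.low y hy) (not_le.2 (hc.trans_lt hv))
  refine ⟨hy, fun x hx => ?_, fun x hx => ?_, fun x hx hxS => ?_, fun x hx => ?_⟩
  · by_cases hxy : x = y
    · subst hxy; simp [hy]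
    · simp [hxy, h.key x hx]
  · rw [Function.update_of_ne (by rintro rfl; exact hy hx)]; exact h.low x hx
  · by_cases hxy : x = y
    · subst hxy; simpa using hc
    · simpa [hxy] using h.high x hx hxS
  · by_cases hxy : x = y
    · subst hxy; simpa using hd
    · simpa [hxy] using h.le x hx

/-- The minimal key becomes the new separating value: earlier settled items lie below it by `high`,
the others above it by minimality. -/
theorem settle (h : Frontier n d S c D H) {x : ℕ} (hx : x < n) (hlt : H x < ⊤)
    (hmin : ∀ z, z < n → H x ≤ H z) :
    x ∉ S ∧ Frontier n d (insert x S) (D x) D (Function.update H x ⊤) := by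
  have hxS : x ∉ S := fun hxS => by simp [h.key x hx, hxS] at hlt
  have hHx : H x = D x := by simp [h.key x hx, hxS]
  refine ⟨hxS, fun z hz => ?_, fun z hz => ?_, fun z hz hzS => ?_, h.le⟩
  · by_cases hzx : z = x
    · subst hzx; simp
    · simp [hzx, h.key z hz]
  · rcases Finset.mem_insert.1 hz with rfl | hz
    · exact le_rfl
    · exact (h.low z hz).trans (h.high x hx hxS)
  · rw [Finset.mem_insert, not_or] at hzS
    have := hmin z hz
    rwa [hHx, h.key z hz, if_neg hzS.2] at this

end Frontier

/-- Computes the initial tentative distance of the vertex `r13` from the source `r12`. -/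
def initialKey : Prog :=
  .seq (.setWReg 0 (.get 1 (.add (.mul (.reg 13) (.reg 0)) (.reg 12)))) <|
  .seq (.setWReg 1 (.get 1 (.add (.mul (.reg 12) (.reg 0)) (.reg 13)))) <|
  .seq (.ite (.wlt (.reg 1) (.reg 0)) (.setWReg 0 (.reg 1)) .skip)
    (.ite (.eq (.reg 13) (.reg 12)) (.setWReg 0 .zero) .skip)

theorem initialKey_spec {B n u v : ℕ} {σ : State} (hn : σ.reg 0 = n) (hu : σ.reg 12 = u)
    (hv : σ.reg 13 = v) :
    Wp B initialKey σ fun t τ => t ≤ 40 ∧ τ.wreg 0 =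
      if v = u then 0 else min (σ.warr 1 (v * n + u)) (σ.warr 1 (u * n + v)) := by
  simp only [initialKey, wp_seq, wp_ite, wp_setWReg, wp_skip, NExp.eval, NExp.size, WExp.eval,
    WExp.size, Test.Holds, Test.size, State.setW_reg, State.setW_wreg, State.setW_warr, hn, hu, hv,
    reduceIte, zero_ne_one]
  refine ⟨fun h => ⟨fun h' => ⟨by omega, by rw [if_pos h']⟩, fun h' => ⟨by omega, ?_⟩⟩,
    fun h => ⟨fun h' => ⟨by omega, by rw [if_pos h']⟩, fun h' => ⟨by omega, ?_⟩⟩⟩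
  · rw [if_neg h', min_eq_right h.le]
  · rw [if_neg h', min_eq_left (not_lt.1 h)]

/-- Initializes row `r12` of the distance matrix and the queue. -/
def dijkstraInit : Prog :=
  .forLt 13 (.reg 0) <|
    .seq initialKey <|
    .seq (.setWArr 1 (.add (.mul (.reg 12) (.reg 0)) (.reg 13)) (.reg 0)) <|
    .seq (.setReg 4 (.reg 13)) heapUpdate

theorem dijkstraInit_spec {B n u : ℕ} {σ : State} (hB : 2 * n < B) (hB' : n * n < B)
    (hn : σ.reg 0 = n) (hu : σ.reg 12 = u) (hun : u < n)
    (hT : IsHeap n (σ.warr 3) fun _ => ⊤) :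
    Wp B dijkstraInit σ fun t τ => t ≤ n * (50 * (Nat.log 2 n + 2) + 80) + 10 ∧
      (∀ v, v < n → τ.warr 1 (u * n + v) =
        if v = u then 0 else min (σ.warr 1 (v * n + u)) (σ.warr 1 (u * n + v))) ∧
      (∀ x v, x < n → v < n → x ≠ u → τ.warr 1 (x * n + v) = σ.warr 1 (x * n + v)) ∧
      IsHeap n (τ.warr 3) (fun v => τ.warr 1 (u * n + v)) := by
  refine (wp_forLt (N := n) (c := 50 * (Nat.log 2 n + 2) + 60)
    (I := fun j τ => (∀ v, v < n → τ.warr 1 (u * n + v) = if v < j then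
        (if v = u then 0 else min (σ.warr 1 (v * n + u)) (σ.warr 1 (u * n + v)))
        else σ.warr 1 (u * n + v)) ∧
      (∀ x v, x < n → v < n → x ≠ u → τ.warr 1 (x * n + v) = σ.warr 1 (x * n + v)) ∧
      IsHeap n (τ.warr 3) (fun v => if v < j then τ.warr 1 (u * n + v) else ⊤))
    (by omega) rfl ⟨by simp, by simp, by simpa using hT⟩ ?_ ?_).mono ?_
  · intro τ hf
    simp [hf.reg 0 rfl, hn]
  · rintro j τ hj hf h13 ⟨hrow, hoth, hH⟩
    have hn1 : τ.reg 0 = n := by rw [hf.reg 0 rfl, hn]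
    have hu1 : τ.reg 12 = u := by rw [hf.reg 12 rfl, hu]
    have hidx := index_lt hun hj
    refine wp_seq.2 ((initialKey_spec hn1 hu1 h13).mono ?_)
    rintro t₀ π hfr₀ ⟨ht₀, hπ0⟩
    -- Both entries are read in time: cell `j` of row `u` has not been overwritten yet, and the
    -- other entry lies in a different row unless `j = u`, where the key is `0` anyway.
    have hcol : (if j = u then 0 else min (τ.warr 1 (j * n + u)) (τ.warr 1 (u * n + j))) =
        if j = u then 0 else min (σ.warr 1 (j * n + u)) (σ.warr 1 (u * n + j)) := by
      split_ifs with hju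
      · rfl
      · rw [hoth j u hj hun hju, hrow j hj, if_neg (lt_irrefl j)]
    rw [hcol] at hπ0
    have hπ : π.reg = τ.reg := funext fun x => hfr₀.reg x rfl
    have hπw : π.warr = τ.warr := funext fun x => hfr₀.warr x rfl
    simp only [wp_seq, wp_setReg, wp_setWArr, NExp.eval, NExp.size, WExp.eval, WExp.size, hπ,
      hn1, hu1, h13, hπ0, State.setWA_reg]
    refine ⟨by omega, by omega, (heapUpdate_spec (n := n) (v := j) hB (by simpa [hπ] using hn1)
      (by simp) hj (by simpa [hπw] using hH)).mono ?_⟩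
    rintro t ρ hfr ⟨ht, hheap⟩
    have hM : ρ.warr 1 = Function.update (τ.warr 1) (u * n + j)
        (if j = u then 0 else min (σ.warr 1 (j * n + u)) (σ.warr 1 (u * n + j))) := by
      rw [hfr.warr 1 rfl]; simp [hπw]
    simp only [State.setR_warr]
    refine ⟨by omega, fun v hv => ?_, fun x v hx hv hxu => ?_, ?_⟩
    · rw [hM]
      by_cases hvj : v = j
      · subst hvj; simp
      · rw [Function.update_of_ne (by omega), hrow v hv]
        simp only [show v < j + 1 ↔ v < j by omega]
    · rw [hM, Function.update_of_ne (fun he => hxu (index_inj hv hj he).1)]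
      exact hoth x v hx hv hxu
    · convert hheap using 1
      funext v
      by_cases hvj : v = j
      · subst hvj
        simp [hM, hπ0]
      · rw [Function.update_of_ne hvj, hM, Function.update_of_ne (by omega)]
        simp only [show v < j + 1 ↔ v < j by omega]
  · rintro t τ - ⟨ht, ⟨hrow, hoth, hH⟩, -⟩
    simp only [NExp.size] at ht
    refine ⟨by nlinarith, fun v hv => by rw [hrow v hv, if_pos hv], hoth, hH.node, fun x hx => ?_⟩
    rw [hH.leaf x hx, if_pos hx]

/-- Relaxes the arcs with tail `r14`, whose distance is in the weight register `1`. -/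
def relaxArcs : Prog :=
  .forLt 13 (.get 5 (.reg 14)) <|
    .seq (.setReg 4 (.get 6 (.add (.mul (.reg 14) (.mul (.reg 0) (.reg 0))) (.reg 13)))) <|
    .seq (.setWReg 0 (.add (.reg 1) (.get 2 (.add (.mul (.reg 14) (.reg 0)) (.reg 4))))) <|
    .ite (.wlt (.reg 0) (.get 1 (.add (.mul (.reg 12) (.reg 0)) (.reg 4))))
      (.seq (.setWArr 1 (.add (.mul (.reg 12) (.reg 0)) (.reg 4)) (.reg 0)) heapUpdate) .skip

/-- The tail `x` is settled and its value is the separator `c`. Weights are non-negative, so all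
candidates are at least `c` and `Frontier.relax` applies; settled values, including that of `x`,
stay fixed throughout. -/
theorem relaxArcs_spec {B n u x : ℕ} {σ : State} {d H : ℕ → ℝ≥0∞} {S : Finset ℕ}
    (hB : 2 * n < B) (hB' : n * n < B) (hn : σ.reg 0 = n) (hu : σ.reg 12 = u) (hx : σ.reg 14 = x)
    (hun : u < n) (hxn : x < n) (hcnt : σ.arr 5 x < B)
    (hout : ∀ q, q < σ.arr 5 x → σ.arr 6 (x * (n * n) + q) < n)
    (hd : ∀ y, y < n → d y ≤ d x + σ.warr 2 (x * n + y)) (hxS : x ∈ S)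
    (hw : σ.wreg 1 = σ.warr 1 (u * n + x)) (hH : IsHeap n (σ.warr 3) H)
    (hF : Frontier n d S (σ.warr 1 (u * n + x)) (fun v => σ.warr 1 (u * n + v)) H) :
    Wp B relaxArcs σ fun t τ =>
      t ≤ σ.arr 5 x * (50 * (Nat.log 2 n + 2) + 80) + 10 ∧
      (∀ y v, y < n → v < n → y ≠ u → τ.warr 1 (y * n + v) = σ.warr 1 (y * n + v)) ∧
      (∀ v, v < n → τ.warr 1 (u * n + v) ≤ σ.warr 1 (u * n + v)) ∧
      (∀ v, v ∈ S → τ.warr 1 (u * n + v) = σ.warr 1 (u * n + v)) ∧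
      (∀ q, q < σ.arr 5 x → τ.warr 1 (u * n + σ.arr 6 (x * (n * n) + q)) ≤
        τ.warr 1 (u * n + x) + σ.warr 2 (x * n + σ.arr 6 (x * (n * n) + q))) ∧
      ∃ H', IsHeap n (τ.warr 3) H' ∧
        Frontier n d S (σ.warr 1 (u * n + x)) (fun v => τ.warr 1 (u * n + v)) H' := by
  refine (wp_forLt (N := σ.arr 5 x) (c := 50 * (Nat.log 2 n + 2) + 60)
    (I := fun j τ =>
      (∀ y v, y < n → v < n → y ≠ u → τ.warr 1 (y * n + v) = σ.warr 1 (y * n + v)) ∧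
      (∀ v, v < n → τ.warr 1 (u * n + v) ≤ σ.warr 1 (u * n + v)) ∧
      (∀ v, v ∈ S → τ.warr 1 (u * n + v) = σ.warr 1 (u * n + v)) ∧
      (∀ q, q < j → τ.warr 1 (u * n + σ.arr 6 (x * (n * n) + q)) ≤
        τ.warr 1 (u * n + x) + σ.warr 2 (x * n + σ.arr 6 (x * (n * n) + q))) ∧
      ∃ H', IsHeap n (τ.warr 3) H' ∧
        Frontier n d S (σ.warr 1 (u * n + x)) (fun v => τ.warr 1 (u * n + v)) H')
    hcnt rfl ⟨by simp, by simp, by simp, by omega, H, hH, by simpa using hF⟩ ?_ ?_).mono ?_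
  · intro τ hf
    simp [hf.reg 14 rfl, hx, hf.arr 5 rfl]
  · rintro j τ hj hf h13 ⟨hoth, hle, hSeq, harc, H', hH', hF'⟩
    have hn1 : τ.reg 0 = n := by rw [hf.reg 0 rfl, hn]
    have hu1 : τ.reg 12 = u := by rw [hf.reg 12 rfl, hu]
    have hx1 : τ.reg 14 = x := by rw [hf.reg 14 rfl, hx]
    have hw1 : τ.wreg 1 = σ.warr 1 (u * n + x) := by rw [hf.wreg 1 rfl, hw]
    have hA : τ.warr 2 = σ.warr 2 := hf.warr 2 rfl
    have ho : τ.arr 6 = σ.arr 6 := hf.arr 6 rfl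
    have hy := hout j hj
    generalize hydef : σ.arr 6 (x * (n * n) + j) = y at hy
    have hidx := index_lt hun hy
    have hdx : d x ≤ σ.warr 1 (u * n + x) := by rw [← hSeq x hxS]; exact hF'.le x hxn
    simp only [wp_seq, wp_ite, wp_skip, wp_setReg, wp_setWReg, wp_setWArr, NExp.eval, NExp.size,
      WExp.eval, WExp.size, Test.Holds, Test.size, State.setR_reg, State.setR_wreg, State.setR_warr,
      State.setW_reg, State.setW_wreg, State.setW_warr, reduceIte, Nat.reduceEqDiff,
      OfNat.zero_ne_ofNat, hn1, hu1, hx1, hw1, hA, ho, h13, hydef]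
    refine ⟨by omega, fun hlt => ⟨by omega, ?_⟩, fun hlt => ⟨by omega, hoth, hle, hSeq, ?_, H', hH',
      hF'⟩⟩
    · obtain ⟨hyS, hF''⟩ := hF'.relax le_self_add
        ((hd y hy).trans (add_le_add_left hdx _)) hlt
      refine (heapUpdate_spec (n := n) (v := y) (H := H') hB (by simpa using hn1) (by simp) hy
        (by simpa using hH')).mono ?_
      rintro t ρ hfr ⟨ht, hheap⟩
      have hM : ρ.warr 1 = Function.update (τ.warr 1) (u * n + y)
          (σ.warr 1 (u * n + x) + σ.warr 2 (x * n + y)) := by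
        rw [hfr.warr 1 rfl]; simp
      have hMv : ∀ v, v ≠ y → ρ.warr 1 (u * n + v) = τ.warr 1 (u * n + v) := by
        intro v hvy
        rw [hM, Function.update_of_ne (by omega)]
      have hMy : ρ.warr 1 (u * n + y) = σ.warr 1 (u * n + x) + σ.warr 2 (x * n + y) := by
        rw [hM, Function.update_self]
      have hMle : ∀ v, ρ.warr 1 (u * n + v) ≤ τ.warr 1 (u * n + v) := by
        intro v
        by_cases hvy : v = y
        · subst hvy; rw [hMy]; exact hlt.le
        · rw [hMv v hvy]
      have hMS : ∀ v, v ∈ S → ρ.warr 1 (u * n + v) = τ.warr 1 (u * n + v) :=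
        fun v hv => hMv v (by rintro rfl; exact hyS hv)
      refine ⟨by omega, fun z v hz hv hzu => ?_, fun v hv => (hMle v).trans (hle v hv),
        fun v hv => (hMS v hv).trans (hSeq v hv), fun q hq => ?_, _, hheap, ?_⟩
      · rw [hM, Function.update_of_ne (fun he => hzu (index_inj hv hy he).1)]
        exact hoth z v hz hv hzu
      · rw [hMS x hxS]
        rcases Nat.lt_succ_iff_lt_or_eq.1 hq with hq | rfl
        · exact (hMle _).trans (harc q hq)
        · rw [hydef, hMy, hSeq x hxS]
      · convert hF'' using 1
        · funext v
          by_cases hvy : v = y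
          · subst hvy; rw [hMy]; simp
          · rw [hMv v hvy, Function.update_of_ne hvy]
        · simp
    · intro q hq
      rcases Nat.lt_succ_iff_lt_or_eq.1 hq with hq | rfl
      · exact harc q hq
      · rw [hydef, hSeq x hxS]; exact not_lt.1 hlt
  · rintro t τ - ⟨ht, hI, -⟩
    simp only [NExp.size] at ht
    refine ⟨?_, hI⟩
    have := Nat.mul_le_mul_left (σ.arr 5 x)
      (show 50 * (Nat.log 2 n + 2) + 60 + (1 + 1) + 7 ≤ 50 * (Nat.log 2 n + 2) + 80 by omega)
    omega

/-- Dijkstra's algorithm from the vertex `r12` on the arcs of the level. The queue starts with the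
distances that are known so far. -/
def dijkstra : Prog :=
  .seq dijkstraInit <|
  .loop (.wlt (.get 3 (.const 1)) .infty) <|
    .seq heapExtract <|
    .seq (.setReg 14 (.reg 4)) <|
    .seq (.setWReg 1 (.get 1 (.add (.mul (.reg 12) (.reg 0)) (.reg 14)))) relaxArcs

/-- The result is not identified with a distance. The stretch argument only needs a zero at the
source, the lower bound `d`, the comparison with the old row and column of `u`, and stability under
all arcs. -/
theorem dijkstra_spec {B n u : ℕ} {σ : State} {d : ℕ → ℝ≥0∞}
    (hB : n * n + 2 * n < B) (hn : σ.reg 0 = n) (hu : σ.reg 12 = u)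
    (hun : u < n) (hcnt : ∀ x, x < n → σ.arr 5 x < B)
    (hout : ∀ x q, x < n → q < σ.arr 5 x → σ.arr 6 (x * (n * n) + q) < n)
    (hd : ∀ x y, x < n → y < n → d y ≤ d x + σ.warr 2 (x * n + y)) (hdu : d u = 0)
    (hdM : ∀ v, v < n → d v ≤ σ.warr 1 (v * n + u) ∧ d v ≤ σ.warr 1 (u * n + v))
    (hT : IsHeap n (σ.warr 3) fun _ => ⊤) :
    Wp B dijkstra σ fun t τ =>
      t ≤ 500 * ((n + ∑ x ∈ Finset.range n, σ.arr 5 x) * (Nat.log 2 n + 2)) ∧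
      IsHeap n (τ.warr 3) (fun _ => ⊤) ∧
      (∀ x v, x < n → v < n → x ≠ u → τ.warr 1 (x * n + v) = σ.warr 1 (x * n + v)) ∧
      τ.warr 1 (u * n + u) = 0 ∧
      (∀ v, v < n → d v ≤ τ.warr 1 (u * n + v) ∧ τ.warr 1 (u * n + v) ≤ σ.warr 1 (v * n + u) ∧
        τ.warr 1 (u * n + v) ≤ σ.warr 1 (u * n + v)) ∧
      ∀ x q, x < n → q < σ.arr 5 x → τ.warr 1 (u * n + σ.arr 6 (x * (n * n) + q)) ≤
        τ.warr 1 (u * n + x) + σ.warr 2 (x * n + σ.arr 6 (x * (n * n) + q)) := by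
  have hn0 : 0 < n := by omega
  set L := Nat.log 2 n + 2 with hL
  have hL2 : 2 ≤ L := by omega
  set K := 50 * L + 80 with hK
  set K' := 100 * L + 60 with hK'
  refine wp_seq.2 ((dijkstraInit_spec (by omega) (by omega) hn hu hun hT).mono ?_)
  rintro t σ₁ hf₁ ⟨ht, hrow, hoth, hheap⟩
  rw [← hL, ← hK] at ht
  have hn1 : σ₁.reg 0 = n := by rw [hf₁.reg 0 rfl, hn]
  have hu1 : σ₁.reg 12 = u := by rw [hf₁.reg 12 rfl, hu]
  have ha1 : σ₁.arr = σ.arr := funext fun a => hf₁.arr a rfl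
  have hA1 : σ₁.warr 2 = σ.warr 2 := hf₁.warr 2 rfl
  -- Each unsettled vertex holds the budget for its own extraction and the relaxation of its arcs;
  -- settled vertices never return to the queue.
  refine (wp_loop (φ := ∑ x ∈ Finset.range n \ ∅, (σ.arr 5 x * K + K'))
    (I := fun φ τ => ∃ (S : Finset ℕ) (c : ℝ≥0∞) (H : ℕ → ℝ≥0∞), IsHeap n (τ.warr 3) H ∧
      S ⊆ Finset.range n ∧ Frontier n d S c (fun v => τ.warr 1 (u * n + v)) H ∧
      (∀ x v, x < n → v < n → x ≠ u → τ.warr 1 (x * n + v) = σ.warr 1 (x * n + v)) ∧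
      (∀ v, v < n → τ.warr 1 (u * n + v) ≤ σ₁.warr 1 (u * n + v)) ∧
      (∀ x q, x ∈ S → q < σ.arr 5 x → τ.warr 1 (u * n + σ.arr 6 (x * (n * n) + q)) ≤
        τ.warr 1 (u * n + x) + σ.warr 2 (x * n + σ.arr 6 (x * (n * n) + q))) ∧
      φ = ∑ x ∈ Finset.range n \ S, (σ.arr 5 x * K + K'))
    ⟨∅, 0, _, hheap, by simp, ⟨by simp, by simp, by simp, fun v hv => ?_⟩, hoth, fun v _ => le_rfl,
      by simp, rfl⟩ ?_).mono ?_
  · rw [hrow v hv]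
    split_ifs with hvu
    · rw [hvu, hdu]
    · exact le_min (hdM v hv).1 (hdM v hv).2
  · rintro φ τ hf ⟨S, c, H, hH, hSn, hF, hoth, hle, harc, rfl⟩ hb
    simp only [Test.Holds, WExp.eval, NExp.eval] at hb
    have hn2 : τ.reg 0 = n := by rw [hf.reg 0 rfl, hn1]
    refine wp_seq.2 ((heapExtract_spec (by omega) hn0 hn2 hH).mono ?_)
    rintro s ρ hf' ⟨hs, x, hx, h4, hxk, hheap'⟩
    have hn3 : ρ.reg 0 = n := by rw [hf'.reg 0 rfl, hn2]
    have hu3 : ρ.reg 12 = u := by rw [hf'.reg 12 rfl, hf.reg 12 rfl, hu1]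
    have ha3 : ρ.arr = σ.arr := by
      rw [← ha1]; exact funext fun a => (hf'.arr a rfl).trans (hf.arr a rfl)
    have hA3 : ρ.warr 2 = σ.warr 2 := by rw [hf'.warr 2 rfl, hf.warr 2 rfl, hA1]
    have hM3 : ρ.warr 1 = τ.warr 1 := hf'.warr 1 rfl
    rw [← hxk] at hb
    obtain ⟨hxS, hF'⟩ := hF.settle hx hb fun z hz => by rw [hxk]; exact hH.root_le hz
    simp only [wp_seq, wp_setReg, wp_setWReg, NExp.eval, NExp.size, WExp.eval, WExp.size,
      State.setR_reg, State.setR_warr, reduceIte, Nat.reduceEqDiff, OfNat.zero_ne_ofNat,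
      h4, hn3, hu3, hM3]
    refine ⟨by omega, (relaxArcs_spec (n := n) (u := u) (x := x) (d := d) (S := insert x S)
      (H := Function.update H x ⊤) (by omega) (by omega) (by simpa using hn3) (by simpa using hu3)
      (by simp) hun hx (by simpa [ha3] using hcnt x hx) (by simpa [ha3] using fun q => hout x q hx)
      (by simpa [hA3] using fun y => hd x y hx) (Finset.mem_insert_self _ _) (by simp [hM3])
      (by simpa using hheap') (by simpa [hM3] using hF')).mono ?_⟩
    simp only [State.setW_arr, State.setR_arr, State.setW_warr, State.setR_warr, ha3, hA3, hM3]
    rintro s' π - ⟨hs', hoth', hle', hSeq, harc', H', hH', hF''⟩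
    have hsdiff : Finset.range n \ S = insert x (Finset.range n \ insert x S) := by
      ext z
      by_cases hzx : z = x
      · subst hzx; simp [hx, hxS]
      · simp [hzx]
    refine ⟨_, ⟨insert x S, _, H', hH', Finset.insert_subset (Finset.mem_range.2 hx) hSn, hF'',
      fun z v hz hv hzu => (hoth' z v hz hv hzu).trans (hoth z v hz hv hzu),
      fun v hv => (hle' v hv).trans (hle v hv), fun z q hz hq => ?_, rfl⟩, ?_⟩
    · rcases Finset.mem_insert.1 hz with rfl | hzS
      · exact harc' q hq
      · rw [hSeq z hz]
        exact (hle' _ (hout z q (Finset.mem_range.1 (hSn hzS)) hq)).trans (harc z q hzS hq)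
    · rw [← hL] at hs
      rw [← hL, ← hK] at hs'
      rw [hsdiff, Finset.sum_insert (by simp)]
      simp only [Test.size, WExp.size, NExp.size]
      omega
  · rintro s τ - ⟨hs, ⟨φ, S, c, H, hH, hSn, hF, hoth, hle, harc, rfl⟩, hb⟩
    simp only [Test.Holds, WExp.eval, NExp.eval, Test.size, WExp.size, NExp.size, not_lt,
      top_le_iff] at hb hs
    have htop : ∀ x, x < n → H x = ⊤ := fun x hx => by
      have := hH.root_le hx
      rwa [hb, top_le_iff] at this
    refine ⟨?_, ⟨hH.node, fun x hx => by rw [hH.leaf x hx, htop x hx]⟩, hoth, ?_,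
      fun v hv => ⟨hF.le v hv, ?_, ?_⟩, fun x q hx hq => ?_⟩
    · have h1 : ∑ x ∈ Finset.range n \ ∅, (σ.arr 5 x * K + K') =
          (∑ x ∈ Finset.range n, σ.arr 5 x) * K + n * K' := by
        rw [Finset.sdiff_empty, Finset.sum_add_distrib, Finset.sum_mul]
        simp
      rw [h1] at hs
      generalize ∑ x ∈ Finset.range n, σ.arr 5 x = E at hs ⊢
      have h2 : E * K ≤ E * (90 * L) := Nat.mul_le_mul_left _ (by omega)
      have h3 : n * K' ≤ n * (130 * L) := Nat.mul_le_mul_left _ (by omega)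
      have h4 : n * K ≤ n * (90 * L) := Nat.mul_le_mul_left _ (by omega)
      have h5 : L ≤ n * L := Nat.le_mul_of_pos_left _ hn0
      have h6 : (n + E) * L = n * L + E * L := by ring
      have h7 : E * (90 * L) = 90 * (E * L) := by ring
      have h8 : n * (130 * L) = 130 * (n * L) := by ring
      have h9 : n * (90 * L) = 90 * (n * L) := by ring
      omega
    · have := hle u hun
      rw [hrow u hun, if_pos rfl] at this
      exact le_antisymm this zero_le
    · refine (hle v hv).trans ?_
      rw [hrow v hv]
      split_ifs
      · exact zero_le
      · exact min_le_left _ _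
    · refine (hle v hv).trans ?_
      rw [hrow v hv]
      split_ifs
      · exact zero_le
      · exact min_le_right _ _
    -- A vertex that was never settled has the estimate `∞`, so its arcs are stable trivially.
    · by_cases hxS : x ∈ S
      · exact harc x q hxS hq
      · have := hF.key x hx
        rw [htop x hx, if_neg hxS] at this
        simp [← this]

/-! ### The potential of the greedy hitting set -/

/-- Each of the `h` additional terms is at least `1 / U`. -/
theorem harmonic_add_div_le {U : ℕ} (V h : ℕ) (hle : V + h ≤ U) :
    harmonic V + (h : ℚ) / U ≤ harmonic (V + h) := by
  induction h with
  | zero => simp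
  | succ h ih =>
    have h1 := ih (by omega)
    rw [← add_assoc, harmonic_succ]
    have h2 : (1 : ℚ) / U ≤ ((V + h + 1 : ℕ) : ℚ)⁻¹ := by
      rw [one_div]
      exact inv_anti₀ (by positivity) (by exact_mod_cast hle)
    push_cast at h2 ⊢
    rw [add_div]
    linarith

theorem harmonic_mono {V U : ℕ} (h : V ≤ U) : harmonic V ≤ harmonic U := by
  obtain ⟨d, rfl⟩ := Nat.exists_eq_add_of_le h
  exact (le_add_of_nonneg_right (by positivity)).trans (harmonic_add_div_le V d le_rfl)

/-- A bound for the number of greedy steps that hit `U` sets of size `s` over `n` points. -/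
def greedyBound (n s U : ℕ) : ℕ := ⌊(n : ℚ) * harmonic U / s⌋₊

/-- A step that hits at least the fraction `s / n` of the `U` open rows lowers `harmonic` by at
least `s / n`. After scaling by `n / s` the potential drops by at least `1`, and so does its integer
part. -/
theorem greedyBound_lt {n s U V : ℕ} (hs : 0 < s) (hVU : V ≤ U) (hU : 0 < U)
    (h : U * s ≤ (U - V) * n) : greedyBound n s V + 1 ≤ greedyBound n s U := by
  obtain ⟨d, rfl⟩ := Nat.exists_eq_add_of_le hVU
  rw [Nat.add_sub_cancel_left] at h
  have h1 := harmonic_add_div_le V d le_rfl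
  have h0 : 0 ≤ harmonic V := by simpa using harmonic_mono (Nat.zero_le V)
  have hs' : (0 : ℚ) < s := by exact_mod_cast hs
  have hU' : (0 : ℚ) < (V + d : ℕ) := by exact_mod_cast hU
  have h2 : (1 : ℚ) ≤ (n : ℚ) * ((d : ℚ) / (V + d : ℕ)) / s := by
    rw [le_div_iff₀ hs', one_mul, ← mul_div_assoc, le_div_iff₀ hU']
    rw [mul_comm (s : ℚ), mul_comm (n : ℚ)]
    exact_mod_cast h
  unfold greedyBound
  rw [← Nat.floor_add_one (by positivity)]
  refine Nat.floor_mono ?_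
  calc (n : ℚ) * harmonic V / s + 1 ≤
      (n : ℚ) * harmonic V / s + (n : ℚ) * ((d : ℚ) / (V + d : ℕ)) / s := by gcongr
    _ = (n : ℚ) * (harmonic V + (d : ℚ) / (V + d : ℕ)) / s := by ring
    _ ≤ _ := by gcongr

theorem greedyBound_mono {n s U V : ℕ} (h : V ≤ U) : greedyBound n s V ≤ greedyBound n s U := by
  unfold greedyBound
  have := harmonic_mono h
  gcongr

/-- From `harmonic n ≤ 1 + ln n` and `ln n ≤ Nat.log 2 n + 1`. -/
theorem greedyBound_mul_le {n s : ℕ} (hn : 0 < n) (hs : 0 < s) :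
    greedyBound n s n * s ≤ n * (Nat.log 2 n + 2) := by
  have hs' : (0 : ℚ) < s := by exact_mod_cast hs
  have h0 : 0 ≤ harmonic n := by simpa using harmonic_mono (Nat.zero_le n)
  have hlog : harmonic n ≤ (Nat.log 2 n + 2 : ℕ) := by
    have h1 := harmonic_le_one_add_log n
    have h2 : Real.log n ≤ Nat.log 2 n + 1 := by
      have h3 : (n : ℝ) ≤ (2 : ℝ) ^ (Nat.log 2 n + 1) := by
        exact_mod_cast (Nat.lt_pow_succ_log_self (by omega) n).le
      have h4 := Real.log_le_log (by exact_mod_cast hn) h3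
      rw [Real.log_pow] at h4
      have h5 : Real.log 2 ≤ 1 := by
        have := Real.log_le_sub_one_of_pos (show (0 : ℝ) < 2 by norm_num)
        linarith
      have h6 : (0 : ℝ) ≤ ((Nat.log 2 n + 1 : ℕ) : ℝ) := by positivity
      push_cast at h4 h6
      nlinarith
    have : ((harmonic n : ℚ) : ℝ) ≤ ((Nat.log 2 n + 2 : ℕ) : ℚ) := by
      push_cast
      linarith
    exact_mod_cast this
  have h1 : ((greedyBound n s n : ℕ) : ℚ) ≤ (n : ℚ) * harmonic n / s :=
    Nat.floor_le (by positivity)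
  rw [le_div_iff₀ hs'] at h1
  have h2 : ((greedyBound n s n * s : ℕ) : ℚ) ≤ ((n * (Nat.log 2 n + 2) : ℕ) : ℚ) := by
    push_cast at hlog ⊢
    refine h1.trans ?_
    gcongr
  exact_mod_cast h2

/-! ### Hitting the neighbourhoods -/

/-- Marks the vertices with fewer than `r9` entries in their rows as hit. -/
def initHit : Prog :=
  .forLt 5 (.reg 0) <|
    .ite (.lt (.get 3 (.reg 5)) (.reg 9)) (.setArr 8 (.reg 5) (.const 1))
      (.setArr 8 (.reg 5) (.const 0))

theorem initHit_spec {B n s : ℕ} {σ : State} (hB : n + 1 < B) (hn : σ.reg 0 = n)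
    (hs : σ.reg 9 = s) :
    Wp B initHit σ fun t τ => t ≤ 30 * n + 10 ∧
      ∀ y, y < n → (τ.arr 8 y = 0 ↔ s ≤ σ.arr 3 y) := by
  refine (wp_forLt (N := n) (c := 15)
    (I := fun i τ => ∀ y, y < i → (τ.arr 8 y = 0 ↔ s ≤ σ.arr 3 y))
    (by omega) rfl (by simp) ?_ ?_).mono ?_
  · intro τ hf
    simp [hf.reg 0 rfl, hn]
  · intro i τ hi hf h5 hI
    have hs1 : τ.reg 9 = s := by rw [hf.reg 9 rfl, hs]
    have ha : τ.arr 3 = σ.arr 3 := hf.arr 3 rfl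
    simp only [wp_ite, wp_setArr, NExp.eval, NExp.size, Test.Holds, Test.size, State.setR_arr,
      State.setA_arr, reduceIte, h5, hs1, ha]
    refine ⟨fun h => ⟨by omega, by omega, by omega, fun y hy => ?_⟩,
      fun h => ⟨by omega, by omega, by omega, fun y hy => ?_⟩⟩
    all_goals
      by_cases hyi : y = i
      · subst hyi; simp; omega
      · simpa [hyi] using hI y (by omega)
  · rintro t τ - ⟨ht, hI, -⟩
    simp only [NExp.size] at ht
    exact ⟨by omega, hI⟩

/-- Counts in array `7` how often each vertex occurs among the first `r9` entries of the rows that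
are not hit; the sum of the counters is stored in register `11`. -/
def countHits : Prog :=
  .seq (.forLt 5 (.reg 0) (.setArr 7 (.reg 5) (.const 0))) <|
  .seq (.setReg 11 (.const 0)) <|
  .forLt 5 (.reg 0) <|
    .ite (.eq (.get 8 (.reg 5)) (.const 0))
      (.forLt 6 (.reg 9) <|
        .seq (.setReg 7 (.get 2 (.add (.mul (.reg 5) (.reg 0)) (.reg 6)))) <|
        .seq (.setArr 7 (.reg 7) (.add (.get 7 (.reg 7)) (.const 1)))
          (.setReg 11 (.add (.reg 11) (.const 1)))) .skip

/-- The rows `y < i` that are not hit. -/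
def unhit (hit : ℕ → ℕ) (i : ℕ) : Finset ℕ := (Finset.range i).filter fun y => hit y = 0

/-- The rows `y < i` that are not hit, and have `c` among their first `s` entries. -/
def newlyHit (n s : ℕ) (nbr hit : ℕ → ℕ) (c i : ℕ) : Finset ℕ :=
  (unhit hit i).filter fun y => ∃ j < s, nbr (y * n + j) = c

theorem unhit_succ_card {hit : ℕ → ℕ} (i : ℕ) :
    (unhit hit (i + 1)).card = (unhit hit i).card + if hit i = 0 then 1 else 0 := by
  unfold unhit
  rw [Finset.range_add_one, Finset.filter_insert]
  split_ifs with h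
  · rw [Finset.card_insert_of_notMem (by simp)]
  · rfl

theorem newlyHit_succ_card {n s : ℕ} {nbr hit : ℕ → ℕ} (c i : ℕ) :
    (newlyHit n s nbr hit c (i + 1)).card = (newlyHit n s nbr hit c i).card +
      if hit i = 0 ∧ ∃ j < s, nbr (i * n + j) = c then 1 else 0 := by
  unfold newlyHit unhit
  rw [Finset.filter_filter, Finset.filter_filter, Finset.range_add_one, Finset.filter_insert]
  split_ifs with h
  · rw [Finset.card_insert_of_notMem (by simp)]
  · rfl

/-- Each open row adds exactly `s` to the total. Its entries are distinct, so it adds at most one to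
any counter; a large counter therefore certifies that many rows are hit. -/
theorem countHits_spec {B n s : ℕ} {σ : State} (hB : n * n + n + 1 < B) (hn0 : 0 < n)
    (hs0 : 0 < s) (hsn : s ≤ n) (hn : σ.reg 0 = n) (hs : σ.reg 9 = s)
    (hnbr : ∀ y j, y < n → σ.arr 8 y = 0 → j < s → σ.arr 2 (y * n + j) < n)
    (hinj : ∀ y i j, y < n → σ.arr 8 y = 0 → i < s → j < s →
      σ.arr 2 (y * n + i) = σ.arr 2 (y * n + j) → i = j) :
    Wp B countHits σ fun t τ => t ≤ 120 * (n * s) ∧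
      τ.reg 11 = (unhit (σ.arr 8) n).card * s ∧
      ∑ x ∈ Finset.range n, τ.arr 7 x = τ.reg 11 ∧
      ∀ x, x < n → τ.arr 7 x ≤ (newlyHit n s (σ.arr 2) (σ.arr 8) x n).card := by
  refine wp_seq.2 ((wp_forLt (N := n) (c := 3) (I := fun i τ => ∀ x, x < i → τ.arr 7 x = 0)
    (by omega) rfl (by simp) ?_ ?_).mono ?_)
  · intro τ hf
    simp [hf.reg 0 rfl, hn]
  · intro i τ hi hf h5 hI
    simp only [wp_setArr, NExp.eval, NExp.size, h5]
    refine ⟨by omega, by omega, le_rfl, fun x hx => ?_⟩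
    simp only [State.setR_arr, State.setA_arr, reduceIte, Function.update_apply]
    split_ifs with h
    · rfl
    · exact hI x (by omega)
  rintro t τ hf ⟨ht, hz, -⟩
  have hn1 : τ.reg 0 = n := by rw [hf.reg 0 rfl, hn]
  have hs1 : τ.reg 9 = s := by rw [hf.reg 9 rfl, hs]
  have ha2 : τ.arr 2 = σ.arr 2 := hf.arr 2 rfl
  have ha8 : τ.arr 8 = σ.arr 8 := hf.arr 8 rfl
  simp only [wp_seq, wp_setReg, NExp.eval, NExp.size]
  refine ⟨by omega, (wp_forLt (N := n) (c := s * 40 + 30)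
    (I := fun i τ => τ.reg 11 = (unhit (σ.arr 8) i).card * s ∧
      ∑ x ∈ Finset.range n, τ.arr 7 x = τ.reg 11 ∧
      ∀ x, x < n → τ.arr 7 x ≤ (newlyHit n s (σ.arr 2) (σ.arr 8) x i).card)
    (by omega) rfl ?_ ?_ ?_).mono ?_⟩
  · simpa [unhit, newlyHit] using hz
  · intro τ' hf
    simp [hf.reg 0 rfl, hn1]
  · rintro i ρ hi hf h5 ⟨h11, hsum, hnum⟩
    have hn2 : ρ.reg 0 = n := by rw [hf.reg 0 rfl]; simpa using hn1
    have hs2 : ρ.reg 9 = s := by rw [hf.reg 9 rfl]; simpa using hs1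
    have hb2 : ρ.arr 2 = σ.arr 2 := by rw [hf.arr 2 rfl]; simpa using ha2
    have hb8 : ρ.arr 8 = σ.arr 8 := by rw [hf.arr 8 rfl]; simpa using ha8
    simp only [wp_ite, wp_skip, NExp.eval, NExp.size, Test.Holds, Test.size, h5, hb8]
    refine ⟨fun h => ?_, fun h => ⟨by omega, ?_⟩⟩
    · refine (wp_forLt (N := s) (c := 20)
        (I := fun i' τ => τ.reg 11 = (unhit (σ.arr 8) i).card * s + i' ∧
          ∑ x ∈ Finset.range n, τ.arr 7 x = τ.reg 11 ∧
          ∀ x, x < n → τ.arr 7 x ≤ (newlyHit n s (σ.arr 2) (σ.arr 8) x i).card +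
            if ∃ j < i', σ.arr 2 (i * n + j) = x then 1 else 0)
        (by omega) rfl (by simpa using ⟨h11, hsum, hnum⟩) ?_ ?_).mono ?_
      · intro τ' hf
        simp [hf.reg 9 rfl, hs2]
      · rintro i' π hi' hf' h6 ⟨h11', hsum', hnum'⟩
        have hn3 : π.reg 0 = n := by rw [hf'.reg 0 rfl, hn2]
        have h53 : π.reg 5 = i := by rw [hf'.reg 5 rfl, h5]
        have hb23 : π.arr 2 = σ.arr 2 := by rw [hf'.arr 2 rfl, hb2]
        have hx := hnbr i i' hi h hi'
        generalize hxdef : σ.arr 2 (i * n + i') = x at hx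
        have hux : (unhit (σ.arr 8) i).card ≤ i :=
          (Finset.card_filter_le _ _).trans (Finset.card_range i).le
        have hr11 : π.reg 11 < n * n := by
          have h1 := index_lt hi (hi'.trans_le hsn)
          have h2 := Nat.mul_le_mul hux hsn
          omega
        have hle : π.arr 7 x ≤ π.reg 11 := by
          rw [← hsum']
          exact Finset.single_le_sum (f := π.arr 7) (fun _ _ => Nat.zero_le _)
            (Finset.mem_range.2 hx)
        simp only [wp_seq, wp_setReg, wp_setArr, NExp.eval, NExp.size, State.setR_reg,
          State.setR_arr, State.setA_arr, State.setA_reg, reduceIte, Nat.reduceEqDiff,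
          hn3, h53, h6, hb23, hxdef]
        refine ⟨by omega, by omega, by omega, by omega, by omega, by omega, ?_, fun z hz => ?_⟩
        · rw [sum_update_succ _ hx, hsum']
        · rw [Function.update_apply]
          by_cases hzx : z = x
          · subst hzx
            have hno : ¬ ∃ j < i', σ.arr 2 (i * n + j) = z := by
              rintro ⟨j, hj, he⟩
              have := hinj i j i' hi h (by omega) hi' (he.trans hxdef.symm)
              omega
            have := hnum' z hz
            rw [if_neg hno] at this
            rw [if_pos rfl, if_pos ⟨i', by omega, hxdef⟩]
            omega
          · rw [if_neg hzx]
            refine (hnum' z hz).trans (Nat.add_le_add_left ?_ _)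
            split_ifs with h1 h2 h2
            · exact le_rfl
            · obtain ⟨j, hj, he⟩ := h1
              exact absurd ⟨j, by omega, he⟩ h2
            · exact Nat.zero_le _
            · exact le_rfl
      · rintro t₂ π - ⟨ht₂, ⟨h11', hsum', hnum'⟩, -⟩
        simp only [NExp.size] at ht₂
        simp only [State.setR_reg, State.setR_arr, Nat.reduceEqDiff, reduceIte]
        refine ⟨by omega, ?_, hsum', fun x hx => ?_⟩
        · rw [h11', unhit_succ_card, if_pos h]; ring
        · rw [newlyHit_succ_card]
          simpa only [h, true_and] using hnum' x hx
    · simp only [State.setR_reg, State.setR_arr, Nat.reduceEqDiff, reduceIte]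
      refine ⟨?_, hsum, fun x hx => ?_⟩
      · rw [h11, unhit_succ_card, if_neg h]; ring
      · rw [newlyHit_succ_card]
        exact (hnum x hx).trans (Nat.le_add_right _ _)
  · rintro t₁ ρ - ⟨ht₁, hI, -⟩
    simp only [NExp.size] at ht ht₁
    refine ⟨?_, hI⟩
    have h1 : n * (s * 40 + 30 + 1 + 7) = 40 * (n * s) + 38 * n := by ring
    have h2 : n ≤ n * s := Nat.le_mul_of_pos_right _ hs0
    omega

/-- Stores in register `12` a vertex whose counter is at least the average. -/
def pickCenter : Prog :=
  .seq (.setReg 12 (.const 0)) <|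
  .loop (.lt (.mul (.get 7 (.reg 12)) (.reg 0)) (.reg 11)) <|
    .setReg 12 (.add (.reg 12) (.const 1))

/-- By averaging, some `c₀` passes the test, and the scan stops there at the latest. -/
theorem pickCenter_spec {B n T : ℕ} {σ : State} (hB : n < B) (hn0 : 0 < n) (hn : σ.reg 0 = n)
    (hT : σ.reg 11 = T) (hsum : ∑ x ∈ Finset.range n, σ.arr 7 x = T) :
    Wp B pickCenter σ fun t τ => t ≤ 30 * n ∧ τ.reg 12 < n ∧ T ≤ σ.arr 7 (τ.reg 12) * n := by
  obtain ⟨c₀, hc₀, hle⟩ : ∃ c ∈ Finset.range n, T ≤ σ.arr 7 c * n := by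
    refine Finset.exists_le_of_sum_le (by simpa using hn0.ne') ?_
    rw [← Finset.sum_mul, hsum]
    simp [mul_comm]
  rw [Finset.mem_range] at hc₀
  simp only [pickCenter, wp_seq, wp_setReg, NExp.eval, NExp.size]
  refine ⟨by omega, (wp_loop (φ := c₀ * 20)
    (I := fun φ τ => ∃ c, τ.reg 12 = c ∧ c ≤ c₀ ∧ φ = (c₀ - c) * 20)
    ⟨0, by simp, by omega, by simp⟩ ?_).mono ?_⟩
  · rintro φ τ hf ⟨c, hc, hcle, rfl⟩ hb
    have hn1 : τ.reg 0 = n := by rw [hf.reg 0 rfl]; simpa using hn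
    have hT1 : τ.reg 11 = T := by rw [hf.reg 11 rfl]; simpa using hT
    have ha : τ.arr 7 = σ.arr 7 := by rw [hf.arr 7 rfl]; simp
    simp only [Test.Holds, NExp.eval, hc, hn1, hT1, ha] at hb
    have : c ≠ c₀ := by rintro rfl; omega
    simp only [wp_setReg, NExp.eval, NExp.size, Test.size, State.setR_reg, reduceIte, hc]
    exact ⟨by omega, _, ⟨_, rfl, by omega, rfl⟩, by omega⟩
  · rintro t τ hf ⟨ht, ⟨φ, c, hc, hcle, rfl⟩, hb⟩
    have hn1 : τ.reg 0 = n := by rw [hf.reg 0 rfl]; simpa using hn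
    have hT1 : τ.reg 11 = T := by rw [hf.reg 11 rfl]; simpa using hT
    have ha : τ.arr 7 = σ.arr 7 := by rw [hf.arr 7 rfl]; simp
    simp only [Test.Holds, NExp.eval, hc, hn1, hT1, ha, not_lt] at hb
    simp only [Test.size, NExp.size] at ht
    rw [hc]
    exact ⟨by omega, by omega, hb⟩

/-- Marks the rows that have the vertex `r12` among their first `r9` entries as hit. -/
def markHits : Prog :=
  .forLt 5 (.reg 0) <|
    .forLt 6 (.reg 9) <|
      .ite (.eq (.get 2 (.add (.mul (.reg 5) (.reg 0)) (.reg 6))) (.reg 12))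
        (.setArr 8 (.reg 5) (.const 1)) .skip

theorem markHits_spec {B n s c : ℕ} {σ : State} (hB : n + 1 < B) (hsn : s ≤ n) (hs0 : 0 < s)
    (hn : σ.reg 0 = n) (hs : σ.reg 9 = s) (hc : σ.reg 12 = c) :
    Wp B markHits σ fun t τ => t ≤ 60 * (n * s) + 10 ∧
      ∀ y, y < n → (τ.arr 8 y = 0 ↔ σ.arr 8 y = 0 ∧ ¬ ∃ j < s, σ.arr 2 (y * n + j) = c) := by
  refine (wp_forLt (N := n) (c := s * 32 + 10)
    (I := fun i τ => (∀ y, y < i →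
        (τ.arr 8 y = 0 ↔ σ.arr 8 y = 0 ∧ ¬ ∃ j < s, σ.arr 2 (y * n + j) = c)) ∧
      ∀ y, i ≤ y → τ.arr 8 y = σ.arr 8 y)
    (by omega) rfl (by simp) ?_ ?_).mono ?_
  · intro τ hf
    simp [hf.reg 0 rfl, hn]
  · rintro i τ hi hf h5 ⟨hI, hI'⟩
    have hn1 : τ.reg 0 = n := by rw [hf.reg 0 rfl, hn]
    have hs1 : τ.reg 9 = s := by rw [hf.reg 9 rfl, hs]
    have hc1 : τ.reg 12 = c := by rw [hf.reg 12 rfl, hc]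
    have ha1 : τ.arr 2 = σ.arr 2 := hf.arr 2 rfl
    refine (wp_forLt (N := s) (c := 22)
      (I := fun i' ρ => (∀ y, y ≠ i → ρ.arr 8 y = τ.arr 8 y) ∧
        (ρ.arr 8 i = 0 ↔ σ.arr 8 i = 0 ∧ ¬ ∃ j < i', σ.arr 2 (i * n + j) = c))
      (by omega) rfl (by simp [hI' i le_rfl]) ?_ ?_).mono ?_
    · intro ρ hf
      simp [hf.reg 9 rfl, hs1]
    · rintro i' ρ hi' hf' h6 ⟨hJ, hJ'⟩
      have hn2 : ρ.reg 0 = n := by rw [hf'.reg 0 rfl, hn1]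
      have hc2 : ρ.reg 12 = c := by rw [hf'.reg 12 rfl, hc1]
      have h52 : ρ.reg 5 = i := by rw [hf'.reg 5 rfl, h5]
      have ha2 : ρ.arr 2 = σ.arr 2 := by rw [hf'.arr 2 rfl, ha1]
      simp only [wp_ite, wp_skip, wp_setArr, NExp.eval, NExp.size, Test.Holds, Test.size,
        State.setR_arr, State.setA_arr, reduceIte, hn2, hc2, h52, h6, ha2]
      refine ⟨fun h => ⟨by omega, by omega, by omega, fun y hy => ?_, ?_⟩,
        fun h => ⟨by omega, hJ, ?_⟩⟩
      · rw [Function.update_of_ne hy, hJ y hy]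
      · rw [Function.update_self]
        exact ⟨fun h0 => absurd h0 one_ne_zero, fun h0 => absurd ⟨i', by omega, h⟩ h0.2⟩
      · rw [hJ']
        refine and_congr_right fun _ => not_congr ⟨fun ⟨j, hj, he⟩ => ⟨j, by omega, he⟩,
          fun ⟨j, hj, he⟩ => ⟨j, ?_, he⟩⟩
        have : j ≠ i' := by rintro rfl; exact h he
        omega
    · rintro t ρ - ⟨ht, ⟨hJ, hJ'⟩, -⟩
      simp only [NExp.size] at ht
      simp only [State.setR_arr]
      refine ⟨by omega, fun y hy => ?_, fun y hy => ?_⟩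
      · by_cases hyi : y = i
        · rw [hyi]; exact hJ'
        · rw [hJ y hyi]; exact hI y (by omega)
      · rw [hJ y (by omega)]; exact hI' y (by omega)
  · rintro t τ - ⟨ht, ⟨hI, -⟩, -⟩
    simp only [NExp.size] at ht
    refine ⟨?_, hI⟩
    have h1 : n * (s * 32 + 10 + 1 + 7) = 32 * (n * s) + 18 * n := by ring
    have h2 : n ≤ n * s := Nat.le_mul_of_pos_right _ hs0
    omega

/-! ### One level of the algorithm -/

/-- The weight matrix and the sorted rows are in memory. -/
structure HasRows (n : ℕ) (G : SimpleGraph (Fin n)) (w : Sym2 (Fin n) → ℝ≥0) (σ : State) :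
    Prop where
  n_eq : σ.reg 0 = n
  weight : ∀ x y, x < n → y < n → σ.warr 2 (x * n + y) = weightMatrix G w x y
  row : ∀ y, y < n →
    SortedRow n (weightMatrix G w y) y (fun j => σ.arr 2 (y * n + j)) (σ.arr 3 y)

/-- The distance matrix is bounded below by the distances, and the queue is empty. -/
structure HasBounds (n : ℕ) (G : SimpleGraph (Fin n)) (w : Sym2 (Fin n) → ℝ≥0) (σ : State) :
    Prop where
  queue : IsHeap n (σ.warr 3) fun _ => ⊤
  le : ∀ u v, u < n → v < n → natDist G w u v ≤ σ.warr 1 (u * n + v)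

/-- Every row with at least `s` entries contains among the first `s` of them a vertex from which
the distances are known up to `2 i W`. -/
def Hit (n : ℕ) (G : SimpleGraph (Fin n)) (w : Sym2 (Fin n) → ℝ≥0) (s i : ℕ) (σ : State)
    (y : ℕ) : Prop :=
  ∃ j, j < s ∧
    RowGood G w (fun v => σ.warr 1 (σ.arr 2 (y * n + j) * n + v)) (2 * i) (σ.arr 2 (y * n + j))

section Level

variable {n : ℕ} {G : SimpleGraph (Fin n)} {w : Sym2 (Fin n) → ℝ≥0} {σ τ : State}

theorem HasRows.of_eq (h : HasRows n G w σ) (hn : τ.reg 0 = σ.reg 0) (hw : τ.warr 2 = σ.warr 2)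
    (h2 : τ.arr 2 = σ.arr 2) (h3 : τ.arr 3 = σ.arr 3) : HasRows n G w τ :=
  ⟨by rw [hn, h.n_eq], by rw [hw]; exact h.weight, by rw [h2, h3]; exact h.row⟩

theorem HasBounds.of_eq (h : HasBounds n G w σ) (hw : τ.warr = σ.warr) : HasBounds n G w τ :=
  ⟨by rw [hw]; exact h.queue, by rw [hw]; exact h.le⟩

/-- Estimates only decrease, so hits found earlier survive all later runs. -/
theorem Hit.of_le {s i y : ℕ} (h : Hit n G w s i σ y) (h2 : τ.arr 2 = σ.arr 2)
    (hlt : ∀ j, j < s → σ.arr 2 (y * n + j) < n)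
    (hle : ∀ x v, x < n → v < n → τ.warr 1 (x * n + v) ≤ σ.warr 1 (x * n + v)) :
    Hit n G w s i τ y := by
  obtain ⟨j, hj, hgood⟩ := h
  refine ⟨j, hj, ?_⟩
  rw [h2]
  exact hgood.mono fun v hv => hle _ v (hlt j hj) hv

/-- Dijkstra's algorithm within a level. -/
theorem dijkstra_level_spec {B s i u : ℕ} (hB : n * n + 2 * n < B) (hrows : HasRows n G w σ)
    (hbd : HasBounds n G w σ) (hu : σ.reg 12 = u) (hun : u < n)
    (harcs : ArcLists n s (σ.arr 2) (σ.arr 3) (σ.arr 5) (σ.arr 6) n 0)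
    (hprev : ∀ y, y < n → s ≤ σ.arr 3 y → 1 ≤ i ∧ Hit n G w s (i - 1) σ y) :
    Wp B dijkstra σ fun t τ =>
      t ≤ 500 * ((n + ∑ y ∈ Finset.range n, min (σ.arr 3 y) s) * (Nat.log 2 n + 2)) ∧
      HasRows n G w τ ∧ HasBounds n G w τ ∧
      (∀ x v, x < n → v < n → τ.warr 1 (x * n + v) ≤ σ.warr 1 (x * n + v)) ∧
      RowGood G w (fun v => τ.warr 1 (u * n + v)) (2 * i) u := by
  have hsum : ∑ x ∈ Finset.range n, σ.arr 5 x = ∑ y ∈ Finset.range n, min (σ.arr 3 y) s := by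
    rw [harcs.sum, add_zero]
  have hcnt : ∀ x, x < n → σ.arr 5 x < B := fun x hx => by
    have h1 := Finset.single_le_sum (f := σ.arr 5) (fun _ _ => Nat.zero_le _)
      (Finset.mem_range.2 hx)
    have h2 := Finset.sum_le_card_nsmul (Finset.range n) (fun y => min (σ.arr 3 y) s) n
      fun y hy => (min_le_left _ _).trans (hrows.row y (Finset.mem_range.1 hy)).le
    rw [hsum] at h1
    simp only [Finset.card_range, smul_eq_mul] at h2
    omega
  refine (dijkstra_spec (d := natDist G w u) hB hrows.n_eq hu hun hcnt harcs.lt ?_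
    (natDist_self u) ?_ hbd.queue).mono ?_
  · intro x y hx hy
    rw [hrows.weight x y hx hy]
    exact natDist_le_add u x y hun
  · exact fun v hv => ⟨by rw [natDist_comm]; exact hbd.le v u hv hun, hbd.le u v hun hv⟩
  · rintro t τ hf ⟨ht, hT, hoth, hzero, hrow, harc⟩
    have hle : ∀ x v, x < n → v < n → τ.warr 1 (x * n + v) ≤ σ.warr 1 (x * n + v) := by
      intro x v hx hv
      by_cases hxu : x = u
      · rw [hxu]; exact (hrow v hv).2.2
      · exact (hoth x v hx hv hxu).le
    refine ⟨by rwa [hsum] at ht, hrows.of_eq (hf.reg 0 rfl) (hf.warr 2 rfl) (hf.arr 2 rfl)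
      (hf.arr 3 rfl), ⟨hT, fun x v hx hv => ?_⟩, hle, ?_⟩
    · by_cases hxu : x = u
      · rw [hxu]; exact (hrow v hv).1
      · rw [hoth x v hx hv hxu]; exact hbd.le x v hx hv
    -- The old estimates from the good vertices of the previous level enter through column `u`,
    -- which the initial keys take into account.
    · refine rowGood_of_stable (N := fun y j => σ.arr 2 (y * n + j)) (len := σ.arr 3)
        (M := fun x v => σ.warr 1 (x * n + v)) (s := s) hrows.row hzero
        (fun v hv => (hrow v hv).2.1) ?_ hprev
      intro y j hy hjs hj
      obtain ⟨q, hq, he⟩ := harcs.arc y j hy (lt_min hj hjs)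
      have hx := (hrows.row y hy).lt j hj
      have := harc _ q hx hq
      rwa [he, hrows.weight _ _ hx hy] at this

/-- One step of the greedy algorithm for the hitting set: find a vertex that hits many rows, and
compute the distances from it; clear register `10` if all rows are hit. -/
def hitStep : Prog :=
  .seq countHits <|
  .ite (.eq (.reg 11) (.const 0)) (.setReg 10 (.const 0))
    (.seq pickCenter (.seq markHits dijkstra))

/-- Either no row is open and only the flag changes, or the run from the new centre serves all rows
it hits and lowers the greedy potential. -/
theorem hitStep_spec {B s s' i E : ℕ} (hB : n * n + 2 * n + 1 < B) (hs0 : 0 < s) (hsn : s ≤ n)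
    (hrows : HasRows n G w σ) (hbd : HasBounds n G w σ) (hs : σ.reg 9 = s)
    (harcs : ArcLists n s' (σ.arr 2) (σ.arr 3) (σ.arr 5) (σ.arr 6) n 0)
    (hprev : ∀ y, y < n → s' ≤ σ.arr 3 y → 1 ≤ i ∧ Hit n G w s' (i - 1) σ y)
    (hE : ∑ y ∈ Finset.range n, min (σ.arr 3 y) s' ≤ E) (hn0 : 0 < n)
    (hunhit : ∀ y, y < n → σ.arr 8 y = 0 → s ≤ σ.arr 3 y)
    (hhit : ∀ y, y < n → s ≤ σ.arr 3 y → σ.arr 8 y ≠ 0 → Hit n G w s i σ y) :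
    Wp B hitStep σ fun t τ =>
      t ≤ 250 * (n * s) + 500 * ((n + E) * (Nat.log 2 n + 2)) ∧
      (τ.reg 10 = 0 ∧ τ.warr = σ.warr ∧ unhit (σ.arr 8) n = ∅ ∨
        τ.reg 10 = σ.reg 10 ∧ HasBounds n G w τ ∧
        (∀ x v, x < n → v < n → τ.warr 1 (x * n + v) ≤ σ.warr 1 (x * n + v)) ∧
        (∀ y, y < n → τ.arr 8 y = 0 → s ≤ σ.arr 3 y) ∧
        (∀ y, y < n → s ≤ σ.arr 3 y → τ.arr 8 y ≠ 0 → Hit n G w s i τ y) ∧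
        greedyBound n s (unhit (τ.arr 8) n).card + 1 ≤
          greedyBound n s (unhit (σ.arr 8) n).card) := by
  have hlt : ∀ y j, y < n → s ≤ σ.arr 3 y → j < s → σ.arr 2 (y * n + j) < n :=
    fun y j hy h hj => (hrows.row y hy).lt j (hj.trans_le h)
  have hns : n ≤ n * s := Nat.le_mul_of_pos_right _ hs0
  refine wp_seq.2 ((countHits_spec (n := n) (s := s) (by omega) hn0 hs0 hsn hrows.n_eq hs
    (fun y j hy h0 hj => hlt y j hy (hunhit y hy h0) hj)
    (fun y a b hy h0 ha hb he => (hrows.row y hy).inj a b (ha.trans_le (hunhit y hy h0))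
      (hb.trans_le (hunhit y hy h0)) he)).mono ?_)
  rintro t ρ hf ⟨ht, h11, hsum, hnum⟩
  have hw : ρ.warr = σ.warr := funext fun a => hf.warr a rfl
  have hrowsρ : HasRows n G w ρ := hrows.of_eq (hf.reg 0 rfl) (hf.warr 2 rfl) (hf.arr 2 rfl)
    (hf.arr 3 rfl)
  simp only [wp_ite, wp_seq, wp_setReg, NExp.eval, NExp.size, Test.Holds, Test.size]
  refine ⟨fun h => ⟨by omega, by omega, .inl ⟨by simp, hw, ?_⟩⟩, fun h => ?_⟩
  · rw [h11] at h
    exact Finset.card_eq_zero.1 ((Nat.mul_eq_zero.1 h).resolve_right hs0.ne')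
  refine (pickCenter_spec (by omega) hn0 hrowsρ.n_eq rfl hsum).mono ?_
  rintro t₁ ρ₁ hf₁ ⟨ht₁, hc, hmany⟩
  generalize hcdef : ρ₁.reg 12 = c at hc hmany
  have hrows₁ : HasRows n G w ρ₁ := hrowsρ.of_eq (hf₁.reg 0 rfl) (hf₁.warr 2 rfl) (hf₁.arr 2 rfl)
    (hf₁.arr 3 rfl)
  have hs₁ : ρ₁.reg 9 = s := by rw [hf₁.reg 9 rfl, hf.reg 9 rfl, hs]
  have h8₁ : ρ₁.arr 8 = σ.arr 8 := by rw [hf₁.arr 8 rfl, hf.arr 8 rfl]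
  have h2₁ : ρ₁.arr 2 = σ.arr 2 := by rw [hf₁.arr 2 rfl, hf.arr 2 rfl]
  refine (markHits_spec (by omega) hsn hs0 hrows₁.n_eq hs₁ hcdef).mono ?_
  rintro t₂ ρ₂ hf₂ ⟨ht₂, hmark⟩
  rw [h8₁, h2₁] at hmark
  have hrows₂ : HasRows n G w ρ₂ := hrows₁.of_eq (hf₂.reg 0 rfl) (hf₂.warr 2 rfl) (hf₂.arr 2 rfl)
    (hf₂.arr 3 rfl)
  have hw₂ : ρ₂.warr = σ.warr := by
    rw [← hw]; exact funext fun a => (hf₂.warr a rfl).trans (hf₁.warr a rfl)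
  have h2₂ : ρ₂.arr 2 = σ.arr 2 := by rw [hf₂.arr 2 rfl, h2₁]
  have h3₂ : ρ₂.arr 3 = σ.arr 3 := by rw [hf₂.arr 3 rfl, hf₁.arr 3 rfl, hf.arr 3 rfl]
  have h5₂ : ρ₂.arr 5 = σ.arr 5 := by rw [hf₂.arr 5 rfl, hf₁.arr 5 rfl, hf.arr 5 rfl]
  have h6₂ : ρ₂.arr 6 = σ.arr 6 := by rw [hf₂.arr 6 rfl, hf₁.arr 6 rfl, hf.arr 6 rfl]
  refine (dijkstra_level_spec (s := s') (i := i) (u := c) (by omega) hrows₂ (hbd.of_eq hw₂)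
    (by rw [hf₂.reg 12 rfl, hcdef]) hc (by rw [h2₂, h3₂, h5₂, h6₂]; exact harcs) ?_).mono ?_
  · intro y hy hys
    rw [h3₂] at hys
    refine (hprev y hy hys).imp_right fun hh => hh.of_le h2₂ (fun j hj => ?_) (by simp [hw₂])
    exact (hrows.row y hy).lt j (hj.trans_le hys)
  rintro t₃ τ hf₃ ⟨ht₃, -, hbd₃, hle₃, hgood⟩
  have h8 : τ.arr 8 = ρ₂.arr 8 := hf₃.arr 8 rfl
  have h2 : τ.arr 2 = σ.arr 2 := by rw [hf₃.arr 2 rfl, h2₂]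
  rw [hw₂] at hle₃
  rw [h3₂] at ht₃
  have hE' : (n + ∑ y ∈ Finset.range n, min (σ.arr 3 y) s') * (Nat.log 2 n + 2) ≤
      (n + E) * (Nat.log 2 n + 2) := Nat.mul_le_mul_right _ (Nat.add_le_add_left hE n)
  refine ⟨by omega, .inr ⟨?_, hbd₃, hle₃, fun y hy h0 => ?_, fun y hy hys h0 => ?_, ?_⟩⟩
  · rw [hf₃.reg 10 rfl, hf₂.reg 10 rfl, hf₁.reg 10 rfl, hf.reg 10 rfl]
  · rw [h8, hmark y hy] at h0
    exact hunhit y hy h0.1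
  · rw [h8, ne_eq, hmark y hy, not_and_not_right] at h0
    by_cases hy0 : σ.arr 8 y = 0
    · obtain ⟨j, hj, he⟩ := h0 hy0
      refine ⟨j, hj, ?_⟩
      rw [h2, he]
      exact hgood
    · exact (hhit y hy hys hy0).of_le h2 (fun j hj => hlt y j hy hys hj) hle₃
  · have hpos : 0 < (unhit (σ.arr 8) n).card := by
      rw [Nat.pos_iff_ne_zero]
      intro h0
      rw [h11, h0, zero_mul] at h
      exact h rfl
    have hnew : newlyHit n s (σ.arr 2) (σ.arr 8) c n ⊆ unhit (σ.arr 8) n := Finset.filter_subset _ _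
    have hsd : unhit (τ.arr 8) n = unhit (σ.arr 8) n \ newlyHit n s (σ.arr 2) (σ.arr 8) c n := by
      ext y
      simp only [unhit, newlyHit, Finset.mem_filter, Finset.mem_sdiff, Finset.mem_range, h8]
      by_cases hy : y < n
      · simp only [hy, true_and, hmark y hy]
        exact ⟨fun h' => ⟨h'.1, fun h'' => h'.2 h''.2⟩, fun h' => ⟨h'.1, fun h'' => h'.2 ⟨h'.1, h''⟩⟩⟩
      · simp [hy]
    have hcard := Finset.card_sdiff_add_card_eq_card hnew
    rw [← hsd] at hcard
    -- The counters sum to `U * s` for `U` open rows, so the chosen counter times `n` is at least `U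
    -- * s`; it is at most the number of newly hit rows times `n`.
    refine greedyBound_lt hs0 (by omega) hpos ?_
    rw [← h11, show (unhit (σ.arr 8) n).card - (unhit (τ.arr 8) n).card =
      (newlyHit n s (σ.arr 2) (σ.arr 8) c n).card by omega]
    exact hmany.trans (Nat.mul_le_mul_right _ (hnum c hc))

end Level

/-- Level `r15` of the algorithm. -/
def level : Prog :=
  .seq (.setReg 9 (.get 4 (.sub (.reg 15) (.const 1)))) <|
  .seq buildArcs <|
  .seq initHit <|
  .seq (.setReg 10 (.const 1)) <|
  .loop (.lt (.const 0) (.reg 10)) hitStep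

section Level

variable {n : ℕ} {G : SimpleGraph (Fin n)} {w : Sym2 (Fin n) → ℝ≥0} {σ : State}

/-- A level turns hits for the threshold `s'` with error `2 (i - 1) W` into hits for the smaller
prefixes `s` with error `2 i W`. The extra `1` besides `greedyBound` pays for the last step, which
finds nothing left to hit. -/
theorem level_spec {B s s' i j E : ℕ} (hB : n * (n * n) + n * n + 2 * n + 1 < B) (hs0 : 0 < s)
    (hsn : s ≤ n) (hn0 : 0 < n) (hrows : HasRows n G w σ) (hbd : HasBounds n G w σ)
    (hj : σ.reg 15 = j) (hs' : σ.arr 4 j = s') (hs : σ.arr 4 (j - 1) = s)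
    (hprev : ∀ y, y < n → s' ≤ σ.arr 3 y → 1 ≤ i ∧ Hit n G w s' (i - 1) σ y)
    (hE : ∑ y ∈ Finset.range n, min (σ.arr 3 y) s' ≤ E) :
    Wp B level σ fun t τ =>
      t ≤ 220 * (n * n) + (greedyBound n s n + 1) *
        (260 * (n * s) + 500 * ((n + E) * (Nat.log 2 n + 2))) ∧
      HasRows n G w τ ∧ HasBounds n G w τ ∧
      ∀ y, y < n → s ≤ τ.arr 3 y → Hit n G w s i τ y := by
  set K := 260 * (n * s) + 500 * ((n + E) * (Nat.log 2 n + 2)) with hK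
  have hnn : n ≤ n * n := Nat.le_mul_self n
  have hns : n ≤ n * s := Nat.le_mul_of_pos_right _ hs0
  simp only [level, wp_seq, wp_setReg, NExp.eval, NExp.size, hj, hs]
  refine ⟨by omega, (buildArcs_spec (n := n) (s := s') (by omega) hn0 (by simpa using hrows.n_eq)
    (by simpa [hj] using hs') (by simpa using fun y hy => (hrows.row y hy).le)
    (by simpa using fun y j hy hj => (hrows.row y hy).lt j hj)).mono ?_⟩
  simp only [State.setR_arr]
  rintro t₁ ρ₁ hf₁ ⟨ht₁, harcs⟩
  have hs₁ : ρ₁.reg 9 = s := by rw [hf₁.reg 9 rfl]; simp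
  have hrows₁ : HasRows n G w ρ₁ := hrows.of_eq ((hf₁.reg 0 rfl).trans (by simp))
    (hf₁.warr 2 rfl) (hf₁.arr 2 rfl) (hf₁.arr 3 rfl)
  have hw₁ : ρ₁.warr = σ.warr := funext fun a => hf₁.warr a rfl
  have h2₁ : ρ₁.arr 2 = σ.arr 2 := hf₁.arr 2 rfl
  have h3₁ : ρ₁.arr 3 = σ.arr 3 := hf₁.arr 3 rfl
  refine (initHit_spec (by omega) hrows₁.n_eq hs₁).mono ?_
  rintro t₂ ρ₂ hf₂ ⟨ht₂, hinit⟩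
  rw [h3₁] at hinit
  have hs₂ : ρ₂.reg 9 = s := by rw [hf₂.reg 9 rfl, hs₁]
  have hrows₂ : HasRows n G w ρ₂ := hrows₁.of_eq (hf₂.reg 0 rfl) (hf₂.warr 2 rfl) (hf₂.arr 2 rfl)
    (hf₂.arr 3 rfl)
  have hw₂ : ρ₂.warr = σ.warr := by rw [← hw₁]; exact funext fun a => hf₂.warr a rfl
  have h2₂ : ρ₂.arr 2 = σ.arr 2 := by rw [hf₂.arr 2 rfl, h2₁]
  have h3₂ : ρ₂.arr 3 = σ.arr 3 := by rw [hf₂.arr 3 rfl, h3₁]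
  have h5₂ : ρ₂.arr 5 = ρ₁.arr 5 := hf₂.arr 5 rfl
  have h6₂ : ρ₂.arr 6 = ρ₁.arr 6 := hf₂.arr 6 rfl
  have hlt : ∀ y, y < n → s' ≤ σ.arr 3 y → ∀ j, j < s' → σ.arr 2 (y * n + j) < n :=
    fun y hy h j hj => (hrows.row y hy).lt j (hj.trans_le h)
  refine ⟨by omega, (wp_loop (φ := (greedyBound n s (unhit (ρ₂.arr 8) n).card + 1) * K)
    (I := fun φ τ => HasBounds n G w τ ∧
      (∀ x v, x < n → v < n → τ.warr 1 (x * n + v) ≤ σ.warr 1 (x * n + v)) ∧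
      (τ.reg 10 = 0 ∧ (∀ y, y < n → s ≤ σ.arr 3 y → Hit n G w s i τ y) ∧ φ = 0 ∨
        τ.reg 10 = 1 ∧ (∀ y, y < n → τ.arr 8 y = 0 → s ≤ σ.arr 3 y) ∧
        (∀ y, y < n → s ≤ σ.arr 3 y → τ.arr 8 y ≠ 0 → Hit n G w s i τ y) ∧
        φ = (greedyBound n s (unhit (τ.arr 8) n).card + 1) * K))
    ⟨hbd.of_eq (by simpa using hw₂), by simp [hw₂], .inr ⟨by simp,
      fun y hy h => (hinit y hy).1 (by simpa using h),
      fun y hy h h' => absurd ((hinit y hy).2 h) (by simpa using h'), by simp⟩⟩ ?_).mono ?_⟩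
  · rintro φ τ hf ⟨hbdτ, hleτ, ⟨h10, -⟩ | ⟨h10, hun, hhit, rfl⟩⟩ hb <;>
      simp only [Test.Holds, NExp.eval] at hb
    · omega
    have hrowsτ : HasRows n G w τ := hrows₂.of_eq ((hf.reg 0 rfl).trans (by simp))
      (hf.warr 2 rfl) (hf.arr 2 rfl) (hf.arr 3 rfl)
    have h2τ : τ.arr 2 = σ.arr 2 := by rw [hf.arr 2 rfl]; simpa using h2₂
    have h3τ : τ.arr 3 = σ.arr 3 := by rw [hf.arr 3 rfl]; simpa using h3₂
    have h5τ : τ.arr 5 = ρ₁.arr 5 := by rw [hf.arr 5 rfl]; simpa using h5₂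
    have h6τ : τ.arr 6 = ρ₁.arr 6 := by rw [hf.arr 6 rfl]; simpa using h6₂
    refine (hitStep_spec (s := s) (s' := s') (i := i) (E := E) (by omega) hs0 hsn hrowsτ hbdτ
      (by rw [hf.reg 9 rfl]; simpa using hs₂) (by rw [h2τ, h3τ, h5τ, h6τ]; exact harcs)
      (fun y hy h => ?_) (by rw [h3τ]; exact hE) hn0 (by rw [h3τ]; exact hun)
      (by rw [h3τ]; exact hhit)).mono ?_
    · rw [h3τ] at h
      exact (hprev y hy h).imp_right fun hh => hh.of_le h2τ (hlt y hy h) hleτ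
    · rintro t π hf' ⟨ht, hor⟩
      have hle1 : K ≤ (greedyBound n s (unhit (τ.arr 8) n).card + 1) * K :=
        Nat.le_mul_of_pos_left _ (Nat.succ_pos _)
      rcases hor with ⟨hπ10, hπw, hempty⟩ | ⟨hπ10, hbdπ, hleπ, hunπ, hhitπ, hgreedy⟩
      · have hall : ∀ y, y < n → τ.arr 8 y ≠ 0 := by
          intro y hy h0
          have : y ∈ unhit (τ.arr 8) n := by simp [unhit, hy, h0]
          rw [hempty] at this
          simp at this
        have h2π : π.arr 2 = τ.arr 2 := hf'.arr 2 rfl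
        have hhit' : ∀ y, y < n → s ≤ σ.arr 3 y → Hit n G w s i π y := by
          intro y hy h
          refine (hhit y hy h (hall y hy)).of_le h2π (fun j hj => ?_) (by simp [hπw])
          rw [h2τ]
          exact (hrows.row y hy).lt j (hj.trans_le h)
        refine ⟨0, ⟨hbdτ.of_eq hπw, by rw [hπw]; exact hleτ, .inl ⟨hπ10, hhit', rfl⟩⟩, ?_⟩
        simp only [Test.size, NExp.size]
        omega
      · refine ⟨_, ⟨hbdπ, fun x v hx hv => (hleπ x v hx hv).trans (hleτ x v hx hv),
          .inr ⟨by rw [hπ10, h10], by rwa [h3τ] at hunπ, by rwa [h3τ] at hhitπ, rfl⟩⟩, ?_⟩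
        have := Nat.mul_le_mul_right K hgreedy
        rw [Nat.add_mul] at this
        simp only [Test.size, NExp.size]
        rw [Nat.add_mul (greedyBound n s (unhit (π.arr 8) n).card),
          Nat.add_mul (greedyBound n s (unhit (τ.arr 8) n).card)]
        omega
  · rintro t τ hf ⟨ht, ⟨φ, hbdτ, -, hgo⟩, hb⟩
    simp only [Test.Holds, NExp.eval, not_lt, Nat.le_zero] at hb
    have hrowsτ : HasRows n G w τ := hrows₂.of_eq ((hf.reg 0 rfl).trans (by simp))
      (hf.warr 2 rfl) (hf.arr 2 rfl) (hf.arr 3 rfl)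
    have h3τ : τ.arr 3 = σ.arr 3 := by rw [hf.arr 3 rfl]; simpa using h3₂
    have hdone : ∀ y, y < n → s ≤ σ.arr 3 y → Hit n G w s i τ y := by
      rcases hgo with h | h
      · exact h.2.1
      · omega
    refine ⟨?_, hrowsτ, hbdτ, by rw [h3τ]; exact hdone⟩
    have hcard : (unhit (ρ₂.arr 8) n).card ≤ n :=
      (Finset.card_filter_le _ _).trans (Finset.card_range n).le
    have := Nat.mul_le_mul_right K
      (Nat.add_le_add_right (greedyBound_mono (n := n) (s := s) hcard) 1)
    simp only [Test.size, NExp.size] at ht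
    have hn1 : 1 ≤ n * n := by omega
    omega

/-! ### Composition of the levels and their total cost -/

/-- The cost of a level, for thresholds `s` and at most `r s`. -/
theorem level_cost_le {n s r : ℕ} (hn0 : 0 < n) (hs0 : 0 < s) (hsn : s ≤ n) (hr : 1 ≤ r) :
    220 * (n * n) + (greedyBound n s n + 1) *
        (260 * (n * s) + 500 * ((n + 3 * (n * (r * s))) * (Nat.log 2 n + 2))) ≤
      5000 * (n * n * r * (Nat.log 2 n + 2) ^ 2) := by
  have hg := greedyBound_mul_le hn0 hs0
  generalize greedyBound n s n = g at hg ⊢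
  have hL : 2 ≤ Nat.log 2 n + 2 := by omega
  generalize Nat.log 2 n + 2 = L at hg hL ⊢
  have h1 : 260 * (n * s) + 500 * ((n + 3 * (n * (r * s))) * L) ≤ 2130 * (n * r * L) * s := by
    have e1 : n * s * 1 ≤ n * s * (r * L) := Nat.mul_le_mul_left _ (by nlinarith)
    have e2 : n * s * 2 ≤ n * s * (r * L) := Nat.mul_le_mul_left _ (by nlinarith)
    have e3 : n * L * 1 ≤ n * L * (r * s) := Nat.mul_le_mul_left _ (by nlinarith)
    have e4 : 500 * ((n + 3 * (n * (r * s))) * L) = 500 * (n * L) + 1500 * (n * L * (r * s)) := by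
      ring
    have e5 : 2130 * (n * r * L) * s = 130 * (n * s * (r * L)) + 2000 * (n * L * (r * s)) := by ring
    omega
  -- The number of centres is inversely proportional to `s`, so the threshold cancels and only the
  -- ratio `r` remains.
  have h2 : (g + 1) * s ≤ 2 * (n * L) := by
    have : n * 1 ≤ n * L := Nat.mul_le_mul_left _ (by omega)
    rw [Nat.add_mul]
    omega
  calc _ ≤ 220 * (n * n) + (g + 1) * (2130 * (n * r * L) * s) := by gcongr
    _ = 220 * (n * n) + (g + 1) * s * (2130 * (n * r * L)) := by ring
    _ ≤ 220 * (n * n) + 2 * (n * L) * (2130 * (n * r * L)) := by gcongr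
    _ = 220 * (n * n * 1) + 4260 * (n * n * (r * L ^ 2)) := by ring
    _ ≤ 220 * (n * n * (r * L ^ 2)) + 4260 * (n * n * (r * L ^ 2)) := by
      gcongr
      exact Nat.one_le_iff_ne_zero.2 (by positivity)
    _ ≤ _ := by rw [mul_assoc (n * n)]; omega

/-- All levels of the algorithm. -/
def levels : Prog :=
  .seq (.setReg 15 (.reg 2)) <|
  .loop (.lt (.const 0) (.reg 15)) <|
    .seq level (.setReg 15 (.sub (.reg 15) (.const 1)))

/-- The counter `j` runs downwards and the error index is `i = k - j`. The invariant concerns hits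
for the threshold in cell `j`, produced by level `j + 1`. -/
theorem levels_spec {B k r : ℕ} (hB : n * (n * n) + n * n + 2 * n + 1 < B) (hkB : k < B)
    (hn0 : 0 < n) (hk1 : 1 ≤ k) (hr : 1 ≤ r) (hk : σ.reg 2 = k) (hrows : HasRows n G w σ)
    (hbd : HasBounds n G w σ) (hS : ∀ j, j < k → σ.arr 4 j = min (r ^ j) n)
    (hSk : σ.arr 4 k = n + 1)
    (hsum : ∑ y ∈ Finset.range n, σ.arr 3 y ≤ 3 * (n * min (r ^ k) n)) :
    Wp B levels σ fun t τ =>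
      t ≤ 6000 * (k * (n * n * r * (Nat.log 2 n + 2) ^ 2)) ∧ HasBounds n G w τ ∧
      ∀ u, u < n → RowGood G w (fun v => τ.warr 1 (u * n + v)) (2 * (k - 1)) u := by
  set K := 5000 * (n * n * r * (Nat.log 2 n + 2) ^ 2) with hK
  have hK1 : 20 ≤ K := by
    have : 0 < n * n * r * (Nat.log 2 n + 2) ^ 2 := by positivity
    omega
  have hmin : ∀ j, 0 < j → min (r ^ j) n ≤ r * min (r ^ (j - 1)) n := by
    intro j hj
    obtain ⟨j, rfl⟩ : ∃ j', j = j' + 1 := ⟨j - 1, by omega⟩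
    rw [Nat.add_sub_cancel, ← min_pow_succ hr, mul_comm]
    exact min_le_left _ _
  simp only [levels, wp_seq, wp_setReg, NExp.eval, NExp.size, hk]
  refine ⟨hkB, (wp_loop (σ := σ.setR 15 k) (φ := k * (K + 20))
    (I := fun φ τ => ∃ j, τ.reg 15 = j ∧ j ≤ k ∧ HasRows n G w τ ∧ HasBounds n G w τ ∧
      τ.arr 4 = σ.arr 4 ∧ τ.arr 3 = σ.arr 3 ∧
      (∀ y, y < n → σ.arr 4 j ≤ σ.arr 3 y →
        1 ≤ k - j ∧ Hit n G w (σ.arr 4 j) (k - j - 1) τ y) ∧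
      φ = j * (K + 20))
    ⟨k, by simp, le_rfl, hrows.of_eq (by simp) rfl rfl rfl, hbd.of_eq rfl, rfl, rfl,
      fun y hy h => ?_, rfl⟩ ?_).mono ?_⟩
  -- Before the first level the threshold is `n + 1`; no row is that long, and the hypothesis on
  -- hits is vacuous.
  · have := (hrows.row y hy).le
    omega
  · rintro φ τ hf ⟨j, h15, hjk, hrowsτ, hbdτ, h4, h3, hprev, rfl⟩ hb
    simp only [Test.Holds, NExp.eval, h15] at hb
    have hpow : 0 < r ^ (j - 1) := by positivity
    have hsj := hS (j - 1) (by omega)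
    have hE : ∑ y ∈ Finset.range n, min (τ.arr 3 y) (σ.arr 4 j) ≤
        3 * (n * (r * σ.arr 4 (j - 1))) := by
      rw [hsj]
      refine le_trans ?_ (Nat.mul_le_mul_left 3 (Nat.mul_le_mul_left n (hmin j hb)))
      -- For `j = k` the threshold `n + 1` says nothing useful about the number of arcs; it is
      -- bounded through the number of edges instead.
      rcases Nat.lt_or_eq_of_le hjk with hjk | rfl
      · have h1 := Finset.sum_le_card_nsmul (Finset.range n)
          (fun y => min (τ.arr 3 y) (σ.arr 4 j)) (min (r ^ j) n)
          fun y _ => (min_le_right _ _).trans (hS j hjk).le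
        simp only [Finset.card_range, smul_eq_mul] at h1
        omega
      · refine (Finset.sum_le_sum fun y _ => min_le_left _ _).trans ?_
        rwa [h3]
    refine wp_seq.2 ((level_spec (s := σ.arr 4 (j - 1)) (s' := σ.arr 4 j) (i := k - j)
      (E := 3 * (n * (r * σ.arr 4 (j - 1)))) hB (by rw [hsj]; exact lt_min hpow hn0)
      (by rw [hsj]; exact min_le_right _ _) hn0 hrowsτ hbdτ h15 (by rw [h4]) (by rw [h4])
      (by rw [h3]; exact hprev) hE).mono ?_)
    rintro t ρ hf' ⟨ht, hrowsρ, hbdρ, hhit⟩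
    have h15' : ρ.reg 15 = j := by rw [hf'.reg 15 rfl, h15]
    have h4' : ρ.arr 4 = σ.arr 4 := by rw [hf'.arr 4 rfl, h4]
    have h3' : ρ.arr 3 = σ.arr 3 := by rw [hf'.arr 3 rfl, h3]
    have hcost := ht.trans (level_cost_le (r := r) hn0 (by rw [hsj]; exact lt_min hpow hn0)
      (by rw [hsj]; exact min_le_right _ _) hr)
    rw [← hK] at hcost
    simp only [wp_setReg, NExp.eval, NExp.size, Test.size, h15']
    refine ⟨by omega, _, ⟨j - 1, by simp, by omega, hrowsρ.of_eq (by simp) rfl rfl rfl,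
      hbdρ.of_eq rfl, h4', h3', fun y hy h => ⟨by omega, ?_⟩, rfl⟩, ?_⟩
    · have := hhit y hy (by rwa [h3'])
      rw [show k - (j - 1) - 1 = k - j by omega]
      exact this
    · obtain ⟨j, rfl⟩ : ∃ j', j = j' + 1 := ⟨j - 1, by omega⟩
      rw [Nat.add_sub_cancel, Nat.add_mul]
      omega
  · rintro t τ - ⟨ht, ⟨φ, j, h15, hjk, hrowsτ, hbdτ, h4, h3, hprev, rfl⟩, hb⟩
    simp only [Test.Holds, NExp.eval, h15, not_lt, Nat.le_zero] at hb
    subst hb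
    simp only [Test.size, NExp.size] at ht
    refine ⟨?_, hbdτ, fun u hu => ?_⟩
    · have h1 : 1 * K ≤ k * K := Nat.mul_le_mul_right _ hk1
      have h2 : k * 20 ≤ k * (n * n * r * (Nat.log 2 n + 2) ^ 2 * 20) := by
        refine Nat.mul_le_mul_left _ ?_
        have : 0 < n * n * r * (Nat.log 2 n + 2) ^ 2 := by positivity
        omega
      have h3 : k * K = 5000 * (k * (n * n * r * (Nat.log 2 n + 2) ^ 2)) := by rw [hK]; ring
      have h4 : k * (n * n * r * (Nat.log 2 n + 2) ^ 2 * 20) =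
        20 * (k * (n * n * r * (Nat.log 2 n + 2) ^ 2)) := by ring
      rw [Nat.mul_add] at ht
      omega
    -- The last threshold is `1`: every row is hit in its first entry, which is its owner, so the
    -- bound holds from every vertex.
    · have h1 : σ.arr 4 0 = 1 := by
        rw [hS 0 (by omega)]
        simp; omega
      have hrow := hrowsτ.row u hu
      obtain ⟨-, j, hj, hgood⟩ := hprev u hu (by rw [h1, ← h3]; exact hrow.pos)
      obtain rfl : j = 0 := by omega
      have h0 : τ.arr 2 (u * n + 0) = u := hrow.zero
      rw [h0] at hgood
      exact hgood

end Level

/-! ### The whole algorithm -/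

/-- Approximate all-pairs shortest paths. The word arrays hold: `2` the sorted rows, `3` their
lengths, `4` the thresholds, `5` and `6` the arc lists, `7` the counters and `8` the marks of the
greedy hitting set. The weight arrays hold: `1` the distance matrix, `2` the weight matrix, `3` the
priority queue. -/
def apasp : Prog :=
  .seq fillTop <| .seq loadEdges <| .seq sortRows <| .seq thresholds levels

theorem apasp_spec {n m k B : ℕ} {G : SimpleGraph (Fin n)} {w : Sym2 (Fin n) → ℝ≥0}
    {e : Fin m → Fin n × Fin n} (hn0 : 0 < n) (hk1 : 1 ≤ k) (he : IsEdgeList G e)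
    (hB : (n + k + 2) ^ 4 ≤ B) :
    Wp B apasp (inputState k e w) fun t τ => ∃ r, 1 ≤ r ∧ (r - 1) ^ k ≤ m / n ∧
      t ≤ 10000 * (k * (n * n * r * (Nat.log 2 n + 2) ^ 2)) ∧ HasBounds n G w τ ∧
      ∀ u, u < n → RowGood G w (fun v => τ.warr 1 (u * n + v)) (2 * (k - 1)) u := by
  -- The largest addresses are those of the arc lists, of order `n ^ 3`; the fourth power leaves
  -- room for `k` and lower order terms.
  have hB3 : (n + 2) ^ 3 + k < B := by
    refine lt_of_lt_of_le ?_ hB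
    have h1 : (n + 2) ^ 3 ≤ (n + k + 2) ^ 3 := Nat.pow_le_pow_left (by omega) 3
    have h2 : k < (n + k + 2) ^ 3 := by
      have := Nat.le_self_pow (n := 3) (by omega) (n + k + 2)
      omega
    have h3 : (n + k + 2) ^ 4 = (n + k + 2) ^ 3 * (n + k + 2) := by ring
    nlinarith
  have hexp : (n + 2) ^ 3 = n * (n * n) + 6 * (n * n) + 12 * n + 8 := by ring
  have hnn : n ≤ n * n := Nat.le_mul_self n
  have hm := card_edges_le he
  have hm' : n * (n - 1) ≤ n * n := Nat.mul_le_mul_left _ (by omega)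
  have hq : m / n + 1 ≤ n := by
    have : m / n ≤ n - 1 := Nat.div_le_of_le_mul (by omega)
    omega
  refine wp_seq.2 ((fillTop_spec (n := n) (by simp [inputState]) (by omega)).mono ?_)
  rintro t₁ σ₁ hf₁ ⟨ht₁, hfill⟩
  have hn₁ : σ₁.reg 0 = n := by rw [hf₁.reg 0 rfl]; simp [inputState]
  refine wp_seq.2 ((loadEdges_spec (w := w) (k := k) he hn₁
    (by rw [hf₁.reg 1 rfl]; simp [inputState]) (funext fun a => hf₁.arr a rfl) (hf₁.warr 0 rfl)
    (fun i hi => (hfill i (by omega)).2.1) (by omega) (by omega)).mono ?_)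
  rintro t₂ σ₂ hf₂ ⟨ht₂, hA⟩
  have hn₂ : σ₂.reg 0 = n := by rw [hf₂.reg 0 rfl, hn₁]
  have hT₂ : IsHeap n (σ₂.warr 3) fun _ => ⊤ := by
    rw [hf₂.warr 3 rfl]
    refine ⟨fun i h1 hi => ?_, fun x hx => (hfill _ (by omega)).2.2⟩
    rw [(hfill i (by omega)).2.2, (hfill (2 * i) (by omega)).2.2,
      (hfill (2 * i + 1) (by omega)).2.2, min_self]
  refine wp_seq.2 ((sortRows_spec (by omega) (by omega) hn0 hn₂ hA hT₂).mono ?_)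
  rintro t₃ σ₃ hf₃ ⟨ht₃, hT₃, hW₃, hrows₃⟩
  have hn₃ : σ₃.reg 0 = n := by rw [hf₃.reg 0 rfl, hn₂]
  have hk₃ : σ₃.reg 2 = k := by
    rw [hf₃.reg 2 rfl, hf₂.reg 2 rfl, hf₁.reg 2 rfl]; simp [inputState]
  refine wp_seq.2 ((thresholds_spec (m := m) (by omega) (by omega) hn0 hk1 hn₃
    (by rw [hf₃.reg 1 rfl, hf₂.reg 1 rfl, hf₁.reg 1 rfl]; simp [inputState]) hk₃
    (by rw [hf₃.arr 4 rfl, hf₂.arr 4 rfl, hf₁.arr 4 rfl]; simp [inputState]) hq).mono ?_)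
  rintro t₄ σ₄ hf₄ ⟨ht₄, r, hr1, hrlow, hrhigh, hS, hSk⟩
  have h3 : σ₄.arr 3 = σ₃.arr 3 := hf₄.arr 3 rfl
  have hM : ∀ i, i < n * n → σ₄.warr 1 i = ⊤ := fun i hi => by
    rw [hf₄.warr 1 rfl, hf₃.warr 1 rfl, hf₂.warr 1 rfl]
    exact (hfill i (by omega)).1
  have hrows : HasRows n G w σ₄ := by
    refine ⟨by rw [hf₄.reg 0 rfl, hn₃], ?_, fun y hy => ?_⟩
    · rw [hf₄.warr 2 rfl]; exact hW₃
    · rw [h3, hf₄.arr 2 rfl]; exact (hrows₃ y hy).2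
  have hbd : HasBounds n G w σ₄ := by
    refine ⟨by rw [hf₄.warr 3 rfl]; exact hT₃, fun u v hu hv => ?_⟩
    rw [hM _ (index_lt hu hv)]
    exact le_top
  -- The lengths sum to `n + 2 m`, and both `n` and `m` are at most `n (m / n + 1)`; hence the
  -- factor `3`.
  have hsum : ∑ y ∈ Finset.range n, σ₄.arr 3 y ≤ 3 * (n * min (r ^ k) n) := by
    have h1 : ∑ y ∈ Finset.range n, σ₄.arr 3 y = n + 2 * m := by
      rw [h3, ← sum_card_edgeMatrix_lt_top (w := w) he,
        Finset.sum_congr rfl fun y hy => (hrows₃ y (Finset.mem_range.1 hy)).1,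
        Finset.sum_add_distrib]
      simp [finiteKeys]
    have h2 : m ≤ n * (m / n + 1) := by
      have := Nat.lt_mul_div_succ m hn0
      omega
    have h4 : n * (m / n + 1) ≤ n * min (r ^ k) n := Nat.mul_le_mul_left _ (le_min hrhigh hq)
    have h5 : n * 1 ≤ n * (m / n + 1) := Nat.mul_le_mul_left _ (by omega)
    omega
  refine (levels_spec (by omega) (by omega) hn0 hk1 hr1 (by rw [hf₄.reg 2 rfl, hk₃]) hrows hbd hS
    hSk hsum).mono ?_
  rintro t₅ τ - ⟨ht₅, hbdτ, hgood⟩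
  refine ⟨r, hr1, hrlow, ?_, hbdτ, hgood⟩
  have hL : 2 ≤ Nat.log 2 n + 2 := by omega
  generalize Nat.log 2 n + 2 = L at ht₃ ht₅ hL ⊢
  have hkr : 1 ≤ k * r := Nat.mul_pos hk1 hr1
  have e0 : k * (n * n * r * L ^ 2) = n * n * L * (k * r * L) := by ring
  have e1 : n * n * L * 1 ≤ n * n * L * (k * r * L) := Nat.mul_le_mul_left _ (by nlinarith)
  have e2 : n * n * 1 ≤ n * n * L := Nat.mul_le_mul_left _ (by omega)
  have e3 : n * (k + 1) ≤ 2 * (k * (n * n * r * L ^ 2)) := by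
    have : 1 ≤ n * r * L ^ 2 := Nat.succ_le_of_lt (by positivity)
    calc n * (k + 1) ≤ n * (2 * k) * 1 := by
          rw [mul_one]; exact Nat.mul_le_mul_left _ (by omega)
      _ ≤ n * (2 * k) * (n * r * L ^ 2) := Nat.mul_le_mul_left _ this
      _ = _ := by ring
  omega

/-! ### From the step count to real powers and logarithms -/

/-- The parameter `r` in terms of the size of the graph. -/
theorem sq_mul_le_rpow {n m k r : ℕ} (hn0 : 0 < n) (hk1 : 1 ≤ k) (hr : (r - 1) ^ k ≤ m / n) :
    (n : ℝ) * n * r ≤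
      2 * ((n : ℝ) ^ (2 - 1 / (k : ℝ)) * (max n m : ℝ) ^ (1 / (k : ℝ))) := by
  have hn : (0 : ℝ) < n := by exact_mod_cast hn0
  set M : ℝ := max (n : ℝ) m with hM
  have hnM : (n : ℝ) ≤ M := le_max_left _ _
  have hroot : ((r - 1 : ℕ) : ℝ) ≤ (M / n) ^ (1 / (k : ℝ)) := by
    have h1 : (((r - 1 : ℕ) : ℝ)) ^ k ≤ M / n := by
      have h2 : (((r - 1) ^ k : ℕ) : ℝ) ≤ (m / n : ℕ) := by exact_mod_cast hr
      push_cast at h2 ⊢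
      exact h2.trans (Nat.cast_div_le.trans (by gcongr; exact le_max_right _ _))
    rw [one_div, ← Real.pow_rpow_inv_natCast (Nat.cast_nonneg (r - 1)) (by omega : k ≠ 0)]
    exact Real.rpow_le_rpow (by positivity) h1 (by positivity)
  have hone : (1 : ℝ) ≤ (M / n) ^ (1 / (k : ℝ)) :=
    Real.one_le_rpow ((one_le_div hn).2 hnM) (by positivity)
  -- Both summands of `(r - 1) + 1` are bounded by the root, because `max n m / n ≥ 1`; this is
  -- where `max n m` replaces `m`.
  have hr2 : (r : ℝ) ≤ 2 * (M / n) ^ (1 / (k : ℝ)) := by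
    have : (r : ℝ) ≤ ((r - 1 : ℕ) : ℝ) + 1 := by exact_mod_cast (by omega : r ≤ r - 1 + 1)
    linarith
  have hsplit : (n : ℝ) * n * (M / n) ^ (1 / (k : ℝ)) =
      (n : ℝ) ^ (2 - 1 / (k : ℝ)) * M ^ (1 / (k : ℝ)) := by
    rw [Real.div_rpow (hn.le.trans hnM) hn.le, Real.rpow_sub hn,
      show (n : ℝ) ^ (2 : ℝ) = n * n by rw [Real.rpow_two, sq]]
    ring
  rw [← hsplit]
  nlinarith [mul_le_mul_of_nonneg_left hr2 (mul_pos hn hn).le]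

/-- It suffices that `ln 2 > 1/2`. -/
theorem log_two_add_two_le {n : ℕ} (hn0 : 0 < n) :
    ((Nat.log 2 n + 2 : ℕ) : ℝ) ≤ 2 * (1 + Real.log n) := by
  have h1 : ((2 : ℝ) ^ Nat.log 2 n) ≤ n := by exact_mod_cast Nat.pow_log_le_self 2 hn0.ne'
  have h2 := Real.log_le_log (by positivity) h1
  rw [Real.log_pow] at h2
  have h3 := Real.log_two_gt_d9
  have h4 : (0 : ℝ) ≤ (Nat.log 2 n : ℝ) := Nat.cast_nonneg _
  push_cast
  nlinarith

end APASP

theorem mainTheorem5 :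
    -- one program `P` for all inputs; words have `O(log (n + k))` bits
    ∃ (P : APASP.Prog) (c : ℕ),
      -- the implied constants depend only on the constant `a` in `k = O(log n)`
      ∀ a : ℝ, ∃ (C : ℝ) (d : ℕ),
        ∀ (n m k : ℕ) (G : SimpleGraph (Fin n)) (w : Sym2 (Fin n) → ℝ≥0)
          (e : Fin m → Fin n × Fin n),
          0 < n → 1 ≤ k → (k : ℝ) ≤ a * (1 + Real.log n) → APASP.IsEdgeList G e →
          ∃ (t : ℕ) (τ : APASP.State),
            APASP.Exec ((n + k + 2) ^ c) P (APASP.inputState k e w) t τ ∧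
            (t : ℝ) ≤ C * ((n : ℝ) ^ (2 - 1 / (k : ℝ)) * (max n m : ℝ) ^ (1 / (k : ℝ)))
              * (1 + Real.log n) ^ d ∧
            ∀ u v : Fin n,
              APASP.wdist G w u v ≤ APASP.outputMatrix n τ u v ∧
              ∀ p : G.Walk u v, APASP.IsShortestPath G w p →
                APASP.outputMatrix n τ u v ≤
                  APASP.wdist G w u v + 2 * ((k - 1 : ℕ) : ℝ≥0∞) * APASP.heaviest w p := by
  -- The constant is `10000 · a · 2 · 2²`: `a` and one logarithm come from `k`, the first `2` from
  -- `r`, and `2²` with two logarithms from `Nat.log 2 n + 2`.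
  refine ⟨APASP.apasp, 4, fun a => ⟨80000 * a, 3, ?_⟩⟩
  intro n m k G w e hn0 hk1 hka he
  obtain ⟨t, τ, hexec, r, hr1, hr, ht, hbd, hgood⟩ :=
    APASP.apasp_spec (w := w) hn0 hk1 he le_rfl
  refine ⟨t, τ, hexec, ?_, fun u v => ⟨?_, fun p hp => ?_⟩⟩
  · have ht' : (t : ℝ) ≤ 10000 * (k * (n * n * r * ((Nat.log 2 n + 2 : ℕ) : ℝ) ^ 2)) := by
      exact_mod_cast ht
    have h1 := APASP.sq_mul_le_rpow (m := m) hn0 hk1 hr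
    have h2 := APASP.log_two_add_two_le hn0
    have hlog : 0 ≤ 1 + Real.log n := by
      have := Real.log_natCast_nonneg n
      linarith
    have hX : 0 ≤ (n : ℝ) ^ (2 - 1 / (k : ℝ)) * (max n m : ℝ) ^ (1 / (k : ℝ)) := by positivity
    generalize (n : ℝ) ^ (2 - 1 / (k : ℝ)) * (max n m : ℝ) ^ (1 / (k : ℝ)) = X at h1 hX ⊢
    calc (t : ℝ) ≤ 10000 * (k * (n * n * r * ((Nat.log 2 n + 2 : ℕ) : ℝ) ^ 2)) := ht'
      _ ≤ 10000 * ((a * (1 + Real.log n)) * ((2 * X) * (2 * (1 + Real.log n)) ^ 2)) := by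
        have hk0 : (0 : ℝ) ≤ k := Nat.cast_nonneg k
        gcongr
        exact hk0.trans hka
      _ = _ := by ring
  · rw [← APASP.natDist_coe]
    exact hbd.le u v u.2 v.2
  · have := hgood u u.2 u v p rfl
    -- The upper bound holds along every walk; being shortest only serves to replace the weight of
    -- `p` by the distance.
    rw [hp.2] at this
    simpa [APASP.outputMatrix] using this
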